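/- Let $G$ be a second-countable locally compact group, $A$ a separable $C^*$-algebra, $B$ a $\sigma$-unital $C^*$-algebra, and let $\alpha: G\curvearrowright A$ and $\beta: G\curvearrowright B$ be point-norm continuous actions. We also write $\beta$ for the induced action on the multiplier algebra $\mathcal M(B)$. Assume that $\beta$ is strongly stable, i.e. $(B,\beta)$ is conjugate to $(B\otimes\mathcal K,\beta\otimes\mathrm{id}_{\mathcal K})$, where $\mathcal K$ denotes the compact operators on $\ell^2(\mathbb N)$. Definitions. (a) A cocycle representation $(\phi,u):(A,\alpha)\to(\mathcal M(B),\beta)$ consists of a $*$-homomorphism $\phi:A\to\mathcal M(B)$ and a strictly continuous map $u:G\to\mathcal U(\mathcal M(B))$ with $u_{gh}=u_g\beta_g(u_h)$ and $u_g\beta_g(\phi(a))u_g^*=\phi(\alpha_g(a))$ for all $g,h\in G$, $a\in A$. Two cocycle representations $(\phi,u),(\psi,v)$ form an $(\alpha,\beta)$-Cuntz pair if $\phi(a)-\psi(a)\in B$ and $u_g-v_g\in B$ for all $a\in A$, $g\in G$. A cocycle pair is a Cuntz pair with $\phi=\psi=0$. (b) For isometries $t_1,t_2\in\mathcal M(B)^\beta$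 with $t_1t_1^*+t_2t_2^*=1$ (these exist since $\beta$ is strongly stable), the Cuntz sum is $b_1\oplus b_2=t_1b_1t_1^*+t_2b_2t_2^*$ for $b_1,b_2\in\mathcal M(B)$; Cuntz sums of cocycle representations and of Cuntz pairs are formed pointwise. (c) Let $B[0,1]=C([0,1],B)$ with the pointwise action $\beta[0,1]$. Two $(\alpha,\beta)$-Cuntz pairs are homotopic if some $(\alpha,\beta[0,1])$-Cuntz pair, with values in $\mathcal M(B[0,1])$, restricts to the first one under evaluation at $0$ and to the second one under evaluation at $1$. A Cuntz pair $((\phi,u),(\psi,v))$ is anchored if $((0,u),(0,v))$ is homotopic to $((0,1),(0,1))$. (d) $KK^G(\alpha,\beta)$ is the set of $(\alpha,\beta)$-Cuntz pairs modulo the equivalence relation $\sim$, where $x\sim y$ if $x\oplus d_1$ and $y\oplus d_2$ are homotopic for some cocycle pairs $d_1,d_2$; its zero element is the class of $((0,1),(0,1))$. (e) For a cocycle representation $(\phi,u)$ let \[ D_{(\phi,u)}=\{x\in\mathcal M(B) : x-u_g\beta_g(x)u_g^*\in B \text{ for all } g\in G,\ x\phi(a)-\phi(a)x\in B\text{ for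 all }a\in A\}, \] a unital $C^*$-algebra, and let $\mathcal U_0(D_{(\phi,u)})$ be the connected component of $1$ in its unitary group, in the norm topology. Cocycle representations $(\phi,u)$ and $(\psi,v)$ are operator homotopic if there is $w\in\mathcal U_0(D_{(\phi,u)})$ with $\psi(a)=w\phi(a)w^*$ and $v_g=wu_g\beta_g(w)^*$ for all $a\in A$, $g\in G$. They are stably operator homotopic if there is a cocycle representation $(\kappa,x):(A,\alpha)\to(\mathcal M(B),\beta)$ such that $(\phi,u)\oplus(\kappa,x)$ and $(\psi,v)\oplus(\kappa,x)$ are operator homotopic (for one, equivalently every, choice of $t_1,t_2$ as in (b)). Theorem. Let $(\phi,u),(\psi,v):(A,\alpha)\to(\mathcal M(B),\beta)$ be two cocycle representations that form an anchored $(\alpha,\beta)$-Cuntz pair. If the class $[(\phi,u),(\psi,v)]$ is zero in $KK^G(\alpha,\beta)$, then $(\phi,u)$ and $(\psi,v)$ are stably operator homotopic. -/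

import Mathlib

open scoped MultiplierAlgebra TensorProduct

noncomputable section

namespace CuntzThomsen

/-! ### Actions on C*-algebras and the induced actions on multiplier algebras -/

section Action

variable {G : Type*} [Group G] [TopologicalSpace G]
variable {A : Type*} [NonUnitalCStarAlgebra A] {B : Type*} [NonUnitalCStarAlgebra B]

/-- A *-automorphism of a C*-algebra, as a continuous linear map. -/
def autCLM (σ : B ≃⋆ₐ[ℂ] B) : B →L[ℂ] B where
  toFun := σ
  map_add' := map_add σ
  map_smul' := map_smul σ
  cont := (NonUnitalStarAlgHom.isometry σ σ.injective).continuous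

@[simp] lemma autCLM_apply (σ : B ≃⋆ₐ[ℂ] B) (b : B) : autCLM σ b = σ b := rfl

/-- The canonical extension of a *-automorphism `σ` of `B` to the multiplier algebra `𝓜(ℂ, B)`,
determined by `σ(m) b = σ (m σ⁻¹(b))` and `b σ(m) = σ (σ⁻¹(b) m)`.
For a double centralizer `m`, `m.fst b` is the product `m b` and `m.snd b` is the product `b m`. -/
def extendAut (σ : B ≃⋆ₐ[ℂ] B) : 𝓜(ℂ, B) →⋆ₐ[ℂ] 𝓜(ℂ, B) where
  toFun m :=
    { fst := (autCLM σ).comp (m.fst.comp (autCLM σ.symm))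
      snd := (autCLM σ).comp (m.snd.comp (autCLM σ.symm))
      central := fun x y => by
        have h := congrArg σ (m.central (σ.symm x) (σ.symm y))
        simpa using h }
  map_one' := by
    ext b <;> simp
  map_mul' m n := by
    ext b <;> simp
  map_zero' := by
    ext b <;> simp
  map_add' m n := by
    ext b <;> simp
  commutes' c := by
    ext b <;> simp [Algebra.algebraMap_eq_smul_one]
  map_star' m := by
    ext b <;> simp [map_star]

/-- A continuous action `G ↷ A` by *-automorphisms on a C*-algebra, where continuity is meant
in the point-norm sense. -/
structure CStarAction (G : Type*) [Group G] [TopologicalSpace G]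
    (A : Type*) [NonUnitalCStarAlgebra A] where
  toHom : G →* (A ≃⋆ₐ[ℂ] A)
  continuous_orbit : ∀ a : A, Continuous fun g => toHom g a

/-- The induced action on the multiplier algebra. -/
def CStarAction.mult (β : CStarAction G B) (g : G) : 𝓜(ℂ, B) →⋆ₐ[ℂ] 𝓜(ℂ, B) :=
  extendAut (β.toHom g)

/-- Post-composition with a *-automorphism of `B`, on `B[0,1] = C([0,1], B)`. -/
def cylAut (σ : B ≃⋆ₐ[ℂ] B) : C(unitInterval, B) ≃⋆ₐ[ℂ] C(unitInterval, B) where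
  toFun f := ⟨fun s => σ (f s), (autCLM σ).continuous.comp f.continuous⟩
  invFun f := ⟨fun s => σ.symm (f s), (autCLM σ.symm).continuous.comp f.continuous⟩
  left_inv f := ContinuousMap.ext fun s => σ.symm_apply_apply (f s)
  right_inv f := ContinuousMap.ext fun s => σ.apply_symm_apply (f s)
  map_mul' f h := ContinuousMap.ext fun s => map_mul σ (f s) (h s)
  map_add' f h := ContinuousMap.ext fun s => map_add σ (f s) (h s)
  map_star' f := ContinuousMap.ext fun s => map_star σ (f s)
  map_smul' c f := ContinuousMap.ext fun s => map_smul σ c (f s)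

/-- The action `β[0,1]` on `B[0,1] = C([0,1], B)` given by `β` pointwise. -/
def CStarAction.cyl (β : CStarAction G B) : CStarAction G C(unitInterval, B) where
  toHom :=
    { toFun := fun g => cylAut (β.toHom g)
      map_one' := by
        ext f s
        exact congrArg (fun τ : B ≃⋆ₐ[ℂ] B => τ (f s)) (map_one β.toHom)
      map_mul' := fun g h => by
        ext f s
        exact congrArg (fun τ : B ≃⋆ₐ[ℂ] B => τ (f s)) (map_mul β.toHom g h) }
  continuous_orbit f := by
    refine ContinuousMap.continuous_of_continuous_uncurry _ ?_
    have key : Continuous fun p : G × B => β.toHom p.1 p.2 := by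
      rw [continuous_iff_continuousAt]
      rintro ⟨g, b⟩
      rw [ContinuousAt, tendsto_iff_norm_sub_tendsto_zero]
      have h1 : Filter.Tendsto (fun p : G × B => ‖p.2 - b‖ + ‖β.toHom p.1 b - β.toHom g b‖)
          (nhds (g, b)) (nhds 0) := by
        have hc : Continuous
            fun p : G × B => ‖p.2 - b‖ + ‖β.toHom p.1 b - β.toHom g b‖ :=
          ((continuous_snd.sub continuous_const).norm).add
            ((((β.continuous_orbit b).comp continuous_fst).sub continuous_const).norm)
        simpa using hc.tendsto (g, b)
      refine squeeze_zero (fun _ => norm_nonneg _) (fun p => ?_) h1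
      have h2 : β.toHom p.1 p.2 - β.toHom g b
          = β.toHom p.1 (p.2 - b) + (β.toHom p.1 b - β.toHom g b) := by
        rw [map_sub]; abel
      rw [h2]
      refine (norm_add_le _ _).trans (add_le_add_left (le_of_eq ?_) _)
      exact NonUnitalStarAlgHom.norm_map (β.toHom p.1) (β.toHom p.1).injective _
    exact key.comp (continuous_fst.prodMk (f.continuous.comp continuous_snd))

/-- The constant functions, as a continuous linear map `B → B[0,1]`. -/
def constCLM (B : Type*) [NonUnitalCStarAlgebra B] : B →L[ℂ] C(unitInterval, B) where
  toFun b := ContinuousMap.const unitInterval b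
  map_add' _ _ := rfl
  map_smul' _ _ := rfl
  cont := ContinuousMap.continuous_const'

/-- The canonical extension `𝓜(B[0,1]) → 𝓜(B)` of the evaluation map at `s ∈ [0,1]`,
determined by `ev_s(m) b = (m b)(s)` and `b ev_s(m) = (b m)(s)`, where on the right-hand sides
`b` is regarded as a constant function. -/
def evMult (s : unitInterval) (m : 𝓜(ℂ, C(unitInterval, B))) : 𝓜(ℂ, B) where
  fst := (ContinuousMap.evalCLM ℂ s).comp (m.fst.comp (constCLM B))
  snd := (ContinuousMap.evalCLM ℂ s).comp (m.snd.comp (constCLM B))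
  central x y := by
    have h := congrArg (fun f : C(unitInterval, B) => f s) (m.central (constCLM B x) (constCLM B y))
    exact h

/-- Membership in the ideal `B ⊆ 𝓜(B)`. -/
def InIdeal (m : 𝓜(ℂ, B)) : Prop := ∃ b : B, m = (b : 𝓜(ℂ, B))

lemma eq_of_forall_mul_eq {c d : B} (h : ∀ e : B, e * c = e * d) : c = d := by
  rw [← sub_eq_zero, ← CStarRing.star_mul_self_eq_zero_iff, mul_sub, h, sub_self]

lemma fst_mul (m : 𝓜(ℂ, B)) (c d : B) : m.fst (c * d) = m.fst c * d :=
  eq_of_forall_mul_eq fun e => by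
    rw [← m.central, ← mul_assoc, m.central, mul_assoc]

lemma snd_mul (m : 𝓜(ℂ, B)) (c d : B) : m.snd (c * d) = c * m.snd d := by
  have h := congrArg star (fst_mul (star m) (star d) (star c))
  simpa using h

/-- `B` is `σ`-unital: it has a countable approximate unit. -/
def IsSigmaUnital (B : Type*) [NonUnitalCStarAlgebra B] : Prop :=
  ∃ e : ℕ → B, (∀ n, ‖e n‖ ≤ 1) ∧
    ∀ b : B, Filter.Tendsto (fun n => e n * b) Filter.atTop (nhds b) ∧
      Filter.Tendsto (fun n => b * e n) Filter.atTop (nhds b)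

end Action

/-! ### Strongly stable actions -/

section StronglyStable

/-- The Hilbert space `ℓ²(ℕ)`. -/
abbrev Ell2 : Type := lp (fun _ : ℕ => ℂ) 2

lemma isCompactOperator_star {H : Type*} [NormedAddCommGroup H] [InnerProductSpace ℂ H]
    [CompleteSpace H] {T : H →L[ℂ] H} (hT : IsCompactOperator ⇑T) :
    IsCompactOperator ⇑(star T) := by
  refine (isCompactOperator_iff_isCompact_closure_image_closedBall
    (star T : H →L[ℂ] H).toLinearMap one_pos).mpr ?_
  refine TotallyBounded.isCompact_of_isClosed (TotallyBounded.closure ?_) isClosed_closure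
  have hTT : IsCompactOperator ⇑(T * star T) := hT.comp_clm (star T)
  have h1 := ((isCompactOperator_iff_isCompact_closure_image_closedBall
    (T * star T : H →L[ℂ] H).toLinearMap one_pos).mp hTT).totallyBounded.subset subset_closure
  rw [Metric.totallyBounded_iff]
  intro ε hε
  obtain ⟨t, ht, htf, hcov⟩ :=
    Metric.finite_approx_of_totallyBounded h1 (ε ^ 2 / 2) (by positivity)
  obtain ⟨s, hs, hsf, rfl⟩ := Set.exists_subset_image_finite_and.mp ⟨t, ht, htf, rfl⟩
  refine ⟨⇑(star T) '' s, hsf.image _, ?_⟩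
  rintro _ ⟨v, hv, rfl⟩
  have hmem := hcov ⟨v, hv, rfl⟩
  simp only [Set.mem_iUnion, Set.mem_image, exists_prop] at hmem ⊢
  obtain ⟨_, ⟨z, hz, rfl⟩, hvz⟩ := hmem
  refine ⟨_, ⟨z, hz, rfl⟩, ?_⟩
  have hz' := hs hz
  rw [mem_closedBall_zero_iff] at hv hz'
  rw [Metric.mem_ball, dist_eq_norm] at hvz ⊢
  have e1 : ‖star T (v - z)‖ ^ 2 ≤ ‖(T * star T) (v - z)‖ * ‖v - z‖ := by
    have h2 : ‖star T (v - z)‖ ^ 2 = RCLike.re (inner ℂ ((T * star T) (v - z)) (v - z)) := by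
      rw [← inner_self_eq_norm_sq (𝕜 := ℂ)]
      congr 1
      exact ContinuousLinearMap.adjoint_inner_right T (star T (v - z)) (v - z)
    rw [h2]
    exact (RCLike.re_le_norm _).trans (norm_inner_le_norm _ _)
  have e2 : ‖v - z‖ ≤ 2 := (norm_sub_le _ _).trans (by linarith)
  have e3 : ‖(T * star T) (v - z)‖ < ε ^ 2 / 2 := by
    rw [map_sub]; exact hvz
  have e4 : ‖star T (v - z)‖ ^ 2 < ε ^ 2 := by
    nlinarith [norm_nonneg (v - z), norm_nonneg ((T * star T) (v - z))]
  have e5 := lt_of_pow_lt_pow_left₀ 2 hε.le e4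
  rw [map_sub] at e5
  exact e5

/-- The C*-algebra `𝒦` of compact operators on `ℓ²(ℕ)`. -/
def Kompakt : NonUnitalStarSubalgebra ℂ (Ell2 →L[ℂ] Ell2) where
  carrier := {T | IsCompactOperator T}
  add_mem' := fun hS hT => hS.add hT
  zero_mem' := isCompactOperator_zero
  mul_mem' := fun {_ T} hS _ => hS.comp_clm T
  smul_mem' := fun c _ hT => hT.smul c
  star_mem' := fun hT => isCompactOperator_star hT

variable {G : Type*} [Group G] [TopologicalSpace G]
variable {B : Type*} [NonUnitalCStarAlgebra B] {C : Type*} [NonUnitalCStarAlgebra C]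

/-- `(C, γ)` is conjugate to `(B ⊗ 𝒦, β ⊗ id)`: the C*-algebra `C` is a C*-completion of the
algebraic tensor product `B ⊙ 𝒦`, in such a way that `γ` extends `β ⊙ id`.
(As `𝒦` is nuclear, `B ⊗ 𝒦` is the only C*-completion of `B ⊙ 𝒦`.) -/
def IsStabilization (β : CStarAction G B) (γ : CStarAction G C) : Prop :=
  ∃ Θ : (B ⊗[ℂ] Kompakt) →⋆ₙₐ[ℂ] C, Function.Injective Θ ∧ DenseRange Θ ∧
    ∀ (g : G) (b : B) (k : Kompakt), Θ ((β.toHom g b) ⊗ₜ[ℂ] k) = γ.toHom g (Θ (b ⊗ₜ[ℂ] k))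

/-- `β` is strongly stable: `(B, β)` is conjugate to `(B ⊗ 𝒦, β ⊗ id)`. -/
def StronglyStable (β : CStarAction G B) : Prop := IsStabilization β β

end StronglyStable

/-! ### Cocycle representations -/

section CocycleRep

variable {G : Type*} [Group G] [TopologicalSpace G]
variable {A : Type*} [NonUnitalCStarAlgebra A] {B : Type*} [NonUnitalCStarAlgebra B]

/-- A cocycle representation `(φ, 𝕦) : (A, α) → (𝓜(B), β)`. -/
structure CocycleRep (α : CStarAction G A) (β : CStarAction G B) where
  /-- the *-homomorphism `φ` -/
  hom : A →⋆ₙₐ[ℂ] 𝓜(ℂ, B)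
  /-- the cocycle `𝕦` -/
  coc : G → 𝓜(ℂ, B)
  coc_mem_unitary : ∀ g, coc g ∈ unitary 𝓜(ℂ, B)
  /-- strict continuity: `g ↦ 𝕦_g b` and `g ↦ b 𝕦_g` are norm continuous for `b ∈ B` -/
  strict_left : ∀ b : B, Continuous fun g => (coc g).fst b
  strict_right : ∀ b : B, Continuous fun g => (coc g).snd b
  coc_mul : ∀ g h, coc (g * h) = coc g * β.mult g (coc h)
  covariant : ∀ g a, coc g * β.mult g (hom a) * star (coc g) = hom (α.toHom g a)

/-- A pair of isometries `t₁, t₂ ∈ 𝓜(B)^β` with `t₁ t₁* + t₂ t₂* = 1`. -/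
structure CuntzIsometries (β : CStarAction G B) where
  t₁ : 𝓜(ℂ, B)
  t₂ : 𝓜(ℂ, B)
  fixed₁ : ∀ g, β.mult g t₁ = t₁
  fixed₂ : ∀ g, β.mult g t₂ = t₂
  isom₁ : star t₁ * t₁ = 1
  isom₂ : star t₂ * t₂ = 1
  sum_range : t₁ * star t₁ + t₂ * star t₂ = 1

namespace CuntzIsometries

variable {β : CStarAction G B} (t : CuntzIsometries β)

lemma orth₁ : star t.t₁ * t.t₂ = 0 := by
  have h : star t.t₁ * (t.t₁ * star t.t₁ + t.t₂ * star t.t₂) * t.t₂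
      = star t.t₁ * t.t₂ + star t.t₁ * t.t₂ := by
    rw [mul_add, add_mul, ← mul_assoc, t.isom₁, one_mul, mul_assoc, mul_assoc, t.isom₂, mul_one]
  rw [t.sum_range, mul_one] at h
  exact left_eq_add.mp h

lemma orth₂ : star t.t₂ * t.t₁ = 0 := by
  have h := congrArg star t.orth₁
  simpa using h

/-- The Cuntz sum `b₁ ⊕ b₂ = t₁ b₁ t₁* + t₂ b₂ t₂*` in `𝓜(B)`. -/
def sum (b₁ b₂ : 𝓜(ℂ, B)) : 𝓜(ℂ, B) :=
  t.t₁ * b₁ * star t.t₁ + t.t₂ * b₂ * star t.t₂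

lemma sum_mul (a b c d : 𝓜(ℂ, B)) : t.sum a b * t.sum c d = t.sum (a * c) (b * d) := by
  have e (x y p q r s : 𝓜(ℂ, B)) : p * x * star q * (r * y * star s)
      = p * x * (star q * r) * y * star s := by simp only [mul_assoc]
  simp only [sum, add_mul, mul_add, e, t.isom₁, t.isom₂, t.orth₁, t.orth₂]
  simp [mul_assoc]

lemma sum_star (a b : 𝓜(ℂ, B)) : star (t.sum a b) = t.sum (star a) (star b) := by
  simp [sum, mul_assoc]

lemma sum_one : t.sum 1 1 = 1 := by
  simp [sum, t.sum_range]

lemma sum_act (g : G) (a b : 𝓜(ℂ, B)) :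
    β.mult g (t.sum a b) = t.sum (β.mult g a) (β.mult g b) := by
  simp [sum, map_star, t.fixed₁, t.fixed₂]

lemma sum_inIdeal {a b : 𝓜(ℂ, B)} (ha : InIdeal a) (hb : InIdeal b) : InIdeal (t.sum a b) := by
  obtain ⟨a, rfl⟩ := ha
  obtain ⟨b, rfl⟩ := hb
  have key (p : 𝓜(ℂ, B)) (c : B) :
      p * (c : 𝓜(ℂ, B)) * star p = ((star p).snd (p.fst c) : B) := by
    ext d
    · change p.fst (c * (star p).fst d) = (star p).snd (p.fst c) * d
      rw [fst_mul, (star p).central]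
    · change (star p).snd (p.snd d * c) = d * (star p).snd (p.fst c)
      rw [p.central, snd_mul]
  refine ⟨(star t.t₁).snd (t.t₁.fst a) + (star t.t₂).snd (t.t₂.fst b), ?_⟩
  rw [sum, key, key]
  ext d
  · simp
  · simp

lemma sum_sub (a b c d : 𝓜(ℂ, B)) : t.sum a b - t.sum c d = t.sum (a - c) (b - d) := by
  simp only [sum, mul_sub, sub_mul]; abel

end CuntzIsometries

namespace CocycleRep

variable {α : CStarAction G A} {β : CStarAction G B}

/-- The Cuntz sum of two cocycle representations, formed pointwise. -/
def cuntzSum (t : CuntzIsometries β) (x y : CocycleRep α β) : CocycleRep α β where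
  hom :=
    { toFun := fun a => t.sum (x.hom a) (y.hom a)
      map_smul' := fun c a => by simp [CuntzIsometries.sum]
      map_zero' := by simp [CuntzIsometries.sum]
      map_add' := fun a b => by simp only [CuntzIsometries.sum, map_add, mul_add, add_mul]; abel
      map_mul' := fun a b => by rw [t.sum_mul, map_mul, map_mul]
      map_star' := fun a => by rw [t.sum_star, map_star, map_star] }
  coc g := t.sum (x.coc g) (y.coc g)
  coc_mem_unitary g := by
    have hx := Unitary.mem_iff.mp (x.coc_mem_unitary g)
    have hy := Unitary.mem_iff.mp (y.coc_mem_unitary g)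
    rw [Unitary.mem_iff, t.sum_star, t.sum_mul, t.sum_mul, hx.1, hx.2, hy.1, hy.2, t.sum_one]
    exact ⟨rfl, rfl⟩
  strict_left b := by
    have h (p : 𝓜(ℂ, B)) (z : CocycleRep α β) :
        Continuous fun g => p.fst ((z.coc g).fst ((star p).fst b)) :=
      p.fst.continuous.comp (z.strict_left _)
    exact (h t.t₁ x).add (h t.t₂ y)
  strict_right b := by
    have h (p : 𝓜(ℂ, B)) (z : CocycleRep α β) :
        Continuous fun g => (star p).snd ((z.coc g).snd (p.snd b)) :=
      (star p).snd.continuous.comp (z.strict_right _)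
    exact (h t.t₁ x).add (h t.t₂ y)
  coc_mul g h := by rw [x.coc_mul, y.coc_mul, t.sum_act, t.sum_mul]
  covariant g a := by
    change t.sum _ _ * β.mult g (t.sum _ _) * star (t.sum _ _) = t.sum _ _
    rw [t.sum_act, t.sum_star, t.sum_mul, t.sum_mul, x.covariant, y.covariant]

/-- The cocycle representation `(0, 𝕦)` with the same cocycle. -/
def zeroHom (x : CocycleRep α β) : CocycleRep α β where
  hom := 0
  coc := x.coc
  coc_mem_unitary := x.coc_mem_unitary
  strict_left := x.strict_left
  strict_right := x.strict_right
  coc_mul := x.coc_mul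
  covariant g a := by simp

/-- The zero representation `(0, 1)`. -/
def zero (α : CStarAction G A) (β : CStarAction G B) : CocycleRep α β where
  hom := 0
  coc := fun _ => 1
  coc_mem_unitary _ := one_mem _
  strict_left _ := continuous_const
  strict_right _ := continuous_const
  coc_mul g h := by simp
  covariant g a := by simp

/-- `x = ev_s ∘ X` for a cocycle representation `X : (A, α) → (𝓜(B[0,1]), β[0,1])`. -/
def EvalsTo (s : unitInterval) (X : CocycleRep α β.cyl) (x : CocycleRep α β) : Prop :=
  (∀ a, evMult s (X.hom a) = x.hom a) ∧ ∀ g, evMult s (X.coc g) = x.coc g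

end CocycleRep

end CocycleRep

/-! ### Cuntz pairs and equivariant KK-theory -/

section KK

variable {G : Type*} [Group G] [TopologicalSpace G]
variable {A : Type*} [NonUnitalCStarAlgebra A] {B : Type*} [NonUnitalCStarAlgebra B]

/-- The cocycle representations `(φ, 𝕦)` and `(ψ, 𝕧)` form a Cuntz pair: `φ - ψ` and `𝕦 - 𝕧`
take values in `B`. -/
structure IsCuntzPair {α : CStarAction G A} {β : CStarAction G B} (x y : CocycleRep α β) :
    Prop where
  hom_sub : ∀ a, InIdeal (x.hom a - y.hom a)
  coc_sub : ∀ g, InIdeal (x.coc g - y.coc g)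

/-- The set `𝔼^G(α, β)` of all `(α, β)`-Cuntz pairs, for strongly stable `β`. -/
structure CuntzPair (α : CStarAction G A) (β : CStarAction G B) where
  left : CocycleRep α β
  right : CocycleRep α β
  isCuntzPair : IsCuntzPair left right

namespace CuntzPair

variable {α : CStarAction G A} {β : CStarAction G B}

/-- The degenerate Cuntz pair `0 = ((0, 1), (0, 1))`. -/
def zero (α : CStarAction G A) (β : CStarAction G B) : CuntzPair α β where
  left := .zero α β
  right := .zero α β
  isCuntzPair := ⟨fun _ => ⟨0, by ext <;> simp⟩, fun _ => ⟨0, by ext <;> simp⟩⟩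

/-- A cocycle pair is a Cuntz pair of the form `((0, 𝕦), (0, 𝕧))`. -/
def IsCocyclePair (p : CuntzPair α β) : Prop := p.left.hom = 0 ∧ p.right.hom = 0

/-- The cocycle pair `((0, 𝕦), (0, 𝕧))` associated to `((φ, 𝕦), (ψ, 𝕧))`. -/
def cocyclePair (p : CuntzPair α β) : CuntzPair α β where
  left := p.left.zeroHom
  right := p.right.zeroHom
  isCuntzPair :=
    ⟨fun _ => ⟨0, by ext <;> simp [CocycleRep.zeroHom]⟩, p.isCuntzPair.coc_sub⟩

/-- The Cuntz sum of two Cuntz pairs. -/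
def cuntzSum (t : CuntzIsometries β) (p q : CuntzPair α β) : CuntzPair α β where
  left := p.left.cuntzSum t q.left
  right := p.right.cuntzSum t q.right
  isCuntzPair :=
    ⟨fun a => by
      change InIdeal (t.sum _ _ - t.sum _ _)
      rw [t.sum_sub]
      exact t.sum_inIdeal (p.isCuntzPair.hom_sub a) (q.isCuntzPair.hom_sub a),
    fun g => by
      change InIdeal (t.sum _ _ - t.sum _ _)
      rw [t.sum_sub]
      exact t.sum_inIdeal (p.isCuntzPair.coc_sub g) (q.isCuntzPair.coc_sub g)⟩

/-- Homotopy of Cuntz pairs: there is an `(α, β[0,1])`-Cuntz pair which evaluates to `p` at `0`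
and to `q` at `1`. -/
def Homotopic (p q : CuntzPair α β) : Prop :=
  ∃ P : CuntzPair α β.cyl,
    P.left.EvalsTo 0 p.left ∧ P.right.EvalsTo 0 p.right ∧
    P.left.EvalsTo 1 q.left ∧ P.right.EvalsTo 1 q.right

/-- A Cuntz pair is anchored if its cocycle pair is homotopic to `(1, 1)`. -/
def Anchored (p : CuntzPair α β) : Prop := p.cocyclePair.Homotopic (zero α β)

/-- `p ~ q` if `p ⊕ d₁` and `q ⊕ d₂` are homotopic for some cocycle pairs `d₁, d₂`. -/
def Equivalent (p q : CuntzPair α β) : Prop :=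
  ∃ (t : CuntzIsometries β) (d₁ d₂ : CuntzPair α β), d₁.IsCocyclePair ∧ d₂.IsCocyclePair ∧
    (p.cuntzSum t d₁).Homotopic (q.cuntzSum t d₂)

end CuntzPair

/-- `KK^G(α, β)` in the Cuntz--Thomsen picture, for strongly stable `β`: Cuntz pairs modulo `~`. -/
def KKG (α : CStarAction G A) (β : CStarAction G B) : Type _ :=
  Quot (CuntzPair.Equivalent (α := α) (β := β))

/-- The class of a Cuntz pair in `KK^G(α, β)`. -/
def KKG.mk {α : CStarAction G A} {β : CStarAction G B} (p : CuntzPair α β) : KKG α β :=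
  Quot.mk _ p

instance (α : CStarAction G A) (β : CStarAction G B) : Zero (KKG α β) :=
  ⟨KKG.mk (CuntzPair.zero α β)⟩

end KK

/-! ### Operator homotopy -/

section OperatorHomotopy

variable {G : Type*} [Group G] [TopologicalSpace G]
variable {A : Type*} [NonUnitalCStarAlgebra A] {B : Type*} [NonUnitalCStarAlgebra B]
variable {α : CStarAction G A} {β : CStarAction G B}

namespace CocycleRep

/-- The C*-algebra `D_{(φ, 𝕦)}` of all `m ∈ 𝓜(B)` with `m - 𝕦_g β_g(m) 𝕦_g* ∈ B` for `g ∈ G` and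
`[m, φ(a)] ∈ B` for `a ∈ A`. -/
def dualSet (x : CocycleRep α β) : Set 𝓜(ℂ, B) :=
  {m | (∀ g, InIdeal (m - x.coc g * β.mult g m * star (x.coc g))) ∧
    ∀ a, InIdeal (m * x.hom a - x.hom a * m)}

/-- The connected component of `1` in the unitary group of `D_{(φ, 𝕦)}`, with respect to the
norm topology. -/
def dualUnitaryComponent (x : CocycleRep α β) : Set 𝓜(ℂ, B) :=
  connectedComponentIn {w | w ∈ unitary 𝓜(ℂ, B) ∧ w ∈ x.dualSet} 1

/-- `y = ad(w) ∘ x`, that is, `ψ = w φ(·) w*` and `𝕧_g = w 𝕦_g β_g(w)*`. -/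
def IsConjugate (w : 𝓜(ℂ, B)) (x y : CocycleRep α β) : Prop :=
  (∀ a, y.hom a = w * x.hom a * star w) ∧ ∀ g, y.coc g = w * x.coc g * star (β.mult g w)

/-- Operator homotopy of cocycle representations. -/
def OperatorHomotopic (x y : CocycleRep α β) : Prop :=
  ∃ w ∈ x.dualUnitaryComponent, IsConjugate w x y

/-- Stable operator homotopy of cocycle representations, for strongly stable `β`. The Cuntz sums
may be formed with any choice of isometries, and such isometries exist. -/
def StablyOperatorHomotopic (x y : CocycleRep α β) : Prop :=
  Nonempty (CuntzIsometries β) ∧ ∃ z : CocycleRep α β, ∀ t : CuntzIsometries β,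
    OperatorHomotopic (x.cuntzSum t z) (y.cuntzSum t z)

end CocycleRep

end OperatorHomotopy

end CuntzThomsen

end

open scoped MultiplierAlgebra TensorProduct

noncomputable section

set_option linter.unusedSectionVars false

namespace CuntzThomsen

/-! ### The ideal `B` in its multiplier algebra -/

section Ideal

variable {B : Type*} [NonUnitalCStarAlgebra B]

/-! A Cuntz pair `(x, y)` is a pair of representations for which the unit of `𝓜(B)` is a unitary
intertwiner modulo `B`. An operator homotopy from `x` to `y` is a path from this unit, through
unitary intertwiners modulo `B`, to an exact intertwiner. This suggests working with all triples
(source, target, unitary intertwiner modulo `B`), identified under exact unitary equivalence. Cuntz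
sums make their classes a commutative semigroup. A class is trivial if its unitary is homotopic to
an exact intertwiner, and stably trivial if it becomes so after adding an identity. Whitehead's
rotation makes `c + -c` stably trivial, and stably trivial summands can be cancelled
(`IsStablyTrivial.of_add`). Stable triviality of the class of `(x, y)` is what the theorem needs
(`operatorHomotopic_of_isStablyTrivial`).

The core is homotopy invariance (`isStablyTrivial_of_homotopic`): homotopic pairs `p`, `q` have `[p]
- [q]` stably trivial. Given this, `[p]` minus the class of the cocycle pair of `p` has a stable
triviality that depends only on the class of `p` in `KKG`, since a summand `d` that is a cocycle
pair contributes to both terms. For a pair of class zero it is therefore stably trivial, and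
anchoring together with homotopy invariance disposes of the cocycle pair.

Homotopy invariance is a swindle. Let `(X, Y)` be the homotopy. Over the index set of all `(k, q)`,
with `q` rational in `[0, 1)`, take the sum of `X(q) ⊕ Y(W k q)` as source and of `Y(q) ⊕ X(W k q)`
as target. Here `W k` moves the multiples of `2⁻ᵏ` to the right by `2⁻ᵏ` and fixes the other points.
At moved points use the rotation with cosine `√(1 - e k)` and sine `√(e k)`, where `e` is a
quasicentral approximate unit. At fixed points use the exact rotation by a right angle. This is an
intertwiner modulo `B`: `1 - e k` nearly kills `X - Y`, which takes values in `B[0,1]`, while `e k`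
nearly kills the effect of the small displacement. The required `e` exists because `B` is
`σ`-unital, `A` is separable and `G` is `σ`-compact.

Since `e 0 = 0`, the entry at `(0, 0)` is the identity from `X(0) ⊕ Y(1)` to `Y(0) ⊕ X(1)`, that is
`[p] - [q]`. The rest of row `0` is exact, and the remaining rows form the same construction with
all levels raised by one. A change of the angles, followed by a homotopy to an involution that
interchanges neighbouring dyadic points, shows that raising the levels does not change the stable
class. Cancelling the tail leaves `[p] - [q]`.

The infinite sums are formed with isometries supplied by strong stability (`exists_isoFrame`). -/

lemma mul_coe (m : 𝓜(ℂ, B)) (b : B) : m * (b : 𝓜(ℂ, B)) = (m.fst b : B) := by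
  ext d
  · exact fst_mul m b d
  · exact m.central d b

lemma coe_mul (m : 𝓜(ℂ, B)) (b : B) : (b : 𝓜(ℂ, B)) * m = (m.snd b : B) := by
  ext d
  · exact (m.central b d).symm
  · exact snd_mul m d b

lemma coe_add (b c : B) : ((b + c : B) : 𝓜(ℂ, B)) = b + c := map_add DoubleCentralizer.coeHom b c
lemma coe_sub (b c : B) : ((b - c : B) : 𝓜(ℂ, B)) = b - c := map_sub DoubleCentralizer.coeHom b c
lemma coe_star (b : B) : ((star b : B) : 𝓜(ℂ, B)) = star (b : 𝓜(ℂ, B)) :=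
  map_star DoubleCentralizer.coeHom b
lemma coe_mul_coe (b c : B) : ((b * c : B) : 𝓜(ℂ, B)) = b * c :=
  map_mul DoubleCentralizer.coeHom b c
lemma coe_smul (r : ℂ) (b : B) : ((r • b : B) : 𝓜(ℂ, B)) = r • (b : 𝓜(ℂ, B)) :=
  map_smul DoubleCentralizer.coeHom r b
lemma coe_zero : ((0 : B) : 𝓜(ℂ, B)) = 0 := map_zero DoubleCentralizer.coeHom

lemma coe_injective : Function.Injective fun b : B => (b : 𝓜(ℂ, B)) := fun b c h => by
  refine eq_of_forall_mul_eq fun e => ?_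
  have := congrArg (fun m : 𝓜(ℂ, B) => m.snd e) h
  simpa using this

lemma norm_coe (b : B) : ‖(b : 𝓜(ℂ, B))‖ = ‖b‖ :=
  NonUnitalStarAlgHom.norm_map (DoubleCentralizer.coeHom : B →⋆ₙₐ[ℂ] 𝓜(ℂ, B)) coe_injective b

lemma inIdeal_coe (b : B) : InIdeal (b : 𝓜(ℂ, B)) := ⟨b, rfl⟩

namespace InIdeal

variable {m n : 𝓜(ℂ, B)}

lemma zero : InIdeal (0 : 𝓜(ℂ, B)) := ⟨0, coe_zero.symm⟩

lemma add (hm : InIdeal m) (hn : InIdeal n) : InIdeal (m + n) := by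
  obtain ⟨b, rfl⟩ := hm
  obtain ⟨c, rfl⟩ := hn
  exact ⟨b + c, (coe_add b c).symm⟩

lemma mul_left (k : 𝓜(ℂ, B)) (hm : InIdeal m) : InIdeal (k * m) := by
  obtain ⟨b, rfl⟩ := hm
  exact ⟨_, mul_coe k b⟩

lemma mul_right (k : 𝓜(ℂ, B)) (hm : InIdeal m) : InIdeal (m * k) := by
  obtain ⟨b, rfl⟩ := hm
  exact ⟨_, coe_mul k b⟩

lemma smul (r : ℂ) (hm : InIdeal m) : InIdeal (r • m) := by
  obtain ⟨b, rfl⟩ := hm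
  exact ⟨_, (coe_smul r b).symm⟩

lemma neg (hm : InIdeal m) : InIdeal (-m) := by
  simpa using hm.smul (-1)

lemma sub (hm : InIdeal m) (hn : InIdeal n) : InIdeal (m - n) := by
  rw [sub_eq_add_neg]
  exact hm.add hn.neg

lemma star (hm : InIdeal m) : InIdeal (star m) := by
  obtain ⟨b, rfl⟩ := hm
  exact ⟨_, (coe_star b).symm⟩

lemma sum {ι : Type*} {s : Finset ι} {f : ι → 𝓜(ℂ, B)} (h : ∀ i ∈ s, InIdeal (f i)) :
    InIdeal (∑ i ∈ s, f i) :=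
  Finset.sum_induction f InIdeal (fun _ _ => add) zero h

variable (B) in
lemma isClosed : IsClosed {m : 𝓜(ℂ, B) | InIdeal m} := by
  have h : {m : 𝓜(ℂ, B) | InIdeal m} = Set.range fun b : B => (b : 𝓜(ℂ, B)) := by
    ext m
    exact ⟨fun ⟨b, hb⟩ => ⟨b, hb.symm⟩, fun ⟨b, hb⟩ => ⟨b, hb.symm⟩⟩
  rw [h]
  refine (Isometry.isClosedEmbedding ?_).isClosed_range
  exact AddMonoidHomClass.isometry_of_norm (DoubleCentralizer.coeHom : B →⋆ₙₐ[ℂ] 𝓜(ℂ, B)) norm_coe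

lemma of_approx (h : ∀ ε > 0, ∃ n, InIdeal n ∧ ‖m - n‖ ≤ ε) : InIdeal m := by
  refine (isClosed B).closure_subset (Metric.mem_closure_iff.mpr fun ε hε => ?_)
  obtain ⟨n, hn, hmn⟩ := h (ε / 2) (by positivity)
  exact ⟨n, hn, by rw [dist_eq_norm]; linarith⟩

/-- An element `m` of `𝓜(B)` with `m* m ∈ B` lies in `B`. -/
lemma of_star_mul_self (hB : IsSigmaUnital B) (h : InIdeal (Star.star m * m)) : InIdeal m := by
  obtain ⟨e, he, hb⟩ := hB
  obtain ⟨c, hc⟩ := h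
  -- The square of `m - m eₙ` is `(1 - eₙ*) (c - c eₙ)` with `c = m* m` in `B`. Hence `m` is the
  -- norm limit of the elements `m eₙ` of the ideal.
  have h1 (n : ℕ) : ‖m - m * (e n : 𝓜(ℂ, B))‖ ^ 2 ≤ 2 * ‖c - c * e n‖ := by
    have h2 : Star.star (m - m * (e n : 𝓜(ℂ, B))) * (m - m * (e n : 𝓜(ℂ, B)))
        = (1 - Star.star (e n : 𝓜(ℂ, B))) * ((c - c * e n : B) : 𝓜(ℂ, B)) := by
      rw [coe_sub, coe_mul_coe, ← hc, star_sub, star_mul]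
      noncomm_ring
    have h3 : ‖(1 : 𝓜(ℂ, B)) - Star.star (e n : 𝓜(ℂ, B))‖ ≤ 2 := by
      refine (norm_sub_le _ _).trans ?_
      rw [norm_star, norm_coe]
      have : ‖(1 : 𝓜(ℂ, B))‖ ≤ 1 := by
        rcases subsingleton_or_nontrivial 𝓜(ℂ, B) with h | h
        · simp [Subsingleton.elim (1 : 𝓜(ℂ, B)) 0]
        · exact (CStarRing.norm_one).le
      linarith [he n]
    rw [sq, ← CStarRing.norm_star_mul_self, h2, ← norm_coe (c - c * e n)]
    exact (norm_mul_le _ _).trans (by gcongr)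
  have h4 : Filter.Tendsto (fun n => m * (e n : 𝓜(ℂ, B))) Filter.atTop (nhds m) := by
    rw [tendsto_iff_norm_sub_tendsto_zero]
    have h5 : Filter.Tendsto (fun n => √(2 * ‖c - c * e n‖)) Filter.atTop (nhds 0) := by
      have h6 : Filter.Tendsto (fun n => c - c * e n) Filter.atTop (nhds 0) := by
        simpa using (tendsto_const_nhds (x := c)).sub (hb c).2
      have := ((h6.norm.const_mul 2).sqrt)
      simpa using this
    refine squeeze_zero (fun _ => norm_nonneg _) (fun n => ?_) h5
    rw [norm_sub_rev]
    exact Real.le_sqrt_of_sq_le (h1 n)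
  exact (isClosed B).mem_of_tendsto h4
    (Filter.Eventually.of_forall fun n => (inIdeal_coe _).mul_left m)

end InIdeal

lemma norm_one_le : ‖(1 : 𝓜(ℂ, B))‖ ≤ 1 := by
  rcases subsingleton_or_nontrivial 𝓜(ℂ, B) with h | h
  · simp [Subsingleton.elim (1 : 𝓜(ℂ, B)) 0]
  · exact (CStarRing.norm_one).le

lemma norm_le_one_of_isometry {m : 𝓜(ℂ, B)} (h : star m * m = 1) : ‖m‖ ≤ 1 := by
  have h1 : ‖m‖ * ‖m‖ ≤ 1 := by
    rw [← CStarRing.norm_star_mul_self, h]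
    exact norm_one_le
  nlinarith [norm_nonneg m]

lemma norm_le_one_of_unitary {m : 𝓜(ℂ, B)} (h : m ∈ unitary 𝓜(ℂ, B)) : ‖m‖ ≤ 1 :=
  norm_le_one_of_isometry h.1

variable {G : Type*} [Group G] [TopologicalSpace G]

lemma mult_coe (β : CStarAction G B) (g : G) (b : B) :
    β.mult g (b : 𝓜(ℂ, B)) = (β.toHom g b : B) := by
  ext d
  · change β.toHom g (b * (β.toHom g).symm d) = β.toHom g b * d
    simp
  · change β.toHom g ((β.toHom g).symm d * b) = d * β.toHom g b
    simp

end Ideal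

/-! ### Intertwiners of cocycle representations modulo `B` -/

section Intertwiner

variable {G : Type*} [Group G] [TopologicalSpace G]
variable {A : Type*} [NonUnitalCStarAlgebra A] {B : Type*} [NonUnitalCStarAlgebra B]
variable {α : CStarAction G A} {β : CStarAction G B}

/-- The values of a cocycle representation on the elements of `A` and of `G`. -/
def CocycleRep.val (x : CocycleRep α β) : A ⊕ G → 𝓜(ℂ, B) := Sum.elim x.hom x.coc

/-- The endomorphism of `𝓜(B)` occurring in the intertwining relation: the identity for elements
of `A` and `β_g` for `g ∈ G`. -/
def twist (A : Type*) (β : CStarAction G B) : A ⊕ G → (𝓜(ℂ, B) →⋆ₐ[ℂ] 𝓜(ℂ, B)) :=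
  Sum.elim (fun _ => StarAlgHom.id ℂ _) β.mult

lemma twist_continuous (τ : A ⊕ G) : Continuous (twist A β τ) :=
  (AddMonoidHomClass.continuous_of_bound (twist A β τ) 1 fun m => by
    simpa using NonUnitalStarAlgHom.norm_apply_le (twist A β τ) m)

/-- `m` intertwines `x` and `y` modulo `B`. -/
def IsHom (x y : CocycleRep α β) (m : 𝓜(ℂ, B)) : Prop :=
  ∀ τ, InIdeal (m * x.val τ - y.val τ * twist A β τ m)

/-- `m` intertwines `x` and `y`. -/
def IsExact (x y : CocycleRep α β) (m : 𝓜(ℂ, B)) : Prop :=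
  ∀ τ, m * x.val τ = y.val τ * twist A β τ m

/-- `m` is fixed by the action. -/
def IsFixed (β : CStarAction G B) (m : 𝓜(ℂ, B)) : Prop := ∀ g, β.mult g m = m

lemma IsFixed.twist_eq {m : 𝓜(ℂ, B)} (h : IsFixed β m) (τ : A ⊕ G) : twist A β τ m = m := by
  rcases τ with a | g
  · rfl
  · exact h g

lemma IsFixed.mul {m n : 𝓜(ℂ, B)} (h : IsFixed β m) (h' : IsFixed β n) : IsFixed β (m * n) :=
  fun g => by rw [map_mul, h g, h' g]

lemma IsFixed.add {m n : 𝓜(ℂ, B)} (h : IsFixed β m) (h' : IsFixed β n) : IsFixed β (m + n) :=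
  fun g => by rw [map_add, h g, h' g]

lemma IsFixed.smul {m : 𝓜(ℂ, B)} (r : ℂ) (h : IsFixed β m) : IsFixed β (r • m) :=
  fun g => by rw [map_smul, h g]

lemma IsFixed.one : IsFixed β (1 : 𝓜(ℂ, B)) := fun _ => map_one _

variable {x y z : CocycleRep α β} {m n : 𝓜(ℂ, B)}

lemma IsExact.isHom (h : IsExact x y m) : IsHom x y m := fun τ => by
  rw [h τ, sub_self]
  exact InIdeal.zero

lemma IsExact.one : IsExact x x (1 : 𝓜(ℂ, B)) := fun τ => by simp

lemma IsHom.mul (hn : IsHom y z n) (hm : IsHom x y m) : IsHom x z (n * m) := fun τ => by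
  have h : n * m * x.val τ - z.val τ * twist A β τ (n * m)
      = n * (m * x.val τ - y.val τ * twist A β τ m)
        + (n * y.val τ - z.val τ * twist A β τ n) * twist A β τ m := by
    rw [map_mul]; noncomm_ring
  rw [h]
  exact ((hm τ).mul_left n).add ((hn τ).mul_right _)

lemma IsExact.mul (hn : IsExact y z n) (hm : IsExact x y m) : IsExact x z (n * m) := fun τ => by
  rw [mul_assoc, hm τ, ← mul_assoc, hn τ, mul_assoc, map_mul]

lemma IsHom.add (hm : IsHom x y m) (hn : IsHom x y n) : IsHom x y (m + n) := fun τ => by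
  have h : (m + n) * x.val τ - y.val τ * twist A β τ (m + n)
      = (m * x.val τ - y.val τ * twist A β τ m) + (n * x.val τ - y.val τ * twist A β τ n) := by
    rw [map_add]; noncomm_ring
  rw [h]
  exact (hm τ).add (hn τ)

lemma IsHom.smul (r : ℂ) (hm : IsHom x y m) : IsHom x y (r • m) := fun τ => by
  have h : (r • m) * x.val τ - y.val τ * twist A β τ (r • m)
      = r • (m * x.val τ - y.val τ * twist A β τ m) := by
    rw [map_smul, smul_sub, smul_mul_assoc, mul_smul_comm]
  rw [h]
  exact (hm τ).smul r

lemma IsHom.neg (hm : IsHom x y m) : IsHom x y (-m) := by simpa using hm.smul (-1)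

lemma IsHom.sub (hm : IsHom x y m) (hn : IsHom x y n) : IsHom x y (m - n) := by
  simpa [sub_eq_add_neg] using hm.add hn.neg

lemma CocycleRep.coc_mul_star (x : CocycleRep α β) (g : G) : x.coc g * star (x.coc g) = 1 :=
  (x.coc_mem_unitary g).2

lemma CocycleRep.star_mul_coc (x : CocycleRep α β) (g : G) : star (x.coc g) * x.coc g = 1 :=
  (x.coc_mem_unitary g).1

lemma CocycleRep.star_hom_star (x : CocycleRep α β) (a : A) : star (x.hom (star a)) = x.hom a := by
  rw [map_star, star_star]

/-- For `a` in `A` one takes adjoints of the relation at `a*`. For `g` in `G` the adjoint relation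
is multiplied by the cocycle of `x` on the left and that of `y` on the right, which moves both
adjoint cocycles to the other side. -/
lemma IsHom.star (hm : IsHom x y m) : IsHom y x (star m) := by
  rintro (a | g)
  · have h := (hm (.inl (Star.star a))).star.neg
    convert h using 1
    simp [CocycleRep.val, twist, x.star_hom_star, y.star_hom_star]
  · have h := ((hm (.inr g)).star.mul_left (x.coc g)).mul_right (y.coc g)
    convert h using 1
    simp only [CocycleRep.val, twist, Sum.elim_inr, star_sub, star_mul, mul_sub, sub_mul, map_star]
    rw [← mul_assoc, x.coc_mul_star, one_mul, mul_assoc (x.coc g), mul_assoc (Star.star _),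
      y.star_mul_coc, mul_one]

lemma IsExact.star (hm : IsExact x y m) : IsExact y x (star m) := by
  rintro (a | g)
  · have h := congrArg Star.star (hm (.inl (Star.star a)))
    simpa [CocycleRep.val, twist, x.star_hom_star, y.star_hom_star] using h.symm
  · have h := congrArg Star.star (hm (.inr g))
    simp only [CocycleRep.val, twist, Sum.elim_inr, star_mul] at h ⊢
    have h1 : x.coc g * (Star.star (x.coc g) * Star.star m) * y.coc g
      = x.coc g * (Star.star (β.mult g m) * Star.star (y.coc g)) * y.coc g := by rw [h]
    rw [← mul_assoc, x.coc_mul_star, one_mul, mul_assoc (x.coc g), mul_assoc (Star.star _),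
      y.star_mul_coc, mul_one] at h1
    rw [map_star, h1]

lemma IsHom.isClosed (x y : CocycleRep α β) : IsClosed {m | IsHom x y m} := by
  have h : {m | IsHom x y m}
      = ⋂ τ, (fun m => m * x.val τ - y.val τ * twist A β τ m) ⁻¹' {m | InIdeal m} := by
    ext m
    simp [IsHom]
  rw [h]
  refine isClosed_iInter fun τ => (InIdeal.isClosed B).preimage ?_
  exact (continuous_id.mul continuous_const).sub
    (continuous_const.mul (twist_continuous τ))

/-- The unitaries that intertwine `x` and `y` modulo `B`. -/
def unitaryHom (x y : CocycleRep α β) : Set 𝓜(ℂ, B) := {m | m ∈ unitary 𝓜(ℂ, B) ∧ IsHom x y m}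

end Intertwiner

section MatrixCalculus

variable {G : Type*} [Group G] [TopologicalSpace G]
variable {A : Type*} [NonUnitalCStarAlgebra A] {B : Type*} [NonUnitalCStarAlgebra B]
variable {α : CStarAction G A} {β : CStarAction G B}

/-! ### Two-by-two matrices with respect to a pair of isometries -/

namespace CuntzIsometries

variable (t : CuntzIsometries β)

lemma isom₁_assoc (m : 𝓜(ℂ, B)) : star t.t₁ * (t.t₁ * m) = m := by
  rw [← mul_assoc, t.isom₁, one_mul]

lemma isom₂_assoc (m : 𝓜(ℂ, B)) : star t.t₂ * (t.t₂ * m) = m := by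
  rw [← mul_assoc, t.isom₂, one_mul]

lemma orth₁_assoc (m : 𝓜(ℂ, B)) : star t.t₁ * (t.t₂ * m) = 0 := by
  rw [← mul_assoc, t.orth₁, zero_mul]

lemma orth₂_assoc (m : 𝓜(ℂ, B)) : star t.t₂ * (t.t₁ * m) = 0 := by
  rw [← mul_assoc, t.orth₂, zero_mul]

lemma eq_of_mul_eq {m n : 𝓜(ℂ, B)} (h₁ : m * t.t₁ = n * t.t₁) (h₂ : m * t.t₂ = n * t.t₂) :
    m = n := by
  rw [← mul_one m, ← mul_one n, ← t.sum_range, mul_add, mul_add, ← mul_assoc, ← mul_assoc,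
    ← mul_assoc, ← mul_assoc, h₁, h₂]

/-- The element of `𝓜(B)` given by a two-by-two matrix over `𝓜(B)`. -/
def mat (a b c d : 𝓜(ℂ, B)) : 𝓜(ℂ, B) :=
  t.t₁ * a * star t.t₁ + t.t₁ * b * star t.t₂ + t.t₂ * c * star t.t₁ + t.t₂ * d * star t.t₂

lemma sum_eq_mat (a b : 𝓜(ℂ, B)) : t.sum a b = t.mat a 0 0 b := by simp [sum, mat]

lemma mat_mul_t₁ (a b c d : 𝓜(ℂ, B)) : t.mat a b c d * t.t₁ = t.t₁ * a + t.t₂ * c := by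
  simp [mat, add_mul, mul_assoc, t.isom₁, t.orth₂]

lemma mat_mul_t₂ (a b c d : 𝓜(ℂ, B)) : t.mat a b c d * t.t₂ = t.t₁ * b + t.t₂ * d := by
  simp [mat, add_mul, mul_assoc, t.isom₂, t.orth₁]

lemma mat_mul (a b c d a' b' c' d' : 𝓜(ℂ, B)) : t.mat a b c d * t.mat a' b' c' d'
    = t.mat (a * a' + b * c') (a * b' + b * d') (c * a' + d * c') (c * b' + d * d') := by
  refine t.eq_of_mul_eq ?_ ?_
  · rw [mul_assoc, mat_mul_t₁, mat_mul_t₁, mul_add, ← mul_assoc, ← mul_assoc, mat_mul_t₁,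
      mat_mul_t₂]
    noncomm_ring
  · rw [mul_assoc, mat_mul_t₂, mat_mul_t₂, mul_add, ← mul_assoc, ← mul_assoc, mat_mul_t₁,
      mat_mul_t₂]
    noncomm_ring

lemma mat_star (a b c d : 𝓜(ℂ, B)) :
    star (t.mat a b c d) = t.mat (star a) (star c) (star b) (star d) := by
  simp only [mat, star_add, star_mul, star_star, mul_assoc]
  abel

lemma mat_one : t.mat 1 0 0 1 = 1 := by rw [← sum_eq_mat, sum_one]

lemma mat_sub (a b c d a' b' c' d' : 𝓜(ℂ, B)) : t.mat a b c d - t.mat a' b' c' d'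
    = t.mat (a - a') (b - b') (c - c') (d - d') := by
  simp only [mat]
  noncomm_ring

lemma mat_twist (τ : A ⊕ G) (a b c d : 𝓜(ℂ, B)) : twist A β τ (t.mat a b c d)
    = t.mat (twist A β τ a) (twist A β τ b) (twist A β τ c) (twist A β τ d) := by
  have h₁ : twist A β τ t.t₁ = t.t₁ := IsFixed.twist_eq t.fixed₁ τ
  have h₂ : twist A β τ t.t₂ = t.t₂ := IsFixed.twist_eq t.fixed₂ τ
  simp only [mat, map_add, map_mul, map_star, h₁, h₂]

lemma mat_inIdeal {a b c d : 𝓜(ℂ, B)} (ha : InIdeal a) (hb : InIdeal b) (hc : InIdeal c)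
    (hd : InIdeal d) : InIdeal (t.mat a b c d) :=
  ((((ha.mul_left _).mul_right _).add ((hb.mul_left _).mul_right _)).add
    ((hc.mul_left _).mul_right _)).add ((hd.mul_left _).mul_right _)

lemma continuous_mat {X : Type*} [TopologicalSpace X] {a b c d : X → 𝓜(ℂ, B)}
    (ha : Continuous a) (hb : Continuous b) (hc : Continuous c) (hd : Continuous d) :
    Continuous fun s => t.mat (a s) (b s) (c s) (d s) := by
  unfold mat
  fun_prop

end CuntzIsometries

variable (t : CuntzIsometries β)

lemma CocycleRep.val_cuntzSum (x y : CocycleRep α β) (τ : A ⊕ G) :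
    (x.cuntzSum t y).val τ = t.mat (x.val τ) 0 0 (y.val τ) := by
  rw [← t.sum_eq_mat]
  rcases τ with a | g <;> rfl

section Mat

variable {x₁ x₂ y₁ y₂ : CocycleRep α β} {a b c d : 𝓜(ℂ, B)}

lemma IsHom.mat (ha : IsHom x₁ y₁ a) (hb : IsHom x₂ y₁ b) (hc : IsHom x₁ y₂ c)
    (hd : IsHom x₂ y₂ d) :
    IsHom (x₁.cuntzSum t x₂) (y₁.cuntzSum t y₂) (t.mat a b c d) := fun τ => by
  rw [CocycleRep.val_cuntzSum, CocycleRep.val_cuntzSum, t.mat_twist, t.mat_mul, t.mat_mul,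
    t.mat_sub]
  apply t.mat_inIdeal
  · simpa using ha τ
  · simpa using hb τ
  · simpa using hc τ
  · simpa using hd τ

lemma IsExact.mat (ha : IsExact x₁ y₁ a) (hb : IsExact x₂ y₁ b) (hc : IsExact x₁ y₂ c)
    (hd : IsExact x₂ y₂ d) :
    IsExact (x₁.cuntzSum t x₂) (y₁.cuntzSum t y₂) (t.mat a b c d) := fun τ => by
  rw [CocycleRep.val_cuntzSum, CocycleRep.val_cuntzSum, t.mat_twist, t.mat_mul, t.mat_mul]
  simp [ha τ, hb τ, hc τ, hd τ]

lemma IsExact.zero (x y : CocycleRep α β) : IsExact x y (0 : 𝓜(ℂ, B)) := fun τ => by simp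

lemma IsExact.neg {x y : CocycleRep α β} (h : IsExact x y a) : IsExact x y (-a) := fun τ => by
  simp [h τ]

lemma isExact_t₁ (x y : CocycleRep α β) : IsExact x (x.cuntzSum t y) t.t₁ := fun τ => by
  rw [CocycleRep.val_cuntzSum, IsFixed.twist_eq t.fixed₁, t.mat_mul_t₁, mul_zero, add_zero]

lemma isExact_t₂ (x y : CocycleRep α β) : IsExact y (x.cuntzSum t y) t.t₂ := fun τ => by
  rw [CocycleRep.val_cuntzSum, IsFixed.twist_eq t.fixed₂, t.mat_mul_t₂, mul_zero, zero_add]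

lemma CuntzIsometries.sum_mem_unitary (ha : a ∈ unitary 𝓜(ℂ, B)) (hb : b ∈ unitary 𝓜(ℂ, B)) :
    t.sum a b ∈ unitary 𝓜(ℂ, B) := by
  rw [Unitary.mem_iff, t.sum_star, t.sum_mul, t.sum_mul, ha.1, ha.2, hb.1, hb.2, t.sum_one]
  exact ⟨rfl, rfl⟩

lemma unitaryHom_sum (ha : a ∈ unitaryHom x₁ y₁) (hb : b ∈ unitaryHom x₂ y₂) :
    t.sum a b ∈ unitaryHom (x₁.cuntzSum t x₂) (y₁.cuntzSum t y₂) := by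
  refine ⟨t.sum_mem_unitary ha.1 hb.1, ?_⟩
  rw [t.sum_eq_mat]
  exact IsHom.mat t ha.2 (IsExact.zero _ _).isHom (IsExact.zero _ _).isHom hb.2

lemma IsExact.sum (ha : IsExact x₁ y₁ a) (hb : IsExact x₂ y₂ b) :
    IsExact (x₁.cuntzSum t x₂) (y₁.cuntzSum t y₂) (t.sum a b) := by
  rw [t.sum_eq_mat]
  exact IsExact.mat t ha (IsExact.zero _ _) (IsExact.zero _ _) hb

end Mat

/-! ### Paths of unitary intertwiners -/

section Joined

variable {x y z x' y' : CocycleRep α β} {m m' n n' : 𝓜(ℂ, B)}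

lemma unitaryHom_mul (hn : n ∈ unitaryHom y z) (hm : m ∈ unitaryHom x y) :
    n * m ∈ unitaryHom x z := ⟨mul_mem hn.1 hm.1, hn.2.mul hm.2⟩

lemma unitaryHom_star (hm : m ∈ unitaryHom x y) : star m ∈ unitaryHom y x :=
  ⟨Unitary.star_mem hm.1, hm.2.star⟩

lemma joinedIn_mul (hn : JoinedIn (unitaryHom y z) n n') (hm : JoinedIn (unitaryHom x y) m m') :
    JoinedIn (unitaryHom x z) (n * m) (n' * m') :=
  (hn.mul hm).mono (Set.mul_subset_iff.mpr fun _ h _ h' => unitaryHom_mul h h')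

lemma joinedIn_star (hm : JoinedIn (unitaryHom x y) m m') :
    JoinedIn (unitaryHom y x) (star m) (star m') :=
  (hm.map continuous_star).mono (Set.image_subset_iff.mpr fun _ h => unitaryHom_star h)

lemma joinedIn_sum (hm : JoinedIn (unitaryHom x y) m m')
    (hn : JoinedIn (unitaryHom x' y') n n') :
    JoinedIn (unitaryHom (x.cuntzSum t x') (y.cuntzSum t y')) (t.sum m n) (t.sum m' n') := by
  have hf : Continuous fun p : 𝓜(ℂ, B) × 𝓜(ℂ, B) => t.sum p.1 p.2 := by
    unfold CuntzIsometries.sum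
    fun_prop
  refine ((hm.prod hn).map hf).mono ?_
  rintro _ ⟨p, hp, rfl⟩
  exact unitaryHom_sum t hp.1 hp.2

end Joined

/-! ### Unitary intertwiners modulo `B`, up to exact unitary equivalence -/

/-- A unitary in `𝓜(B)` that intertwines two cocycle representations modulo `B`. -/
structure ModUnitary (α : CStarAction G A) (β : CStarAction G B) where
  src : CocycleRep α β
  tgt : CocycleRep α β
  u : 𝓜(ℂ, B)
  mem : u ∈ unitaryHom src tgt

namespace ModUnitary

/-- The identity of `x`. -/
def id (x : CocycleRep α β) : ModUnitary α β := ⟨x, x, 1, one_mem _, IsExact.one.isHom⟩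

/-- The direct sum. -/
def add (p q : ModUnitary α β) : ModUnitary α β where
  src := p.src.cuntzSum t q.src
  tgt := p.tgt.cuntzSum t q.tgt
  u := t.sum p.u q.u
  mem := unitaryHom_sum t p.mem q.mem

/-- The adjoint. -/
def symm (p : ModUnitary α β) : ModUnitary α β := ⟨p.tgt, p.src, star p.u, unitaryHom_star p.mem⟩

/-- Equivalence through exact unitary intertwiners. -/
def Iso (p q : ModUnitary α β) : Prop :=
  ∃ a b : 𝓜(ℂ, B), a ∈ unitary 𝓜(ℂ, B) ∧ b ∈ unitary 𝓜(ℂ, B) ∧ IsExact p.src q.src a ∧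
    IsExact p.tgt q.tgt b ∧ q.u * a = b * p.u

variable {p q r p' q' : ModUnitary α β}

lemma Iso.refl (p : ModUnitary α β) : Iso p p :=
  ⟨1, 1, one_mem _, one_mem _, IsExact.one, IsExact.one, by simp⟩

lemma Iso.symm (h : Iso p q) : Iso q p := by
  obtain ⟨a, b, ha, hb, ha', hb', h⟩ := h
  refine ⟨star a, star b, Unitary.star_mem ha, Unitary.star_mem hb, ha'.star, hb'.star, ?_⟩
  calc p.u * star a = star b * (b * p.u) * star a := by rw [← mul_assoc, hb.1, one_mul]
    _ = star b * q.u * (a * star a) := by rw [← h]; simp only [mul_assoc]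
    _ = star b * q.u := by rw [ha.2, mul_one]

lemma Iso.trans (h : Iso p q) (h' : Iso q r) : Iso p r := by
  obtain ⟨a, b, ha, hb, ha', hb', h⟩ := h
  obtain ⟨c, d, hc, hd, hc', hd', h'⟩ := h'
  refine ⟨c * a, d * b, mul_mem hc ha, mul_mem hd hb, hc'.mul ha', hd'.mul hb', ?_⟩
  rw [← mul_assoc, h', mul_assoc, h, mul_assoc]

lemma Iso.add (h : Iso p p') (h' : Iso q q') : Iso (p.add t q) (p'.add t q') := by
  obtain ⟨a, b, ha, hb, ha', hb', h⟩ := h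
  obtain ⟨c, d, hc, hd, hc', hd', h'⟩ := h'
  refine ⟨t.sum a c, t.sum b d, t.sum_mem_unitary ha hc, t.sum_mem_unitary hb hd,
    ha'.sum t hc', hb'.sum t hd', ?_⟩
  simp only [ModUnitary.add, t.sum_mul, h, h']

lemma Iso.symm_congr (h : Iso p q) : Iso p.symm q.symm := by
  obtain ⟨a, b, ha, hb, ha', hb', h⟩ := h.symm
  refine ⟨star b, star a, Unitary.star_mem hb, Unitary.star_mem ha, hb'.star, ha'.star, ?_⟩
  have := congrArg star h
  simpa [ModUnitary.symm] using this.symm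

/-- The unitary exchanging the two summands. -/
lemma Iso.add_comm (p q : ModUnitary α β) : Iso (p.add t q) (q.add t p) := by
  have hu : t.mat 0 1 1 0 ∈ unitary 𝓜(ℂ, B) := by
    rw [Unitary.mem_iff, t.mat_star]
    simp [t.mat_mul, t.mat_one]
  refine ⟨t.mat 0 1 1 0, t.mat 0 1 1 0, hu, hu,
    IsExact.mat t (IsExact.zero _ _) IsExact.one IsExact.one (IsExact.zero _ _),
    IsExact.mat t (IsExact.zero _ _) IsExact.one IsExact.one (IsExact.zero _ _), ?_⟩
  simp [ModUnitary.add, t.sum_eq_mat, t.mat_mul]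

/-- The unitary changing the order of summation. -/
lemma Iso.add_assoc (p q r : ModUnitary α β) :
    Iso ((p.add t q).add t r) (p.add t (q.add t r)) := by
  have hu : t.mat (star t.t₁) 0 (t.t₁ * star t.t₂) t.t₂ ∈ unitary 𝓜(ℂ, B) := by
    rw [Unitary.mem_iff, t.mat_star, t.mat_mul, t.mat_mul]
    simp [mul_assoc, t.isom₁, t.isom₂, t.orth₁, t.orth₂, t.isom₁_assoc, t.sum_range, t.mat_one,
      t.isom₂_assoc, t.orth₁_assoc, t.orth₂_assoc]
  have he (x y z : CocycleRep α β) : IsExact ((x.cuntzSum t y).cuntzSum t z)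
      (x.cuntzSum t (y.cuntzSum t z)) (t.mat (star t.t₁) 0 (t.t₁ * star t.t₂) t.t₂) :=
    IsExact.mat t (isExact_t₁ t _ _).star (IsExact.zero _ _)
      ((isExact_t₁ t _ _).mul (isExact_t₂ t _ _).star) (isExact_t₂ t _ _)
  refine ⟨_, _, hu, hu, he _ _ _, he _ _ _, ?_⟩
  simp only [ModUnitary.add, t.sum_eq_mat, t.mat_mul]
  congr 1 <;> simp [CuntzIsometries.mat, mul_assoc, add_mul, mul_add, t.isom₂, t.orth₁,
    t.isom₁_assoc, t.isom₂_assoc, t.orth₁_assoc, t.orth₂_assoc]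

/-- Cuntz sums formed with different isometries are equivalent. -/
lemma Iso.add_change (t' : CuntzIsometries β) (p q : ModUnitary α β) :
    Iso (p.add t q) (p.add t' q) := by
  have h1 : (t'.t₁ * star t.t₁ + t'.t₂ * star t.t₂) * t.t₁ = t'.t₁ := by
    simp [add_mul, mul_assoc, t.isom₁, t.orth₂]
  have h2 : (t'.t₁ * star t.t₁ + t'.t₂ * star t.t₂) * t.t₂ = t'.t₂ := by
    simp [add_mul, mul_assoc, t.isom₂, t.orth₁]
  have hu : t'.t₁ * star t.t₁ + t'.t₂ * star t.t₂ ∈ unitary 𝓜(ℂ, B) := by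
    rw [Unitary.mem_iff]
    constructor
    · refine t.eq_of_mul_eq ?_ ?_ <;>
      simp [mul_assoc, add_mul, mul_add, t.isom₁, t.isom₂, t.orth₁, t.orth₂, t'.isom₁_assoc,
        t'.isom₂_assoc, t'.orth₁_assoc, t'.orth₂_assoc]
    · simp [mul_assoc, add_mul, mul_add, t.isom₁_assoc, t.isom₂_assoc, t.orth₁_assoc,
        t.orth₂_assoc, t'.sum_range]
  have he (x y : CocycleRep α β) : IsExact (x.cuntzSum t y) (x.cuntzSum t' y)
      (t'.t₁ * star t.t₁ + t'.t₂ * star t.t₂) := fun τ => by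
    have e1 := ((isExact_t₁ t' x y).mul (isExact_t₁ t x y).star) τ
    have e2 := ((isExact_t₂ t' x y).mul (isExact_t₂ t x y).star) τ
    rw [add_mul, e1, e2, map_add, mul_add]
  refine ⟨_, _, hu, hu, he _ _, he _ _, ?_⟩
  change t'.sum p.u q.u * _ = _ * t.sum p.u q.u
  rw [t.sum_eq_mat, t'.sum_eq_mat]
  refine t.eq_of_mul_eq ?_ ?_
  · rw [mul_assoc, h1, mul_assoc, t.mat_mul_t₁, t'.mat_mul_t₁, mul_add, ← mul_assoc, h1,
      ← mul_assoc, h2]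
  · rw [mul_assoc, h2, mul_assoc, t.mat_mul_t₂, t'.mat_mul_t₂, mul_add, ← mul_assoc, h1,
      ← mul_assoc, h2]

/-- `p` is homotopic to an exact intertwiner. -/
def HomotopicToExact (p : ModUnitary α β) : Prop :=
  ∃ w, IsExact p.src p.tgt w ∧ JoinedIn (unitaryHom p.src p.tgt) p.u w

lemma HomotopicToExact.congr (hp : HomotopicToExact p) (h : Iso p q) : HomotopicToExact q := by
  obtain ⟨a, b, ha, hb, ha', hb', h⟩ := h
  obtain ⟨w, hw, hj⟩ := hp
  refine ⟨b * w * star a, (hb'.mul hw).mul ha'.star, ?_⟩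
  have h1 : q.u = b * p.u * star a := by rw [← h, mul_assoc, ha.2, mul_one]
  rw [h1]
  exact joinedIn_mul (joinedIn_mul (JoinedIn.refl ⟨hb, hb'.isHom⟩) hj)
    (JoinedIn.refl ⟨Unitary.star_mem ha, ha'.star.isHom⟩)

lemma HomotopicToExact.of_isExact (h : IsExact p.src p.tgt p.u) : HomotopicToExact p :=
  ⟨p.u, h, JoinedIn.refl p.mem⟩

lemma HomotopicToExact.add (hp : HomotopicToExact p) (hq : HomotopicToExact q) :
    HomotopicToExact (p.add t q) := by
  obtain ⟨w, hw, hj⟩ := hp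
  obtain ⟨w', hw', hj'⟩ := hq
  exact ⟨t.sum w w', hw.sum t hw', joinedIn_sum t hj hj'⟩

/-- Composing the path for `p ⊕ q` with the sum of `1` and the adjoint of the path for `q` turns the
second component into `q.u* q.u = 1`, with target `q.src` again. The end point remains exact. -/
lemma HomotopicToExact.cancel (hq : HomotopicToExact q) (hpq : HomotopicToExact (p.add t q)) :
    HomotopicToExact (p.add t (id q.src)) := by
  obtain ⟨w, hw, hj⟩ := hq
  obtain ⟨v, hv, hj'⟩ := hpq
  have h1 : JoinedIn (unitaryHom (p.tgt.cuntzSum t q.tgt) (p.tgt.cuntzSum t q.src))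
      (t.sum 1 (star q.u)) (t.sum 1 (star w)) :=
    joinedIn_sum t (JoinedIn.refl ⟨one_mem _, IsExact.one.isHom⟩) (joinedIn_star hj)
  have h2 := joinedIn_mul h1 hj'
  refine ⟨t.sum 1 (star w) * v, ((IsExact.sum t IsExact.one hw.star).mul hv), ?_⟩
  have h3 : t.sum 1 (star q.u) * (p.add t q).u = (p.add t (id q.src)).u := by
    simp only [ModUnitary.add, t.sum_mul, one_mul, id, q.mem.1.1]
  rw [h3] at h2
  exact h2

/-- Whitehead's rotation. -/
lemma HomotopicToExact.add_symm (p : ModUnitary α β) : HomotopicToExact (p.add t p.symm) := by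
  have hpp := p.mem.1.1
  have hpp' := p.mem.1.2
  -- The end point has entries `±1` off the diagonal. It is exact because the second summand has
  -- source and target interchanged. The path has cosines times `u` and `u*` on the diagonal.
  refine ⟨t.mat 0 1 (-1) 0,
    IsExact.mat t (IsExact.zero _ _) IsExact.one IsExact.one.neg (IsExact.zero _ _), ?_⟩
  let f : ℝ → 𝓜(ℂ, B) := fun s => t.mat
    ((Real.cos (Real.pi / 2 * s) : ℂ) • p.u) ((Real.sin (Real.pi / 2 * s) : ℂ) • 1)
    (-((Real.sin (Real.pi / 2 * s) : ℂ) • 1)) ((Real.cos (Real.pi / 2 * s) : ℂ) • star p.u)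
  refine JoinedIn.ofLine (f := f) (Continuous.continuousOn ?_) ?_ ?_ ?_
  · refine t.continuous_mat ?_ ?_ ?_ ?_ <;> fun_prop
  · simp [f, ModUnitary.add, t.sum_eq_mat, symm]
  · simp [f]
  · rintro _ ⟨s, -, rfl⟩
    have hcs := Real.cos_sq_add_sin_sq (Real.pi / 2 * s)
    have hcs' : (Real.cos (Real.pi / 2 * s) : ℂ) * (Real.cos (Real.pi / 2 * s) : ℂ)
        + (Real.sin (Real.pi / 2 * s) : ℂ) * (Real.sin (Real.pi / 2 * s) : ℂ) = 1 := by
      rw [← sq, ← sq]; exact_mod_cast hcs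
    refine ⟨?_, ?_⟩
    · simp only [f]
      generalize (Real.cos (Real.pi / 2 * s)) = c at hcs' ⊢
      generalize (Real.sin (Real.pi / 2 * s)) = d at hcs' ⊢
      rw [Unitary.mem_iff, t.mat_star, t.mat_mul, t.mat_mul]
      simp only [star_smul, star_star, star_neg, star_one, smul_mul_smul_comm, hpp, hpp', mul_one,
        one_mul, neg_mul, mul_neg, RCLike.star_def, Complex.conj_ofReal, ← add_smul,
        mul_comm (d : ℂ) (c : ℂ)]
      simp [neg_neg, ← add_smul, hcs', add_comm ((d : ℂ) * d), t.mat_one]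
    · exact IsHom.mat t (p.mem.2.smul _) (IsExact.one.isHom.smul _)
        (IsExact.one.isHom.smul _).neg (p.symm.mem.2.smul _)

variable (α) in
/-- Equivalence of `ModUnitary`s. The isometries `t` determine the sum. -/
def isoSetoid (_ : CuntzIsometries β) : Setoid (ModUnitary α β) where
  r := Iso
  iseqv := ⟨Iso.refl, Iso.symm, Iso.trans⟩

end ModUnitary

open ModUnitary

variable (α) in
/-- Equivalence classes of unitary intertwiners modulo `B`. -/
def ModClass (t : CuntzIsometries β) : Type _ := Quotient (isoSetoid α t)

namespace ModClass

/-- The class of a unitary intertwiner modulo `B`. -/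
def mk (p : ModUnitary α β) : ModClass α t := Quotient.mk (isoSetoid α t) p

instance : AddCommSemigroup (ModClass α t) where
  add := Quotient.map₂ (ModUnitary.add t) fun _ _ h _ _ h' => Iso.add t h h'
  add_assoc := by
    rintro ⟨p⟩ ⟨q⟩ ⟨r⟩
    exact Quotient.sound (s := isoSetoid α t) (Iso.add_assoc t p q r)
  add_comm := by
    rintro ⟨p⟩ ⟨q⟩
    exact Quotient.sound (s := isoSetoid α t) (Iso.add_comm t p q)

/-- This is not an inverse: `c + -c` is only stably trivial. -/
instance : Neg (ModClass α t) where
  neg := Quotient.map ModUnitary.symm fun _ _ h => h.symm_congr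

variable {t}

lemma mk_eq {p q : ModUnitary α β} (h : Iso p q) : mk t p = mk t q :=
  Quotient.sound (s := isoSetoid α t) h

lemma mk_add (p q : ModUnitary α β) : mk t (p.add t q) = mk t p + mk t q := rfl

lemma mk_symm (p : ModUnitary α β) : mk t p.symm = -mk t p := rfl

lemma neg_neg (c : ModClass α t) : -(-c) = c := by
  induction c using Quotient.inductionOn with | _ p
  refine mk_eq ⟨1, 1, one_mem _, one_mem _, IsExact.one, IsExact.one, ?_⟩
  simp [ModUnitary.symm]

lemma neg_add (c d : ModClass α t) : -(c + d) = -c + -d := by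
  induction c using Quotient.inductionOn with | _ p
  induction d using Quotient.inductionOn with | _ q
  refine mk_eq ⟨1, 1, one_mem _, one_mem _, IsExact.one, IsExact.one, ?_⟩
  simp [ModUnitary.symm, ModUnitary.add, t.sum_star]

/-- The class contains an element homotopic to an exact intertwiner. -/
def IsTrivial (c : ModClass α t) : Prop := ∃ p, HomotopicToExact p ∧ mk t p = c

lemma isTrivial_mk {p : ModUnitary α β} : IsTrivial (mk t p) ↔ HomotopicToExact p :=
  ⟨fun ⟨_, hq, h⟩ => hq.congr (Quotient.exact h), fun h => ⟨p, h, rfl⟩⟩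

/-- The class becomes trivial after adding an identity. -/
def IsStablyTrivial (c : ModClass α t) : Prop := ∃ z, IsTrivial (c + mk t (ModUnitary.id z))

lemma IsTrivial.add {c d : ModClass α t} (hc : IsTrivial c) (hd : IsTrivial d) :
    IsTrivial (c + d) := by
  obtain ⟨p, hp, rfl⟩ := hc
  obtain ⟨q, hq, rfl⟩ := hd
  exact ⟨p.add t q, hp.add t hq, rfl⟩

lemma isTrivial_id (z : CocycleRep α β) : IsTrivial (mk t (ModUnitary.id z)) :=
  ⟨_, HomotopicToExact.of_isExact IsExact.one, rfl⟩

lemma IsTrivial.isStablyTrivial {c : ModClass α t} (hc : IsTrivial c) : IsStablyTrivial c :=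
  ⟨CocycleRep.zero α β, hc.add (isTrivial_id _)⟩

lemma id_add_id (z z' : CocycleRep α β) :
    mk t (ModUnitary.id z) + mk t (ModUnitary.id z') = mk t (ModUnitary.id (z.cuntzSum t z')) := by
  refine mk_eq ⟨1, 1, one_mem _, one_mem _, IsExact.one, IsExact.one, ?_⟩
  simp [ModUnitary.id, ModUnitary.add, t.sum_one]

lemma IsStablyTrivial.add {c d : ModClass α t} (hc : IsStablyTrivial c)
    (hd : IsStablyTrivial d) : IsStablyTrivial (c + d) := by
  obtain ⟨z, hz⟩ := hc
  obtain ⟨z', hz'⟩ := hd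
  refine ⟨z.cuntzSum t z', ?_⟩
  rw [← id_add_id, add_add_add_comm]
  exact hz.add hz'

lemma isStablyTrivial_add_neg (c : ModClass α t) : IsStablyTrivial (c + -c) := by
  induction c using Quotient.inductionOn with | _ p
  exact IsTrivial.isStablyTrivial ⟨_, HomotopicToExact.add_symm t p, rfl⟩

/-- Both stabilising identities are absorbed into `d`. Then `d` and `c + d` have trivial
representatives, and `HomotopicToExact.cancel` replaces `d` by the identity of its source. -/
lemma IsStablyTrivial.of_add {c d : ModClass α t} (hcd : IsStablyTrivial (c + d))
    (hd : IsStablyTrivial d) : IsStablyTrivial c := by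
  obtain ⟨z, hz⟩ := hcd
  obtain ⟨z', hz'⟩ := hd
  induction c using Quotient.inductionOn with | _ p
  induction d using Quotient.inductionOn with | _ q
  have h1 : HomotopicToExact (q.add t (ModUnitary.id (z.cuntzSum t z'))) := by
    rw [← isTrivial_mk (t := t), mk_add, ← id_add_id, add_left_comm]
    exact (isTrivial_id z).add hz'
  have h2 : HomotopicToExact (p.add t (q.add t (ModUnitary.id (z.cuntzSum t z')))) := by
    rw [← isTrivial_mk (t := t), mk_add, mk_add, ← id_add_id, ← add_assoc, ← add_assoc]
    exact hz.add (isTrivial_id z')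
  exact ⟨_, isTrivial_mk.mpr (HomotopicToExact.cancel t h1 h2)⟩

/-- Homotopic unitaries represent the same stable class. -/
lemma isStablyTrivial_of_joinedIn {x y : CocycleRep α β} {a b : 𝓜(ℂ, B)} {c : ModClass α t}
    (hj : JoinedIn (unitaryHom x y) a b) (ha : a ∈ unitaryHom x y) (hb : b ∈ unitaryHom x y)
    (h : IsStablyTrivial (mk t ⟨x, y, b, hb⟩ + c)) : IsStablyTrivial (mk t ⟨x, y, a, ha⟩ + c) := by
  obtain ⟨z, hz⟩ := h
  induction c using Quotient.inductionOn with | _ r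
  refine ⟨z, ?_⟩
  obtain ⟨w, hw, hj'⟩ := isTrivial_mk.mp hz
  refine ⟨(ModUnitary.add t ⟨x, y, a, ha⟩ r).add t (.id z), ⟨w, hw, ?_⟩, rfl⟩
  refine JoinedIn.trans ?_ hj'
  exact joinedIn_sum t (joinedIn_sum t hj (JoinedIn.refl r.mem))
    (JoinedIn.refl (ModUnitary.id z).mem)

end ModClass

end MatrixCalculus

/-! ### Infinite direct sums -/

section Strict

variable {B : Type*} [NonUnitalCStarAlgebra B] {ι : Type*}

lemma eq_of_fst_eq {m n : 𝓜(ℂ, B)} (h : ∀ b, m.fst b = n.fst b) : m = n := by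
  have h1 : ‖(m - n).fst‖ = 0 := by
    rw [norm_eq_zero]
    ext b
    simp [h b]
  rwa [DoubleCentralizer.norm_fst, norm_eq_zero, sub_eq_zero] at h1

lemma norm_fst_le (m : 𝓜(ℂ, B)) (b : B) : ‖m.fst b‖ ≤ ‖m‖ * ‖b‖ := by
  rw [← DoubleCentralizer.norm_fst]
  exact m.fst.le_opNorm b

lemma norm_snd_le (m : 𝓜(ℂ, B)) (b : B) : ‖m.snd b‖ ≤ ‖m‖ * ‖b‖ := by
  rw [← DoubleCentralizer.norm_snd]
  exact m.snd.le_opNorm b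

lemma sum_fst (s : Finset ι) (S : ι → 𝓜(ℂ, B)) (b : B) :
    (∑ i ∈ s, S i).fst b = ∑ i ∈ s, (S i).fst b := by
  classical
  induction s using Finset.induction_on with
  | empty => simp
  | insert i s hi ih => simp [Finset.sum_insert hi, ih]

lemma sum_snd (s : Finset ι) (S : ι → 𝓜(ℂ, B)) (b : B) :
    (∑ i ∈ s, S i).snd b = ∑ i ∈ s, (S i).snd b := by
  classical
  induction s using Finset.induction_on with
  | empty => simp
  | insert i s hi ih => simp [Finset.sum_insert hi, ih]

/-- A strictly summable family in `𝓜(B)` with bounded partial sums has a strict sum. -/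
lemma exists_strict_sum (S : ι → 𝓜(ℂ, B)) (C : ℝ) (hC : ∀ s : Finset ι, ‖∑ i ∈ s, S i‖ ≤ C)
    (h₁ : ∀ b, Summable fun i => (S i).fst b) (h₂ : ∀ b, Summable fun i => (S i).snd b) :
    ∃ m : 𝓜(ℂ, B), ‖m‖ ≤ C ∧ ∀ b, HasSum (fun i => (S i).fst b) (m.fst b) := by
  have hC0 : 0 ≤ C := (norm_nonneg _).trans (hC ∅)
  have n₁ (b : B) : ‖∑' i, (S i).fst b‖ ≤ C * ‖b‖ := by
    refine le_of_tendsto (h₁ b).hasSum.norm (Filter.Eventually.of_forall fun s => ?_)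
    rw [← sum_fst]
    exact (norm_fst_le _ _).trans (by gcongr; exact hC s)
  have n₂ (b : B) : ‖∑' i, (S i).snd b‖ ≤ C * ‖b‖ := by
    refine le_of_tendsto (h₂ b).hasSum.norm (Filter.Eventually.of_forall fun s => ?_)
    rw [← sum_snd]
    exact (norm_snd_le _ _).trans (by gcongr; exact hC s)
  let f₁ : B →ₗ[ℂ] B :=
    { toFun := fun b => ∑' i, (S i).fst b
      map_add' := fun b c => by simp only [map_add]; exact (h₁ b).tsum_add (h₁ c)
      map_smul' := fun r b => by
        simp only [map_smul, RingHom.id_apply]; exact (h₁ b).tsum_const_smul r }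
  let f₂ : B →ₗ[ℂ] B :=
    { toFun := fun b => ∑' i, (S i).snd b
      map_add' := fun b c => by simp only [map_add]; exact (h₂ b).tsum_add (h₂ c)
      map_smul' := fun r b => by
        simp only [map_smul, RingHom.id_apply]; exact (h₂ b).tsum_const_smul r }
  let m : 𝓜(ℂ, B) :=
    { fst := f₁.mkContinuous C n₁
      snd := f₂.mkContinuous C n₂
      central := fun x y => by
        change (∑' i, (S i).snd x) * y = x * ∑' i, (S i).fst y
        rw [← (h₂ x).tsum_mul_right, ← (h₁ y).tsum_mul_left]
        exact tsum_congr fun i => (S i).central x y }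
  refine ⟨m, ?_, fun b => (h₁ b).hasSum⟩
  rw [← DoubleCentralizer.norm_fst]
  exact f₁.mkContinuous_norm_le hC0 n₁

end Strict

/-! ### Orthogonal families of isometries and diagonal operators -/

section Frames

variable {G : Type*} [Group G] [TopologicalSpace G]
variable {A : Type*} [NonUnitalCStarAlgebra A] {B : Type*} [NonUnitalCStarAlgebra B]
variable {α : CStarAction G A} {β : CStarAction G B} {ι κ : Type*}

/-- A family of isometries in `𝓜(B)^β` with pairwise orthogonal ranges adding up to one. -/
structure IsoFrame (β : CStarAction G B) (ι : Type*) where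
  r : ι → 𝓜(ℂ, B)
  fixed : ∀ i, IsFixed β (r i)
  isom : ∀ i, star (r i) * r i = 1
  orth : ∀ i j, i ≠ j → star (r i) * r j = 0
  full : ∀ b : B, HasSum (fun i => (r i * star (r i)).fst b) b

namespace IsoFrame

variable (R R' R'' : IsoFrame β ι)

lemma eq_of_mul_eq {m n : 𝓜(ℂ, B)} (h : ∀ i, m * R.r i = n * R.r i) : m = n := by
  refine eq_of_fst_eq fun b => ?_
  have h1 := (R.full b).mapL m.fst
  have h2 := (R.full b).mapL n.fst
  have h3 (i : ι) : m.fst ((R.r i * star (R.r i)).fst b) = n.fst ((R.r i * star (R.r i)).fst b) := by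
    have := congrArg (fun k : 𝓜(ℂ, B) => (k * star (R.r i)).fst b) (h i)
    simpa using this
  simp only [h3] at h1
  exact h1.unique h2

/-- Reindexing a frame. -/
def reindex (e : κ ≃ ι) : IsoFrame β κ where
  r i := R.r (e i)
  fixed _ := R.fixed _
  isom _ := R.isom _
  orth _ _ h := R.orth _ _ fun h' => h (e.injective h')
  full b := (e.hasSum_iff (f := fun i => (R.r i * star (R.r i)).fst b)).mpr (R.full b)

/-- The direct sum of two frames. -/
def sum (t : CuntzIsometries β) (R : IsoFrame β ι) (S : IsoFrame β κ) : IsoFrame β (ι ⊕ κ) where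
  r := Sum.elim (fun i => t.t₁ * R.r i) (fun j => t.t₂ * S.r j)
  fixed := by
    rintro (i | j)
    · exact IsFixed.mul t.fixed₁ (R.fixed i)
    · exact IsFixed.mul t.fixed₂ (S.fixed j)
  isom := by
    rintro (i | j)
    · simp [mul_assoc, t.isom₁_assoc, R.isom]
    · simp [mul_assoc, t.isom₂_assoc, S.isom]
  orth := by
    rintro (i | i) (j | j) h
    · simp [mul_assoc, t.isom₁_assoc, R.orth i j (by simpa using h)]
    · simp [mul_assoc, t.orth₁_assoc]
    · simp [mul_assoc, t.orth₂_assoc]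
    · simp [mul_assoc, t.isom₂_assoc, S.orth i j (by simpa using h)]
  full b := by
    have h1 := (R.full ((star t.t₁).fst b)).mapL t.t₁.fst
    have h2 := (S.full ((star t.t₂).fst b)).mapL t.t₂.fst
    have h3 : t.t₁.fst ((star t.t₁).fst b) + t.t₂.fst ((star t.t₂).fst b) = b := by
      have := congrArg (fun k : 𝓜(ℂ, B) => k.fst b) t.sum_range
      simpa using this
    have h4 (i : ι) : ((t.t₁ * R.r i) * star (t.t₁ * R.r i)).fst b
        = t.t₁.fst ((R.r i * star (R.r i)).fst ((star t.t₁).fst b)) := by simp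
    have h5 (i : κ) : ((t.t₂ * S.r i) * star (t.t₂ * S.r i)).fst b
        = t.t₂.fst ((S.r i * star (S.r i)).fst ((star t.t₂).fst b)) := by simp
    simp only [← h4] at h1
    simp only [← h5] at h2
    have h6 := HasSum.sum (f := fun i => (Sum.elim (fun i => t.t₁ * R.r i) (fun j => t.t₂ * S.r j) i
      * star (Sum.elim (fun i => t.t₁ * R.r i) (fun j => t.t₂ * S.r j) i)).fst b) h1 h2
    rwa [h3] at h6

/-- The frame consisting of the unit. -/
def unit (β : CStarAction G B) : IsoFrame β Unit where
  r _ := 1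
  fixed _ := IsFixed.one
  isom _ := by simp
  orth i j h := absurd (Subsingleton.elim i j) h
  full b := by simp

/-- A pair of Cuntz isometries from a frame indexed by `Bool`. -/
def toCuntzIsometries (R : IsoFrame β Bool) : CuntzIsometries β where
  t₁ := R.r false
  t₂ := R.r true
  fixed₁ := R.fixed _
  fixed₂ := R.fixed _
  isom₁ := R.isom _
  isom₂ := R.isom _
  sum_range := R.eq_of_mul_eq <| by
    rintro (i | i) <;> simp [add_mul, mul_assoc, R.isom, R.orth]

/-- By orthogonality the diagonal sum is a *-homomorphism from a finite power of `𝓜(B)`, hence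
contractive. The bound therefore does not depend on the number of summands. -/
lemma norm_sum_diag_le (s : Finset ι) {x : ι → 𝓜(ℂ, B)} {C : ℝ} (hC : 0 ≤ C)
    (hx : ∀ i, ‖x i‖ ≤ C) : ‖∑ i ∈ s, R.r i * x i * star (R.r i)‖ ≤ C := by
  classical
  let φ : (s → 𝓜(ℂ, B)) →⋆ₙₐ[ℂ] 𝓜(ℂ, B) :=
    { toFun := fun x => ∑ i : s, R.r i * x i * star (R.r i)
      map_smul' := fun c x => by simp [Finset.smul_sum]
      map_zero' := by simp
      map_add' := fun x y => by simp [mul_add, add_mul, Finset.sum_add_distrib]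
      map_mul' := fun x y => by
        rw [Finset.sum_mul_sum]
        refine Finset.sum_congr rfl fun i _ => ?_
        rw [Finset.sum_eq_single i]
        · have : R.r i * x i * star (R.r i) * (R.r i * y i * star (R.r i))
              = R.r i * x i * (star (R.r i) * R.r i) * y i * star (R.r i) := by
            simp only [mul_assoc]
          rw [this, R.isom]
          simp [mul_assoc]
        · intro j _ hj
          have : R.r i * x i * star (R.r i) * (R.r j * y j * star (R.r j))
              = R.r i * x i * (star (R.r i) * R.r j) * y j * star (R.r j) := by
            simp only [mul_assoc]
          rw [this, R.orth _ _ (fun h => hj (Subtype.ext h.symm))]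
          simp
        · simp
      map_star' := fun x => by simp [star_sum, mul_assoc] }
  have h := NonUnitalStarAlgHom.norm_apply_le φ fun i : s => x i
  have h1 : φ (fun i : s => x i) = ∑ i ∈ s, R.r i * x i * star (R.r i) :=
    Finset.sum_coe_sort s fun i => R.r i * x i * star (R.r i)
  rw [h1] at h
  exact h.trans ((pi_norm_le_iff_of_nonneg hC).mpr fun i => hx i)

lemma norm_sum_le (s : Finset ι) {x : ι → 𝓜(ℂ, B)} {C : ℝ} (hC : 0 ≤ C)
    (hx : ∀ i, ‖x i‖ ≤ C) : ‖∑ i ∈ s, R'.r i * x i * star (R.r i)‖ ≤ C := by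
  classical
  have h1 : star (∑ i ∈ s, R'.r i * x i * star (R.r i)) * ∑ i ∈ s, R'.r i * x i * star (R.r i)
      = ∑ i ∈ s, R.r i * (star (x i) * x i) * star (R.r i) := by
    rw [star_sum, Finset.sum_mul_sum]
    refine Finset.sum_congr rfl fun i hi => ?_
    have e (j : ι) : star (R'.r i * x i * star (R.r i)) * (R'.r j * x j * star (R.r j))
        = R.r i * star (x i) * (star (R'.r i) * R'.r j) * x j * star (R.r j) := by
      simp [mul_assoc]
    rw [Finset.sum_eq_single i]
    · rw [e, R'.isom]
      simp [mul_assoc]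
    · intro j _ hj
      rw [e, R'.orth _ _ hj.symm]
      simp
    · exact fun h => absurd hi h
  have h2 : ‖∑ i ∈ s, R.r i * (star (x i) * x i) * star (R.r i)‖ ≤ C * C := by
    refine R.norm_sum_diag_le s (by positivity) fun i => ?_
    rw [CStarRing.norm_star_mul_self]
    exact mul_le_mul (hx i) (hx i) (norm_nonneg _) hC
  rw [← h1, CStarRing.norm_star_mul_self] at h2
  nlinarith [norm_nonneg (∑ i ∈ s, R'.r i * x i * star (R.r i))]

/-- A partial sum over `t` sees only the component of `b` in the ranges indexed by `t`. This
component is small far out because the range projections sum strictly to one, and the partial sums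
are bounded by `C`. -/
lemma summable_fst {x : ι → 𝓜(ℂ, B)} {C : ℝ} (hC : 0 ≤ C) (hx : ∀ i, ‖x i‖ ≤ C) (b : B) :
    Summable fun i => (R'.r i * x i * star (R.r i)).fst b := by
  classical
  rw [summable_iff_vanishing_norm]
  intro ε hε
  have h := (R.full b).summable
  rw [summable_iff_vanishing_norm] at h
  obtain ⟨s, hs⟩ := h (ε / (C + 1)) (by positivity)
  refine ⟨s, fun t ht => ?_⟩
  have e : ∑ i ∈ t, (R'.r i * x i * star (R.r i)).fst b
      = (∑ i ∈ t, R'.r i * x i * star (R.r i)).fst (∑ i ∈ t, (R.r i * star (R.r i)).fst b) := by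
    rw [map_sum]
    refine Finset.sum_congr rfl fun i hi => ?_
    have : (∑ i ∈ t, R'.r i * x i * star (R.r i)) * (R.r i * star (R.r i))
        = R'.r i * x i * star (R.r i) := by
      have e' (j : ι) : R'.r j * x j * star (R.r j) * (R.r i * star (R.r i))
          = R'.r j * x j * (star (R.r j) * R.r i) * star (R.r i) := by simp only [mul_assoc]
      rw [Finset.sum_mul, Finset.sum_eq_single i]
      · rw [e', R.isom, mul_one]
      · intro j _ hj
        rw [e', R.orth _ _ hj]
        simp
      · exact fun h => absurd hi h
    have h' := congrArg (fun k : 𝓜(ℂ, B) => k.fst b) this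
    exact h'.symm
  rw [e]
  refine (norm_fst_le _ _).trans_lt ?_
  calc _ ≤ C * ‖∑ i ∈ t, (R.r i * star (R.r i)).fst b‖ := by
        gcongr
        exact norm_sum_le R R' t hC hx
    _ ≤ C * (ε / (C + 1)) := by gcongr; exact (hs t ht).le
    _ < ε := by
        rw [mul_div_assoc', div_lt_iff₀ (by positivity)]
        nlinarith

lemma exists_op {x : ι → 𝓜(ℂ, B)} {C : ℝ} (hC : 0 ≤ C) (hx : ∀ i, ‖x i‖ ≤ C) :
    ∃ m : 𝓜(ℂ, B), ‖m‖ ≤ C ∧ ∀ i, m * R.r i = R'.r i * x i := by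
  obtain ⟨m, hm, hs⟩ := exists_strict_sum (fun i => R'.r i * x i * star (R.r i)) C
    -- Summability of the right multiplications is summability of the left multiplications for the
    -- adjoint family, with the two frames interchanged.
    (fun s => norm_sum_le R R' s hC hx) (summable_fst R R' hC hx) (fun b => by
      have h := (summable_fst R' R (x := fun i => star (x i)) hC (fun i => by simpa using hx i)
        (star b)).star
      convert h using 2 with i
      rw [← DoubleCentralizer.star_snd]
      simp [mul_assoc])
  refine ⟨m, hm, fun i => eq_of_fst_eq fun b => ?_⟩
  refine (hs ((R.r i).fst b)).unique ?_
  have e (j : ι) : (R'.r j * x j * star (R.r j)).fst ((R.r i).fst b)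
      = (R'.r j * x j * (star (R.r j) * R.r i)).fst b := by simp
  simp only [e]
  have h := hasSum_single (f := fun j => (R'.r j * x j * (star (R.r j) * R.r i)).fst b) i
    (fun j hj => by rw [R.orth _ _ hj]; simp)
  simpa [R.isom] using h

/-- A bounded family in `𝓜(B)`. -/
def Bdd (x : ι → 𝓜(ℂ, B)) : Prop := ∃ C, 0 ≤ C ∧ ∀ i, ‖x i‖ ≤ C

open Classical in
/-- The element of `𝓜(B)` that maps the `i`-th summand with respect to `R` to the `i`-th summand
with respect to `R'` by `x i`. -/
def op (x : ι → 𝓜(ℂ, B)) : 𝓜(ℂ, B) :=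
  if h : Bdd x then (exists_op R R' h.choose_spec.1 h.choose_spec.2).choose else 0

variable {R R' R''} {x y : ι → 𝓜(ℂ, B)}

lemma op_mul_r (h : Bdd x) (i : ι) : op R R' x * R.r i = R'.r i * x i := by
  rw [op, dif_pos h]
  exact (exists_op R R' h.choose_spec.1 h.choose_spec.2).choose_spec.2 i

/-- An element is determined by its products with the isometries of a frame. All algebraic
identities for `op` below reduce to one summand in this way. -/
lemma eq_op {m : 𝓜(ℂ, B)} (h : Bdd x) (hm : ∀ i, m * R.r i = R'.r i * x i) : m = op R R' x :=
  R.eq_of_mul_eq fun i => by rw [hm, op_mul_r h]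

lemma norm_op_le {C : ℝ} (hC : 0 ≤ C) (hx : ∀ i, ‖x i‖ ≤ C) : ‖op R R' x‖ ≤ C := by
  obtain ⟨m, hm, h⟩ := exists_op R R' hC hx
  rwa [← eq_op ⟨C, hC, hx⟩ h]

lemma Bdd.star (h : Bdd x) : Bdd fun i => star (x i) := by
  obtain ⟨C, hC, h⟩ := h
  exact ⟨C, hC, fun i => by simpa using h i⟩

lemma Bdd.mul (h : Bdd x) (h' : Bdd y) : Bdd fun i => x i * y i := by
  obtain ⟨C, hC, h⟩ := h
  obtain ⟨C', hC', h'⟩ := h'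
  exact ⟨C * C', by positivity, fun i => (norm_mul_le _ _).trans (by gcongr; exacts [h i, h' i])⟩

lemma Bdd.add (h : Bdd x) (h' : Bdd y) : Bdd fun i => x i + y i := by
  obtain ⟨C, hC, h⟩ := h
  obtain ⟨C', hC', h'⟩ := h'
  exact ⟨C + C', by positivity, fun i => (norm_add_le _ _).trans (add_le_add (h i) (h' i))⟩

lemma Bdd.sub (h : Bdd x) (h' : Bdd y) : Bdd fun i => x i - y i := by
  obtain ⟨C, hC, h⟩ := h
  obtain ⟨C', hC', h'⟩ := h'
  exact ⟨C + C', by positivity, fun i => (norm_sub_le _ _).trans (add_le_add (h i) (h' i))⟩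

lemma Bdd.smul (r : ℂ) (h : Bdd x) : Bdd fun i => r • x i := by
  obtain ⟨C, hC, h⟩ := h
  exact ⟨‖r‖ * C, by positivity, fun i => (norm_smul_le _ _).trans (by gcongr; exact h i)⟩

lemma Bdd.twist (h : Bdd x) (τ : A ⊕ G) : Bdd fun i => twist A β τ (x i) := by
  obtain ⟨C, hC, h⟩ := h
  exact ⟨C, hC, fun i => (NonUnitalStarAlgHom.norm_apply_le (CuntzThomsen.twist A β τ) _).trans
    (h i)⟩

lemma Bdd.const (m : 𝓜(ℂ, B)) : Bdd fun _ : ι => m := ⟨‖m‖, norm_nonneg _, fun _ => le_rfl⟩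

lemma bdd_of_le_one (h : ∀ i, ‖x i‖ ≤ 1) : Bdd x := ⟨1, zero_le_one, h⟩

lemma op_mul_op (hx : Bdd x) (hy : Bdd y) :
    op R' R'' y * op R R' x = op R R'' fun i => y i * x i :=
  eq_op (hy.mul hx) fun i => by
    rw [mul_assoc, op_mul_r hx, ← mul_assoc, op_mul_r hy, mul_assoc]

lemma op_star (hx : Bdd x) : star (op R R' x) = op R' R fun i => star (x i) := by
  refine eq_op hx.star fun i => ?_
  have h : star (R'.r i) * op R R' x = x i * star (R.r i) := by
    refine R.eq_of_mul_eq fun j => ?_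
    rw [mul_assoc, op_mul_r hx, ← mul_assoc, mul_assoc (x i)]
    by_cases hij : i = j
    · subst hij
      simp [R.isom, R'.isom]
    · simp [R.orth _ _ hij, R'.orth _ _ hij]
  simpa using congrArg star h

lemma op_add (hx : Bdd x) (hy : Bdd y) : op R R' (fun i => x i + y i) = op R R' x + op R R' y :=
  (eq_op (hx.add hy) fun i => by rw [add_mul, op_mul_r hx, op_mul_r hy, mul_add]).symm

lemma op_sub (hx : Bdd x) (hy : Bdd y) : op R R' (fun i => x i - y i) = op R R' x - op R R' y :=
  (eq_op (hx.sub hy) fun i => by rw [sub_mul, op_mul_r hx, op_mul_r hy, mul_sub]).symm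

lemma op_smul (r : ℂ) (hx : Bdd x) : op R R' (fun i => r • x i) = r • op R R' x :=
  (eq_op (hx.smul r) fun i => by rw [smul_mul_assoc, op_mul_r hx, mul_smul_comm]).symm

lemma op_one : op R R (fun _ => 1) = 1 := (eq_op (Bdd.const 1) fun i => by simp).symm

lemma op_twist (τ : A ⊕ G) (hx : Bdd x) :
    twist A β τ (op R R' x) = op R R' fun i => twist A β τ (x i) := by
  refine eq_op (hx.twist τ) fun i => ?_
  have h := congrArg (twist A β τ) (op_mul_r (R := R) (R' := R') hx i)
  rwa [map_mul, map_mul, (R.fixed i).twist_eq, (R'.fixed i).twist_eq] at h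

/-- Membership of `op x` in `B`. -/
lemma op_inIdeal (hx : ∀ i, InIdeal (x i))
    (h0 : Filter.Tendsto (fun i => ‖x i‖) Filter.cofinite (nhds 0)) :
    InIdeal (op R R' x) := by
  classical
  have hb : Bdd x := by
    have h1 := h0.eventually (gt_mem_nhds zero_lt_one)
    rw [Filter.eventually_cofinite] at h1
    refine ⟨1 + ∑ i ∈ h1.toFinset, ‖x i‖, by positivity, fun i => ?_⟩
    by_cases hi : ‖x i‖ < 1
    · have : 0 ≤ ∑ i ∈ h1.toFinset, ‖x i‖ := by positivity
      linarith
    · have := Finset.single_le_sum (f := fun i => ‖x i‖) (s := h1.toFinset)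
        (fun i _ => norm_nonneg _) (a := i) (by simpa using hi)
      linarith
  refine InIdeal.of_approx fun ε hε => ?_
  have h1 := h0.eventually (gt_mem_nhds hε)
  rw [Filter.eventually_cofinite] at h1
  -- Cutting off the finitely many entries of norm at least `ε` leaves an operator of norm at most
  -- `ε`.
  refine ⟨∑ i ∈ h1.toFinset, R'.r i * x i * star (R.r i),
    InIdeal.sum fun i _ => ((hx i).mul_left _).mul_right _, ?_⟩
  have h2 (i : ι) : ‖if i ∈ h1.toFinset then 0 else x i‖ ≤ ε := by
    split_ifs with hi
    · simpa using hε.le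
    · have : ‖x i‖ < ε := by simpa using hi
      exact this.le
  have h3 : op R R' x - ∑ i ∈ h1.toFinset, R'.r i * x i * star (R.r i)
      = op R R' fun i => if i ∈ h1.toFinset then 0 else x i := by
    refine eq_op ⟨ε, hε.le, h2⟩ fun i => ?_
    have e (j : ι) : R'.r j * x j * star (R.r j) * R.r i = if j = i then R'.r i * x i else 0 := by
      split_ifs with hji
      · subst hji
        rw [mul_assoc, R.isom, mul_one]
      · rw [mul_assoc, R.orth _ _ hji, mul_zero]
    rw [sub_mul, op_mul_r hb, Finset.sum_mul]
    simp only [e, Finset.sum_ite_eq']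
    split_ifs <;> simp
  rw [h3]
  exact norm_op_le hε.le h2

lemma op_mem_unitary (hx : ∀ i, x i ∈ unitary 𝓜(ℂ, B)) : op R R' x ∈ unitary 𝓜(ℂ, B) := by
  have hb : Bdd x := bdd_of_le_one fun i => norm_le_one_of_unitary (hx i)
  rw [Unitary.mem_iff, op_star hb, op_mul_op hb hb.star, op_mul_op hb.star hb]
  constructor
  · simp only [(hx _).1, op_one]
  · simp only [(hx _).2, op_one]

/-- On a finite partial sum of `b` only finitely many entries act, and continuity is clear. The
remainder of `b` contributes an error bounded uniformly in `s`, because the families share the bound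
`C`. -/
lemma op_continuous {X : Type*} [TopologicalSpace X] {f : X → ι → 𝓜(ℂ, B)} {C : ℝ} (hC : 0 ≤ C)
    (hf : ∀ s i, ‖f s i‖ ≤ C) (hc : ∀ i b, Continuous fun s => (f s i).fst b) (b : B) :
    Continuous fun s => (op R R (f s)).fst b := by
  classical
  have hb (s : X) : Bdd (f s) := ⟨C, hC, hf s⟩
  have key : ∀ F : Finset ι, Continuous fun s =>
      (op R R (f s)).fst (∑ i ∈ F, (R.r i * star (R.r i)).fst b) := by
    intro F
    simp only [map_sum]
    refine continuous_finsetSum _ fun i _ => ?_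
    have e (s : X) : (op R R (f s)).fst ((R.r i * star (R.r i)).fst b)
        = (R.r i).fst ((f s i).fst ((star (R.r i)).fst b)) := by
      have := congrArg (fun k : 𝓜(ℂ, B) => (k * star (R.r i)).fst b)
        (op_mul_r (R := R) (R' := R) (hb s) i)
      simpa using this
    simp only [e]
    exact (R.r i).fst.continuous.comp (hc i _)
  refine continuous_of_uniform_approx_of_continuous fun u hu => ?_
  obtain ⟨ε, hε, hu⟩ := Metric.mem_uniformity_dist.mp hu
  have h1 := (R.full b)
  rw [HasSum, SummationFilter.unconditional_filter, Metric.tendsto_atTop] at h1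
  obtain ⟨F, hF⟩ := h1 (ε / (C + 1)) (by positivity)
  refine ⟨_, key F, fun s => hu ?_⟩
  rw [dist_eq_norm, ← map_sub]
  refine (norm_fst_le _ _).trans_lt ?_
  have h2 := hF F le_rfl
  rw [dist_comm, dist_eq_norm] at h2
  calc _ ≤ C * (ε / (C + 1)) := by
        gcongr
        exact norm_op_le hC (hf s)
    _ < ε := by
        rw [mul_div_assoc', div_lt_iff₀ (by positivity)]
        nlinarith

end IsoFrame

open IsoFrame

lemma CocycleRep.norm_val_le (x : CocycleRep α β) (τ : A ⊕ G) :
    ‖x.val τ‖ ≤ Sum.elim (fun a => ‖a‖) (fun _ => 1) τ := by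
  rcases τ with a | g
  · exact NonUnitalStarAlgHom.norm_apply_le x.hom a
  · exact norm_le_one_of_unitary (x.coc_mem_unitary g)

lemma CocycleRep.bdd_val (x : ι → CocycleRep α β) (τ : A ⊕ G) : Bdd fun i => (x i).val τ :=
  ⟨Sum.elim (fun a => ‖a‖) (fun _ => 1) τ, by rcases τ with a | g <;> simp,
    fun i => (x i).norm_val_le τ⟩

/-- The direct sum of a family of cocycle representations. -/
def CocycleRep.directSum (R : IsoFrame β ι) (x : ι → CocycleRep α β) : CocycleRep α β where
  hom :=
    { toFun := fun a => op R R fun i => (x i).hom a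
      map_smul' := fun c a => by
        simp only [map_smul]
        exact op_smul c (CocycleRep.bdd_val x (.inl a))
      map_zero' := by
        simp only [map_zero]
        exact (eq_op (Bdd.const 0) fun i => by simp).symm
      map_add' := fun a b => by
        simp only [map_add]
        exact op_add (CocycleRep.bdd_val x (.inl a)) (CocycleRep.bdd_val x (.inl b))
      map_mul' := fun a b => by
        simp only [map_mul]
        exact (op_mul_op (CocycleRep.bdd_val x (.inl b)) (CocycleRep.bdd_val x (.inl a))).symm
      map_star' := fun a => by
        simp only [map_star]
        exact (op_star (CocycleRep.bdd_val x (.inl a))).symm }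
  coc g := op R R fun i => (x i).coc g
  coc_mem_unitary g := op_mem_unitary fun i => (x i).coc_mem_unitary g
  strict_left b := op_continuous (C := 1) zero_le_one
    (fun g i => (norm_le_one_of_unitary ((x i).coc_mem_unitary g))) (fun i b => (x i).strict_left b) b
  strict_right b := by
    have h := (op_continuous (R := R) (C := 1) (f := fun g i => star ((x i).coc g)) zero_le_one
      (fun g i => by simpa using (norm_le_one_of_unitary ((x i).coc_mem_unitary g)))
      (fun i b => by simpa using ((x i).strict_right (star b)).star) (star b)).star
    refine h.congr fun g => ?_
    have h1 : (op R R fun i => star ((x i).coc g)) = star (op R R fun i => (x i).coc g) :=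
      (op_star (CocycleRep.bdd_val x (.inr g))).symm
    rw [h1]
    simp
  coc_mul g h := by
    have h1 : β.mult g (op R R fun i => (x i).coc h) = op R R fun i => β.mult g ((x i).coc h) :=
      op_twist (A := A) (.inr g) (CocycleRep.bdd_val x (.inr h))
    rw [h1]
    simp only [coc_mul]
    exact (op_mul_op (Bdd.twist (A := A) (CocycleRep.bdd_val x (.inr h)) (.inr g))
      (CocycleRep.bdd_val x (.inr g))).symm
  covariant g a := by
    have h1 : β.mult g (op R R fun i => (x i).hom a) = op R R fun i => β.mult g ((x i).hom a) :=
      op_twist (A := A) (.inr g) (CocycleRep.bdd_val x (.inl a))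
    have b1 : Bdd fun i => β.mult g ((x i).hom a) :=
      Bdd.twist (A := A) (CocycleRep.bdd_val x (.inl a)) (.inr g)
    have b2 : Bdd fun i => (x i).coc g := CocycleRep.bdd_val x (.inr g)
    change (op R R fun i => (x i).coc g) * β.mult g (op R R fun i => (x i).hom a)
      * star (op R R fun i => (x i).coc g) = op R R fun i => (x i).hom (α.toHom g a)
    rw [h1, op_star b2, op_mul_op b1 b2, op_mul_op b2.star (b2.mul b1)]
    simp only [covariant]

lemma CocycleRep.val_directSum (R : IsoFrame β ι) (x : ι → CocycleRep α β) (τ : A ⊕ G) :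
    (CocycleRep.directSum R x).val τ = op R R fun i => (x i).val τ := by
  rcases τ with a | g <;> rfl

end Frames

/-! ### Isometries from strong stability -/

section Uniform

variable {E X : Type*} [SeminormedAddCommGroup E] {l : Filter X} {f : X → E → E}

/-- Pointwise convergence of contractions to the identity is uniform on totally bounded sets. -/
lemma eventually_forall_norm_sub_le (hf : ∀ i v w, ‖f i v - f i w‖ ≤ ‖v - w‖)
    (h : ∀ v, Filter.Tendsto (fun i => f i v) l (nhds v)) {S : Set E} (hS : TotallyBounded S)
    {ε : ℝ} (hε : 0 < ε) : ∀ᶠ i in l, ∀ v ∈ S, ‖f i v - v‖ ≤ ε := by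
  obtain ⟨t, htf, hcov⟩ := Metric.totallyBounded_iff.mp hS (ε / 3) (by positivity)
  have h1 : ∀ᶠ i in l, ∀ v ∈ t, ‖f i v - v‖ < ε / 3 := by
    refine (Filter.eventually_all_finite htf).mpr fun v _ => ?_
    have := (tendsto_iff_norm_sub_tendsto_zero.mp (h v)).eventually
      (gt_mem_nhds (show (0 : ℝ) < ε / 3 by positivity))
    exact this
  filter_upwards [h1] with i hi v hv
  have h2 := hcov hv
  simp only [Set.mem_iUnion, Metric.mem_ball, exists_prop, dist_eq_norm] at h2
  obtain ⟨w, hw, hvw⟩ := h2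
  have h3 : f i v - v = (f i v - f i w) + (f i w - w) - (v - w) := by abel
  rw [h3]
  have := hi w hw
  have := hf i v w
  calc _ ≤ ‖f i v - f i w‖ + ‖f i w - w‖ + ‖v - w‖ :=
        (norm_sub_le _ _).trans (by gcongr; exact norm_add_le _ _)
    _ ≤ ε := by linarith

/-- The set on which contractions converge to the identity is closed. -/
lemma isClosed_setOf_tendsto_self (hf : ∀ i v w, ‖f i v - f i w‖ ≤ ‖v - w‖) :
    IsClosed {v | Filter.Tendsto (fun i => f i v) l (nhds v)} := by
  refine isClosed_of_closure_subset fun v hv => ?_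
  change Filter.Tendsto _ _ _
  rw [tendsto_iff_norm_sub_tendsto_zero, Metric.tendsto_nhds]
  intro ε hε
  obtain ⟨w, hw, hvw⟩ := Metric.mem_closure_iff.mp hv (ε / 3) (by positivity)
  have h1 := (tendsto_iff_norm_sub_tendsto_zero.mp hw).eventually
      (gt_mem_nhds (show (0 : ℝ) < ε / 3 by positivity))
  filter_upwards [h1] with i hi
  rw [dist_eq_norm] at hvw
  have h3 : f i v - v = (f i v - f i w) + (f i w - w) - (v - w) := by abel
  have := hf i v w
  rw [dist_zero_right, norm_norm, h3]
  calc _ ≤ ‖f i v - f i w‖ + ‖f i w - w‖ + ‖v - w‖ :=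
        (norm_sub_le _ _).trans (by gcongr; exact norm_add_le _ _)
    _ < ε := by linarith

end Uniform

/-! ### Isometries of the Hilbert space -/

section Ell2

variable {ι : Type*}

/-- The standard basis of `ℓ²(ℕ)`. -/
def ell2Basis : HilbertBasis ℕ ℂ Ell2 := ⟨LinearIsometryEquiv.refl ℂ _⟩

lemma orthonormal_ell2Basis_comp (e : ι × ℕ ≃ ℕ) (i : ι) :
    Orthonormal ℂ fun m => ell2Basis (e (i, m)) :=
  ell2Basis.orthonormal.comp _ fun m n h => by simpa using h

/-- Isometries of `ℓ²(ℕ)` with orthogonal ranges adding up to one. -/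
def ell2Isometry (e : ι × ℕ ≃ ℕ) (i : ι) : Ell2 →L[ℂ] Ell2 :=
  (orthonormal_ell2Basis_comp e i).orthogonalFamily.linearIsometry.toContinuousLinearMap

lemma ell2Isometry_basis (e : ι × ℕ ≃ ℕ) (i : ι) (m : ℕ) :
    ell2Isometry e i (ell2Basis m) = ell2Basis (e (i, m)) := by
  have h1 : ell2Basis m = lp.single 2 m (1 : ℂ) := by
    rw [← ell2Basis.repr_symm_single]
    rfl
  rw [h1]
  have h := (orthonormal_ell2Basis_comp e i).orthogonalFamily.linearIsometry_apply_single
    (i := m) (1 : ℂ)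
  refine h.trans ?_
  simp

lemma star_ell2Isometry_basis [DecidableEq ι] (e : ι × ℕ ≃ ℕ) (i j : ι) (m : ℕ) :
    star (ell2Isometry e i) (ell2Basis (e (j, m))) = if i = j then ell2Basis m else 0 := by
  classical
  apply ell2Basis.repr.injective
  ext n
  rw [ell2Basis.repr_apply_apply, ell2Basis.repr_apply_apply, ContinuousLinearMap.star_eq_adjoint,
    ContinuousLinearMap.adjoint_inner_right, ell2Isometry_basis,
    orthonormal_iff_ite.mp ell2Basis.orthonormal]
  split_ifs with h1 h2 h2
  · rw [orthonormal_iff_ite.mp ell2Basis.orthonormal, if_pos]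
    have := e.injective h1
    simp_all
  · exfalso
    have := e.injective h1
    simp_all
  · rw [orthonormal_iff_ite.mp ell2Basis.orthonormal, if_neg]
    rintro rfl
    exact h1 (by rw [h2])
  · simp

lemma ell2_ext {S T : Ell2 →L[ℂ] Ell2} (h : ∀ n, S (ell2Basis n) = T (ell2Basis n)) : S = T := by
  refine ContinuousLinearMap.ext_on (s := Set.range ell2Basis) ?_ ?_
  · exact Submodule.dense_iff_topologicalClosure_eq_top.mpr ell2Basis.dense_span
  · rintro _ ⟨n, rfl⟩
    exact h n

lemma star_mul_ell2Isometry [DecidableEq ι] (e : ι × ℕ ≃ ℕ) (i j : ι) :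
    star (ell2Isometry e i) * ell2Isometry e j = if i = j then 1 else 0 := by
  refine ell2_ext fun n => ?_
  rw [mul_apply_eq_comp, ell2Isometry_basis, star_ell2Isometry_basis]
  split_ifs <;> simp

/-- The projection onto the sum of finitely many of the ranges. -/
def ell2Proj (e : ι × ℕ ≃ ℕ) (F : Finset ι) : Ell2 →L[ℂ] Ell2 :=
  ∑ i ∈ F, ell2Isometry e i * star (ell2Isometry e i)

lemma norm_sum_proj_le {C : Type*} [CStarAlgebra C] {r : ι → C}
    (h : ∀ i, star (r i) * r i = 1) (h' : ∀ i j, i ≠ j → star (r i) * r j = 0) (F : Finset ι) :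
    ‖∑ i ∈ F, r i * star (r i)‖ ≤ 1 := by
  classical
  set p := ∑ i ∈ F, r i * star (r i) with hp
  have h1 : star p * p = p := by
    simp only [hp, star_sum, star_mul, star_star, Finset.sum_mul_sum]
    refine Finset.sum_congr rfl fun i hi => ?_
    have e (j : ι) : r i * star (r i) * (r j * star (r j))
        = r i * (star (r i) * r j) * star (r j) := by simp only [mul_assoc]
    rw [Finset.sum_eq_single i, e, h, mul_one]
    · intro j _ hj
      rw [e, h' _ _ hj.symm]
      simp
    · exact fun h => absurd hi h
  have h2 : ‖p‖ * ‖p‖ = ‖p‖ := by rw [← CStarRing.norm_star_mul_self, h1]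
  by_contra hlt
  push Not at hlt
  nlinarith

lemma norm_ell2Proj_le (e : ι × ℕ ≃ ℕ) (F : Finset ι) : ‖ell2Proj e F‖ ≤ 1 := by
  classical
  exact norm_sum_proj_le (fun i => by simp [star_mul_ell2Isometry])
    (fun i j h => by simp [star_mul_ell2Isometry, h]) F

lemma contraction_of_norm_le {T : Ell2 →L[ℂ] Ell2} (hT : ‖T‖ ≤ 1) (v w : Ell2) :
    ‖T v - T w‖ ≤ ‖v - w‖ := by
  rw [← map_sub]
  exact (T.le_opNorm _).trans (by nlinarith [norm_nonneg (v - w)])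

lemma tendsto_ell2Proj (e : ι × ℕ ≃ ℕ) (v : Ell2) :
    Filter.Tendsto (fun F => ell2Proj e F v) Filter.atTop (nhds v) := by
  classical
  have hc : IsClosed {v | Filter.Tendsto (fun F => ell2Proj e F v) Filter.atTop (nhds v)} :=
    isClosed_setOf_tendsto_self (f := fun F v => ell2Proj e F v)
      (fun F => contraction_of_norm_le (norm_ell2Proj_le e F))
  let V : Submodule ℂ Ell2 :=
    { carrier := {v | Filter.Tendsto (fun F => ell2Proj e F v) Filter.atTop (nhds v)}
      add_mem' := fun {v w} hv hw => by
        change Filter.Tendsto _ _ _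
        simp only [map_add]
        exact Filter.Tendsto.add hv hw
      zero_mem' := by simp
      smul_mem' := fun c v hv => by
        change Filter.Tendsto _ _ _
        simp only [map_smul]
        exact Filter.Tendsto.const_smul hv c }
  have h1 : Submodule.span ℂ (Set.range ell2Basis) ≤ V := by
    rw [Submodule.span_le]
    rintro _ ⟨n, rfl⟩
    obtain ⟨⟨j, m⟩, rfl⟩ := e.surjective n
    refine tendsto_const_nhds.congr' ?_
    filter_upwards [Filter.eventually_ge_atTop {j}] with F hF
    have hj : j ∈ F := by simpa using hF
    rw [ell2Proj, sum_apply, Finset.sum_eq_single j]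
    · rw [mul_apply_eq_comp, star_ell2Isometry_basis, if_pos rfl, ell2Isometry_basis]
    · intro i _ hi
      rw [mul_apply_eq_comp, star_ell2Isometry_basis, if_neg hi, map_zero]
    · exact fun h => absurd hj h
  have h2 : (Submodule.span ℂ (Set.range ell2Basis)).topologicalClosure ≤ V :=
    Submodule.topologicalClosure_minimal _ h1 hc
  rw [ell2Basis.dense_span] at h2
  exact h2 (Submodule.mem_top (x := v))

/-- The projections converge only strongly. Compactness of `k` makes the image of the unit ball
totally bounded, and there strong convergence of contractions is uniform. -/
lemma tendsto_ell2Proj_mul (e : ι × ℕ ≃ ℕ) {k : Ell2 →L[ℂ] Ell2} (hk : IsCompactOperator k) :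
    Filter.Tendsto (fun F => ‖ell2Proj e F * k - k‖) Filter.atTop (nhds 0) := by
  have hS : TotallyBounded (k '' Metric.closedBall 0 1) :=
    ((isCompactOperator_iff_isCompact_closure_image_closedBall
      k.toLinearMap one_pos).mp hk).totallyBounded.subset subset_closure
  rw [Metric.tendsto_nhds]
  intro ε hε
  have h := eventually_forall_norm_sub_le (f := fun F v => ell2Proj e F v)
    (fun F => contraction_of_norm_le (norm_ell2Proj_le e F)) (tendsto_ell2Proj e) hS
    (half_pos hε)
  filter_upwards [h] with F hF
  rw [dist_zero_right, norm_norm]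
  refine lt_of_le_of_lt (ContinuousLinearMap.opNorm_le_of_unit_norm (half_pos hε).le
    fun v hv => ?_) (half_lt_self hε)
  exact hF (k v) ⟨v, by simp [hv], rfl⟩

end Ell2

/-- The positive element `‖T‖² - T* T` is written as a square. This turns the norm bound for left
multiplication by `T` into an algebraic identity that makes sense in any completion of the tensor
product. -/
lemma exists_star_mul_self_eq {C : Type*} [CStarAlgebra C] (T : C) :
    ∃ S : C, star S * S = ((‖T‖ : ℂ) ^ 2) • (1 : C) - star T * T := by
  let _ := CStarAlgebra.spectralOrder C
  let _ := CStarAlgebra.spectralOrderedRing C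
  have h : (0 : C) ≤ algebraMap ℝ C (‖T‖ ^ 2) - star T * T :=
    sub_nonneg.mpr CStarAlgebra.star_mul_le_algebraMap_norm_sq
  obtain ⟨S, hS⟩ := CStarAlgebra.nonneg_iff_eq_star_mul_self.mp h
  refine ⟨S, ?_⟩
  rw [← hS, Algebra.algebraMap_eq_smul_one, ← Complex.coe_smul (‖T‖ ^ 2) (1 : C)]
  push_cast
  rfl

lemma norm_star_mul_self_le_add {C : Type*} [NonUnitalCStarAlgebra C] (a b : C) :
    ‖star a * a‖ ≤ ‖star a * a + star b * b‖ := by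
  let _ := CStarAlgebra.spectralOrder C
  let _ := CStarAlgebra.spectralOrderedRing C
  exact CStarAlgebra.norm_le_norm_of_nonneg_of_le (star_mul_self_nonneg a)
    (le_add_of_nonneg_right (star_mul_self_nonneg b))

lemma norm_le_of_star_mul_self_add {C : Type*} [NonUnitalCStarAlgebra C] {a b c : C} {r : ℝ}
    (hr : 0 ≤ r) (h : star a * a + star b * b = ((r : ℂ) ^ 2) • (star c * c)) :
    ‖a‖ ≤ r * ‖c‖ := by
  have h1 := norm_star_mul_self_le_add a b
  rw [h, norm_smul, CStarRing.norm_star_mul_self, CStarRing.norm_star_mul_self] at h1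
  simp only [norm_pow, Complex.norm_real, Real.norm_eq_abs, sq_abs] at h1
  have h2 : 0 ≤ r * ‖c‖ := by positivity
  exact (abs_le_of_sq_le_sq' (by nlinarith) h2).2

/-! ### Multipliers of the form `1 ⊗ T` -/

section Stabilization

variable {G : Type*} [Group G] [TopologicalSpace G]
variable {B : Type*} [NonUnitalCStarAlgebra B]

/-- Left multiplication by a bounded operator on the compact operators. -/
def kompaktMul (T : Ell2 →L[ℂ] Ell2) : Kompakt →ₗ[ℂ] Kompakt where
  toFun k := ⟨T * k, k.2.clm_comp T⟩
  map_add' _ _ := Subtype.ext (mul_add _ _ _)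
  map_smul' _ _ := Subtype.ext (mul_smul_comm _ _ _)

variable (B) in
/-- Left multiplication by `1 ⊗ T` on `B ⊙ 𝒦`. -/
def tensorMul (T : Ell2 →L[ℂ] Ell2) : (B ⊗[ℂ] Kompakt) →ₗ[ℂ] (B ⊗[ℂ] Kompakt) :=
  LinearMap.lTensor B (kompaktMul T)

lemma tensorMul_tmul (T : Ell2 →L[ℂ] Ell2) (b : B) (k : Kompakt) :
    tensorMul B T (b ⊗ₜ k) = b ⊗ₜ kompaktMul T k := LinearMap.lTensor_tmul _ _ _ _

lemma tensorMul_one (y : B ⊗[ℂ] Kompakt) : tensorMul B 1 y = y := by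
  have h : kompaktMul 1 = LinearMap.id := by
    ext1 k
    exact Subtype.ext (one_mul _)
  simp [tensorMul, h]

lemma tensorMul_mul (S T : Ell2 →L[ℂ] Ell2) (y : B ⊗[ℂ] Kompakt) :
    tensorMul B (S * T) y = tensorMul B S (tensorMul B T y) := by
  have h : kompaktMul (S * T) = (kompaktMul S).comp (kompaktMul T) := by
    ext1 k
    exact Subtype.ext (mul_assoc _ _ _)
  simp [tensorMul, h, LinearMap.lTensor_comp]

lemma tensorMul_sub (S T : Ell2 →L[ℂ] Ell2) (y : B ⊗[ℂ] Kompakt) :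
    tensorMul B (S - T) y = tensorMul B S y - tensorMul B T y := by
  have h : kompaktMul (S - T) = kompaktMul S - kompaktMul T := by
    ext1 k
    exact Subtype.ext (sub_mul _ _ _)
  simp [tensorMul, h, LinearMap.lTensor_sub]

lemma tensorMul_smul (c : ℂ) (T : Ell2 →L[ℂ] Ell2) (y : B ⊗[ℂ] Kompakt) :
    tensorMul B (c • T) y = c • tensorMul B T y := by
  have h : kompaktMul (c • T) = c • kompaktMul T := by
    ext1 k
    exact Subtype.ext (smul_mul_assoc _ _ _)
  simp [tensorMul, h, LinearMap.lTensor_smul]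

/-- A linear map on `B ⊙ 𝒦` with dense range that is multiplicative and *-preserving on elementary
tensors. -/
structure TensorRep (B : Type*) [NonUnitalCStarAlgebra B] where
  θ : (B ⊗[ℂ] Kompakt) →ₗ[ℂ] B
  mul : ∀ (b c : B) (k l : Kompakt), θ (b ⊗ₜ k) * θ (c ⊗ₜ l) = θ ((b * c) ⊗ₜ (k * l))
  star : ∀ (b : B) (k : Kompakt), star (θ (b ⊗ₜ k)) = θ (star b ⊗ₜ star k)
  dense : DenseRange θ

namespace TensorRep

variable (Θ : TensorRep B)

lemma star_mul (S T : Ell2 →L[ℂ] Ell2) (y z : B ⊗[ℂ] Kompakt) :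
    Star.star (Θ.θ (tensorMul B S y)) * Θ.θ (tensorMul B T z)
      = Star.star (Θ.θ y) * Θ.θ (tensorMul B (Star.star S * T) z) := by
  induction y using TensorProduct.induction_on with
  | zero => simp only [map_zero, star_zero, zero_mul]
  | add y y' h h' => simp only [map_add, star_add, add_mul, h, h']
  | tmul b k =>
    induction z using TensorProduct.induction_on with
    | zero => simp only [map_zero, mul_zero]
    | add y y' h h' => simp only [map_add, mul_add, h, h']
    | tmul c l =>
      rw [tensorMul_tmul, tensorMul_tmul, tensorMul_tmul, Θ.star, Θ.star, Θ.mul, Θ.mul]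
      congr 2
      refine Subtype.ext ?_
      change Star.star (S * (k : Ell2 →L[ℂ] Ell2)) * (T * l)
        = Star.star (k : Ell2 →L[ℂ] Ell2) * (Star.star S * T * l)
      simp [mul_assoc]

/-- With `S* S = ‖T‖² - T* T`, the squares of `(1 ⊗ T) y` and `(1 ⊗ S) y` add up to `‖T‖² y* y`. No
property of the C*-norm on the tensor product other than the C*-identity is used. -/
lemma norm_tensorMul_le (T : Ell2 →L[ℂ] Ell2) (y : B ⊗[ℂ] Kompakt) :
    ‖Θ.θ (tensorMul B T y)‖ ≤ ‖T‖ * ‖Θ.θ y‖ := by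
  obtain ⟨S, hS⟩ := exists_star_mul_self_eq T
  refine norm_le_of_star_mul_self_add (norm_nonneg T) (b := Θ.θ (tensorMul B S y)) ?_
  rw [Θ.star_mul, Θ.star_mul, hS, tensorMul_sub, tensorMul_smul, tensorMul_one,
    map_sub, map_smul, mul_sub, mul_smul_comm, add_sub_cancel]

/-- Left multiplication by `1 ⊗ T` on the completion. -/
def mulLeft (T : Ell2 →L[ℂ] Ell2) : B →L[ℂ] B :=
  (Θ.θ.comp (tensorMul B T)).extendOfNorm Θ.θ

lemma mulLeft_apply (T : Ell2 →L[ℂ] Ell2) (y : B ⊗[ℂ] Kompakt) :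
    Θ.mulLeft T (Θ.θ y) = Θ.θ (tensorMul B T y) :=
  LinearMap.extendOfNorm_eq (f := Θ.θ.comp (tensorMul B T)) (e := Θ.θ) Θ.dense
    ⟨‖T‖, Θ.norm_tensorMul_le T⟩ y

lemma norm_mulLeft_le (T : Ell2 →L[ℂ] Ell2) (b : B) : ‖Θ.mulLeft T b‖ ≤ ‖T‖ * ‖b‖ :=
  LinearMap.norm_extendOfNorm_apply_le (f := Θ.θ.comp (tensorMul B T))
    (e := Θ.θ) Θ.dense ‖T‖ (Θ.norm_tensorMul_le T) b

lemma star_mulLeft_mul (T : Ell2 →L[ℂ] Ell2) (b c : B) :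
    Star.star (Θ.mulLeft (Star.star T) b) * c = Star.star b * Θ.mulLeft T c := by
  induction b using Θ.dense.induction_on with
  | hp => exact isClosed_eq (by fun_prop) (by fun_prop)
  | ih y =>
    induction c using Θ.dense.induction_on with
    | hp => exact isClosed_eq (by fun_prop) (by fun_prop)
    | ih z =>
      rw [mulLeft_apply, mulLeft_apply]
      have h := Θ.star_mul (Star.star T) 1 y z
      rwa [star_star, mul_one, tensorMul_one] at h

/-- The multiplier `1 ⊗ T`. -/
def mult (T : Ell2 →L[ℂ] Ell2) : 𝓜(ℂ, B) where
  fst := Θ.mulLeft T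
  snd := (((starₗᵢ ℂ : B ≃ₗᵢ⋆[ℂ] B) : B →L⋆[ℂ] B).comp (Θ.mulLeft (Star.star T))).comp
    ((starₗᵢ ℂ : B ≃ₗᵢ⋆[ℂ] B) : B →L⋆[ℂ] B)
  central x y := by
    have h := Θ.star_mulLeft_mul T (Star.star x) y
    rwa [star_star] at h

lemma mult_star (T : Ell2 →L[ℂ] Ell2) : Star.star (Θ.mult T) = Θ.mult (Star.star T) := by
  refine eq_of_fst_eq fun b => ?_
  rw [DoubleCentralizer.star_fst]
  change Star.star (Star.star (Θ.mulLeft (Star.star T) (Star.star (Star.star b)))) = _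
  rw [star_star, star_star]
  rfl

lemma eq_of_fst_eq_range {m n : 𝓜(ℂ, B)} (h : ∀ y, m.fst (Θ.θ y) = n.fst (Θ.θ y)) : m = n := by
  refine eq_of_fst_eq fun b => ?_
  induction b using Θ.dense.induction_on with
  | hp => exact isClosed_eq m.fst.continuous n.fst.continuous
  | ih y => exact h y

lemma mult_mul (S T : Ell2 →L[ℂ] Ell2) : Θ.mult S * Θ.mult T = Θ.mult (S * T) :=
  Θ.eq_of_fst_eq_range fun y => by
    change Θ.mulLeft S (Θ.mulLeft T _) = Θ.mulLeft (S * T) _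
    rw [mulLeft_apply, mulLeft_apply, mulLeft_apply, tensorMul_mul]

lemma mult_one : Θ.mult 1 = 1 := Θ.eq_of_fst_eq_range fun y => by
  change Θ.mulLeft 1 _ = _
  rw [mulLeft_apply, tensorMul_one]
  simp

lemma mult_zero : Θ.mult 0 = 0 := Θ.eq_of_fst_eq_range fun y => by
  change Θ.mulLeft 0 _ = _
  rw [mulLeft_apply, ← sub_self (0 : Ell2 →L[ℂ] Ell2), tensorMul_sub, sub_self, map_zero]
  simp

lemma mult_sum {ι : Type*} (F : Finset ι) (T : ι → Ell2 →L[ℂ] Ell2) :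
    ∑ i ∈ F, Θ.mult (T i) = Θ.mult (∑ i ∈ F, T i) := by
  classical
  have hadd (S T : Ell2 →L[ℂ] Ell2) : Θ.mult (S + T) = Θ.mult S + Θ.mult T :=
    Θ.eq_of_fst_eq_range fun y => by
      change Θ.mulLeft (S + T) _ = Θ.mulLeft S _ + Θ.mulLeft T _
      have h := tensorMul_sub (S + T) T y
      rw [add_sub_cancel_right] at h
      rw [mulLeft_apply, mulLeft_apply, mulLeft_apply, h, map_sub, sub_add_cancel]
  induction F using Finset.induction_on with
  | empty => simp [Θ.mult_zero]
  | insert i F hi ih => rw [Finset.sum_insert hi, Finset.sum_insert hi, ih, hadd]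

/-- On a product of two elementary tensors the error is `1 ⊗ (P k - k)` applied to `(b c) ⊗ l`,
which is bounded by `‖P k - k‖` without knowledge of a cross norm. General elements are limits of
such products by density and the approximate unit, and the set where convergence holds is closed. -/
lemma tendsto_proj {ι : Type*} (hB : IsSigmaUnital B) (e : ι × ℕ ≃ ℕ) (b : B) :
    Filter.Tendsto (fun F => Θ.mulLeft (ell2Proj e F) b) Filter.atTop (nhds b) := by
  have hc : ∀ (F : Finset ι) (v w : B),
      ‖Θ.mulLeft (ell2Proj e F) v - Θ.mulLeft (ell2Proj e F) w‖ ≤ ‖v - w‖ := fun F v w => by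
    rw [← map_sub]
    exact (Θ.norm_mulLeft_le _ _).trans
      (by nlinarith [norm_nonneg (v - w), norm_ell2Proj_le e F])
  have hcl := isClosed_setOf_tendsto_self (l := Filter.atTop)
    (f := fun F v => Θ.mulLeft (ell2Proj e F) v) hc
  have h1 (y z : B ⊗[ℂ] Kompakt) : Filter.Tendsto
      (fun F => Θ.mulLeft (ell2Proj e F) (Θ.θ y * Θ.θ z)) Filter.atTop (nhds (Θ.θ y * Θ.θ z)) := by
    induction y using TensorProduct.induction_on with
    | zero => simp
    | add y y' h h' => simpa [add_mul] using h.add h'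
    | tmul b k =>
      induction z using TensorProduct.induction_on with
      | zero => simp
      | add y y' h h' => simpa [mul_add] using h.add h'
      | tmul c l =>
        have e1 (F : Finset ι) : Θ.mulLeft (ell2Proj e F) (Θ.θ (b ⊗ₜ k) * Θ.θ (c ⊗ₜ l))
            - Θ.θ (b ⊗ₜ k) * Θ.θ (c ⊗ₜ l)
            = Θ.θ (tensorMul B (ell2Proj e F * k - k) ((b * c) ⊗ₜ l)) := by
          rw [Θ.mul, mulLeft_apply, tensorMul_tmul, tensorMul_tmul, ← map_sub,
            ← TensorProduct.tmul_sub]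
          congr 2
        rw [tendsto_iff_norm_sub_tendsto_zero]
        simp only [e1]
        refine squeeze_zero (fun _ => norm_nonneg _) (fun F => Θ.norm_tensorMul_le _ _) ?_
        simpa using (tendsto_ell2Proj_mul e k.2).mul_const ‖Θ.θ ((b * c) ⊗ₜ l)‖
  have h2 (y : B ⊗[ℂ] Kompakt) (c : B) : Filter.Tendsto
      (fun F => Θ.mulLeft (ell2Proj e F) (Θ.θ y * c)) Filter.atTop (nhds (Θ.θ y * c)) := by
    induction c using Θ.dense.induction_on with
    | hp => exact hcl.preimage (continuous_const.mul continuous_id)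
    | ih z => exact h1 y z
  obtain ⟨u, -, hu⟩ := hB
  induction b using Θ.dense.induction_on with
  | hp => exact hcl
  | ih y => exact hcl.mem_of_tendsto (hu (Θ.θ y)).2 (Filter.Eventually.of_forall fun n => h2 y (u n))

/-- The frame of isometries attached to a bijection `ι × ℕ ≃ ℕ`. -/
def frame {G : Type*} [Group G] [TopologicalSpace G] {β : CStarAction G B} {ι : Type*}
    (hB : IsSigmaUnital B) (e : ι × ℕ ≃ ℕ)
    (hβ : ∀ (g : G) (b : B) (k : Kompakt), Θ.θ (β.toHom g b ⊗ₜ k) = β.toHom g (Θ.θ (b ⊗ₜ k))) :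
    IsoFrame β ι where
  r i := Θ.mult (ell2Isometry e i)
  fixed i g := by
    refine Θ.eq_of_fst_eq_range fun y => ?_
    change β.toHom g (Θ.mulLeft _ ((β.toHom g).symm (Θ.θ y))) = Θ.mulLeft _ (Θ.θ y)
    induction y using TensorProduct.induction_on with
    | zero => simp
    | add y y' h h' => simp only [map_add, h, h']
    | tmul b k =>
      have h1 : (β.toHom g).symm (Θ.θ (b ⊗ₜ k)) = Θ.θ ((β.toHom g).symm b ⊗ₜ k) := by
        rw [StarAlgEquiv.symm_apply_eq, ← hβ, StarAlgEquiv.apply_symm_apply]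
      rw [h1, mulLeft_apply, mulLeft_apply, tensorMul_tmul, tensorMul_tmul, ← hβ,
        StarAlgEquiv.apply_symm_apply]
  isom i := by
    classical
    rw [mult_star, mult_mul, star_mul_ell2Isometry, if_pos rfl, mult_one]
  orth i j h := by
    classical
    rw [mult_star, mult_mul, star_mul_ell2Isometry, if_neg h, mult_zero]
  full b := by
    simp only [mult_star, mult_mul]
    have h := Θ.tendsto_proj hB e b
    rw [HasSum, SummationFilter.unconditional_filter]
    refine h.congr fun F => ?_
    rw [← sum_fst, mult_sum]
    rfl

end TensorRep

/-- A bijection of `ι × ℕ` with `ℕ` splits the Hilbert space into copies of itself indexed by `ι`.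
The corresponding isometries `1 ⊗ T` are fixed because the action is trivial on the second tensor
factor. -/
lemma exists_isoFrame {G : Type*} [Group G] [TopologicalSpace G] {β : CStarAction G B}
    (hB : IsSigmaUnital B) (hβ : StronglyStable β) (ι : Type*) [Countable ι] [Nonempty ι] :
    Nonempty (IsoFrame β ι) := by
  obtain ⟨Θ, -, hd, hg⟩ := hβ
  obtain ⟨⟨e⟩⟩ : Nonempty (Nonempty (ι × ℕ ≃ ℕ)) := by
    obtain ⟨h⟩ := nonempty_denumerable (ι × ℕ)
    exact ⟨⟨Denumerable.eqv _⟩⟩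
  let Θ' : TensorRep B :=
    { θ :=
        { toFun := Θ
          map_add' := Θ.map_add'
          map_smul' := Θ.map_smul' }
      mul := fun b c k l => ((Θ.map_mul' (b ⊗ₜ k) (c ⊗ₜ l)).symm.trans
        (congrArg Θ (Algebra.TensorProduct.tmul_mul_tmul b c k l)))
      star := fun b k => (Θ.map_star' (b ⊗ₜ k)).symm
      dense := hd }
  exact ⟨Θ'.frame hB e hg⟩

end Stabilization

/-! ### Evaluation of cocycle representations over the cylinder -/

section Cylinder

variable {G : Type*} [Group G] [TopologicalSpace G]
variable {A : Type*} [NonUnitalCStarAlgebra A] {B : Type*} [NonUnitalCStarAlgebra B]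
variable {α : CStarAction G A} {β : CStarAction G B}

/-- Multipliers act fibrewise: multiplying `m f` on the left by a constant function `e` gives `(e m)
f`, whose value at `s` depends on `f` only through `f s`. -/
lemma fst_apply_eval (s : unitInterval) (m : 𝓜(ℂ, C(unitInterval, B))) (f : C(unitInterval, B)) :
    m.fst f s = (evMult s m).fst (f s) := by
  refine eq_of_forall_mul_eq fun e => ?_
  rw [← (evMult s m).central]
  have h := congrArg (fun f : C(unitInterval, B) => f s) (m.central (constCLM B e) f)
  exact h.symm

lemma evMult_star (s : unitInterval) (m : 𝓜(ℂ, C(unitInterval, B))) :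
    evMult s (star m) = star (evMult s m) := rfl

/-- The evaluation map `𝓜(B[0,1]) → 𝓜(B)` as a *-homomorphism. -/
def evHom (s : unitInterval) : 𝓜(ℂ, C(unitInterval, B)) →⋆ₐ[ℂ] 𝓜(ℂ, B) where
  toFun := evMult s
  map_one' := eq_of_fst_eq fun _ => rfl
  map_mul' m n := eq_of_fst_eq fun b => by
    change m.fst (n.fst (constCLM B b)) s = (evMult s m).fst ((evMult s n).fst b)
    rw [fst_apply_eval]
    rfl
  map_zero' := eq_of_fst_eq fun _ => rfl
  map_add' m n := eq_of_fst_eq fun _ => rfl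
  commutes' c := eq_of_fst_eq fun b => by
    rw [Algebra.algebraMap_eq_smul_one, Algebra.algebraMap_eq_smul_one]
    rfl
  map_star' m := evMult_star s m

lemma evHom_coe (s : unitInterval) (f : C(unitInterval, B)) :
    evHom s (f : 𝓜(ℂ, C(unitInterval, B))) = (f s : B) :=
  eq_of_fst_eq fun _ => rfl

lemma evHom_mult (s : unitInterval) (g : G) (m : 𝓜(ℂ, C(unitInterval, B))) :
    evHom s (β.cyl.mult g m) = β.mult g (evHom s m) :=
  eq_of_fst_eq fun _ => rfl

/-- Evaluation of a cocycle representation over the cylinder. -/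
def CocycleRep.eval (X : CocycleRep α β.cyl) (s : unitInterval) : CocycleRep α β where
  hom :=
    { toFun := fun a => evHom s (X.hom a)
      map_smul' := fun c a => by rw [map_smul, map_smul]; rfl
      map_zero' := by rw [map_zero, map_zero]
      map_add' := fun a b => by rw [map_add, map_add]
      map_mul' := fun a b => by rw [map_mul, map_mul]
      map_star' := fun a => by rw [map_star, map_star] }
  coc g := evHom s (X.coc g)
  coc_mem_unitary g := Unitary.map_mem (evHom s) (X.coc_mem_unitary g)
  strict_left b := (ContinuousMap.evalCLM ℂ s).continuous.comp (X.strict_left (constCLM B b))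
  strict_right b := (ContinuousMap.evalCLM ℂ s).continuous.comp (X.strict_right (constCLM B b))
  coc_mul g h := by rw [X.coc_mul, map_mul, evHom_mult]
  covariant g a := by
    change evHom s (X.coc g) * β.mult g (evHom s (X.hom a)) * star (evHom s (X.coc g))
      = evHom s (X.hom (α.toHom g a))
    rw [← evHom_mult, ← map_star, ← map_mul, ← map_mul, X.covariant]

lemma CocycleRep.val_eval (X : CocycleRep α β.cyl) (s : unitInterval) (τ : A ⊕ G) :
    (X.eval s).val τ = evHom s (X.val τ) := by
  rcases τ with a | g <;> rfl

lemma CocycleRep.EvalsTo.val_eq {X : CocycleRep α β.cyl} {s : unitInterval}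
    {x : CocycleRep α β} (h : CocycleRep.EvalsTo s X x) (τ : A ⊕ G) :
    (X.eval s).val τ = x.val τ := by
  rcases τ with a | g
  · exact h.1 a
  · exact h.2 g

lemma evHom_twist (s : unitInterval) (τ : A ⊕ G) (m : 𝓜(ℂ, C(unitInterval, B))) :
    evHom s (twist A β.cyl τ m) = twist A β τ (evHom s m) := by
  rcases τ with a | g
  · rfl
  · exact evHom_mult s g m

end Cylinder

/-! ### Joint continuity -/

section Continuity

variable {G : Type*} [Group G] [TopologicalSpace G]
variable {A : Type*} [NonUnitalCStarAlgebra A] {C : Type*} [NonUnitalCStarAlgebra C]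
variable {α : CStarAction G A} {γ : CStarAction G C}

/-- Strict continuity only gives continuity for each fixed vector. The norm bound upgrades it to
joint continuity, which is what keeps images of compact sets compact below. -/
lemma continuous_of_lipschitz_of_continuous {X E F : Type*} [TopologicalSpace X]
    [SeminormedAddCommGroup E] [SeminormedAddCommGroup F] {f : X → E → F} {K : X → ℝ}
    (hK : Continuous K) (hf : ∀ x v w, ‖f x v - f x w‖ ≤ K x * ‖v - w‖)
    (hc : ∀ v, Continuous fun x => f x v) : Continuous fun p : X × E => f p.1 p.2 := by
  rw [continuous_iff_continuousAt]
  rintro ⟨x, v⟩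
  rw [ContinuousAt, tendsto_iff_norm_sub_tendsto_zero]
  have h1 : Filter.Tendsto (fun p : X × E => K p.1 * ‖p.2 - v‖ + ‖f p.1 v - f x v‖)
      (nhds (x, v)) (nhds 0) := by
    have hc : Continuous fun p : X × E => K p.1 * ‖p.2 - v‖ + ‖f p.1 v - f x v‖ :=
      ((hK.comp continuous_fst).mul (continuous_snd.sub continuous_const).norm).add
        (((hc v).comp continuous_fst).sub continuous_const).norm
    simpa using hc.tendsto (x, v)
  refine squeeze_zero (fun _ => norm_nonneg _) (fun p => ?_) h1
  have h2 : f p.1 p.2 - f x v = (f p.1 p.2 - f p.1 v) + (f p.1 v - f x v) := by abel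
  rw [h2]
  exact (norm_add_le _ _).trans (by gcongr; exact hf _ _ _)

/-- A continuous bound for the norm of the values of a cocycle representation. -/
def valBound (A G : Type*) [NonUnitalCStarAlgebra A] : A ⊕ G → ℝ :=
  Sum.elim (fun a => ‖a‖) (fun _ => 1)

lemma continuous_valBound : Continuous (valBound A G) :=
  continuous_sumElim.mpr ⟨continuous_norm, continuous_const⟩

namespace CocycleRep

variable (x : CocycleRep α γ)

lemma norm_val_le_valBound (τ : A ⊕ G) : ‖x.val τ‖ ≤ valBound A G τ := x.norm_val_le τ

lemma continuous_hom : Continuous x.hom :=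
  AddMonoidHomClass.continuous_of_bound x.hom 1 fun a => by
    simpa using NonUnitalStarAlgHom.norm_apply_le x.hom a

lemma continuous_val_fst (c : C) : Continuous fun τ => (x.val τ).fst c := by
  have hf (m n : 𝓜(ℂ, C)) : ‖m.fst c - n.fst c‖ ≤ ‖c‖ * ‖m - n‖ := by
    rw [mul_comm]
    exact norm_fst_le (m - n) c
  have h : Continuous fun m : 𝓜(ℂ, C) => m.fst c :=
    (LipschitzWith.of_dist_le_mul (K := ‖c‖₊) fun m n => by
      simpa [dist_eq_norm] using hf m n).continuous
  have e : (fun τ => (x.val τ).fst c)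
      = Sum.elim (fun a => (x.hom a).fst c) fun g => (x.coc g).fst c := by
    ext τ
    rcases τ with a | g <;> rfl
  rw [e]
  exact continuous_sumElim.mpr ⟨h.comp x.continuous_hom, x.strict_left c⟩

lemma continuous_star_val_fst (c : C) : Continuous fun τ => (star (x.val τ)).fst c := by
  have hf (m n : 𝓜(ℂ, C)) : ‖m.snd (star c) - n.snd (star c)‖ ≤ ‖c‖ * ‖m - n‖ := by
    rw [mul_comm, ← norm_star c]
    exact norm_snd_le (m - n) (star c)
  have h : Continuous fun m : 𝓜(ℂ, C) => m.snd (star c) :=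
    (LipschitzWith.of_dist_le_mul (K := ‖c‖₊) fun m n => by
      simpa [dist_eq_norm] using hf m n).continuous
  have e : (fun τ => (x.val τ).snd (star c))
      = Sum.elim (fun a => (x.hom a).snd (star c)) fun g => (x.coc g).snd (star c) := by
    ext τ
    rcases τ with a | g <;> rfl
  have h' : Continuous fun τ => (x.val τ).snd (star c) := by
    rw [e]
    exact continuous_sumElim.mpr ⟨h.comp x.continuous_hom, x.strict_right (star c)⟩
  exact h'.star

lemma continuous_val_snd (c : C) : Continuous fun τ => (x.val τ).snd c := by
  simpa using (x.continuous_star_val_fst (star c)).star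

lemma continuous_val_fst_prod : Continuous fun p : (A ⊕ G) × C => (x.val p.1).fst p.2 :=
  continuous_of_lipschitz_of_continuous (f := fun τ c => (x.val τ).fst c) continuous_valBound
    (fun τ v w => by
      rw [← map_sub]
      exact (norm_fst_le _ _).trans (by gcongr; exact x.norm_val_le_valBound τ))
    x.continuous_val_fst

lemma continuous_star_val_fst_prod :
    Continuous fun p : (A ⊕ G) × C => (star (x.val p.1)).fst p.2 :=
  continuous_of_lipschitz_of_continuous (f := fun τ c => (star (x.val τ)).fst c)
    continuous_valBound
    (fun τ v w => by
      rw [← map_sub]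
      refine (norm_fst_le _ _).trans ?_
      rw [norm_star]
      gcongr
      exact x.norm_val_le_valBound τ)
    x.continuous_star_val_fst

end CocycleRep

/-- The restriction of `twist` to `C`. -/
def twistAut (A : Type*) (γ : CStarAction G C) : A ⊕ G → (C ≃⋆ₐ[ℂ] C) :=
  Sum.elim (fun _ => 1) γ.toHom

lemma twist_coe (τ : A ⊕ G) (c : C) :
    twist A γ τ (c : 𝓜(ℂ, C)) = (twistAut A γ τ c : C) := by
  rcases τ with a | g
  · rfl
  · exact mult_coe γ g c

lemma norm_aut (σ : C ≃⋆ₐ[ℂ] C) (c : C) : ‖σ c‖ = ‖c‖ :=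
  NonUnitalStarAlgHom.norm_map σ σ.injective c

lemma continuous_twistAut (c : C) : Continuous fun τ : A ⊕ G => twistAut A γ τ c := by
  have e : (fun τ : A ⊕ G => twistAut A γ τ c) = Sum.elim (fun _ => c) fun g => γ.toHom g c := by
    ext τ
    rcases τ with a | g <;> rfl
  rw [e]
  exact continuous_sumElim.mpr ⟨continuous_const, γ.continuous_orbit c⟩

lemma continuous_twistAut_symm_prod [IsTopologicalGroup G] :
    Continuous fun p : (A ⊕ G) × C => (twistAut A γ p.1).symm p.2 := by
  refine continuous_of_lipschitz_of_continuous (f := fun τ c => (twistAut A γ τ).symm c)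
    (K := fun _ => 1) continuous_const (fun τ v w => ?_) fun c => ?_
  · rw [← map_sub, norm_aut, one_mul]
  · have e : (fun τ : A ⊕ G => (twistAut A γ τ).symm c)
        = Sum.elim (fun _ => c) fun g => γ.toHom g⁻¹ c := by
      ext τ
      rcases τ with a | g
      · rfl
      · rw [Sum.elim_inr, map_inv]
        rfl
    rw [e]
    exact continuous_sumElim.mpr
      ⟨continuous_const, (γ.continuous_orbit c).comp continuous_inv⟩

end Continuity

/-! ### Quasicentral approximate units -/

section Averaging

/-- The C*-identity expands the square. Only the `m` diagonal terms are of size `M ^ 2`, so the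
square grows like `m` instead of `m ^ 2` up to the almost orthogonality `δ`. -/
lemma norm_sum_sq_le {C : Type*} [NonUnitalCStarAlgebra C] {m : ℕ} {c : ℕ → C} {M δ : ℝ}
    (hM : ∀ i, ‖c i‖ ≤ M) (hδ : ∀ i j, i < j → ‖star (c j) * c i‖ ≤ δ) :
    ‖∑ i ∈ Finset.range m, c i‖ ^ 2 ≤ m * M ^ 2 + m ^ 2 * δ := by
  have hM0 : 0 ≤ M := (norm_nonneg _).trans (hM 0)
  have hδ0 : 0 ≤ δ := (norm_nonneg _).trans (hδ 0 1 zero_lt_one)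
  have key (i j : ℕ) : ‖star (c i) * c j‖ ≤ (if j = i then M ^ 2 else 0) + δ := by
    rcases lt_trichotomy i j with h | h | h
    · rw [if_neg h.ne', zero_add, ← norm_star, star_mul, star_star]
      exact hδ i j h
    · subst h
      rw [if_pos rfl, CStarRing.norm_star_mul_self]
      nlinarith [hM i, norm_nonneg (c i)]
    · rw [if_neg h.ne, zero_add]
      exact hδ j i h
  rw [sq, ← CStarRing.norm_star_mul_self, star_sum, Finset.sum_mul_sum]
  calc _ ≤ ∑ i ∈ Finset.range m, ∑ j ∈ Finset.range m, ((if j = i then M ^ 2 else 0) + δ) := by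
        refine (norm_sum_le _ _).trans (Finset.sum_le_sum fun i _ => ?_)
        exact (norm_sum_le _ _).trans (Finset.sum_le_sum fun j _ => key i j)
    _ ≤ ∑ i ∈ Finset.range m, (M ^ 2 + m * δ) := by
        refine Finset.sum_le_sum fun i hi => ?_
        rw [Finset.sum_add_distrib, Finset.sum_ite_eq', if_pos hi]
        simp
    _ = _ := by simp; ring

/-- If the elements `L_l (f_n)` are asymptotically orthogonal as `n → ∞`, uniformly in `l ∈ K`,
then some convex combinations of the `f_n` have small image under all `L_l`. -/
lemma exists_convexHull_norm_le {E C Λ : Type*} [AddCommGroup E] [Module ℝ E]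
    [NonUnitalCStarAlgebra C] (L : Λ → E →ₗ[ℝ] C) (f : ℕ → E) (K : Set Λ) {M : ℝ}
    (hM : ∀ l ∈ K, ∀ n, ‖L l (f n)‖ ≤ M)
    (h : ∀ j, ∀ ε > 0, ∀ᶠ n in Filter.atTop, ∀ l ∈ K, ‖star (L l (f n)) * L l (f j)‖ ≤ ε)
    {ε : ℝ} (hε : 0 < ε) (N : ℕ) :
    ∃ e ∈ convexHull ℝ (f '' Set.Ici N), ∀ l ∈ K, ‖L l e‖ ≤ ε := by
  -- Each new index is chosen so that its images are almost orthogonal to all earlier ones.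
  obtain ⟨n, hn, hr⟩ := exists_seq_of_forall_finset_exists (fun n => N ≤ n)
    (fun j n => ∀ l ∈ K, ‖star (L l (f n)) * L l (f j)‖ ≤ ε ^ 2 / 2) (fun s _ => by
      have h1 : ∀ᶠ n in Filter.atTop, ∀ j ∈ s, ∀ l ∈ K,
          ‖star (L l (f n)) * L l (f j)‖ ≤ ε ^ 2 / 2 :=
        (Filter.eventually_all_finset s).mpr fun j _ => h j _ (by positivity)
      obtain ⟨y, hy⟩ := ((Filter.eventually_ge_atTop N).and h1).exists
      exact ⟨y, hy.1, hy.2⟩)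
  -- The average of `m` terms has squared norm at most `M ^ 2 / m + ε ^ 2 / 2`, so `m` has to exceed
  -- `2 * M ^ 2 / ε ^ 2`.
  obtain ⟨m, hm⟩ := exists_nat_gt (2 * M ^ 2 / ε ^ 2)
  have hm0 : (0 : ℝ) < m := lt_of_le_of_lt (by positivity) hm
  refine ⟨∑ i ∈ Finset.range m, (1 / (m : ℝ)) • f (n i), ?_, fun l hl => ?_⟩
  · refine (convex_convexHull ℝ _).sum_mem (fun _ _ => by positivity) ?_ fun i _ =>
      subset_convexHull _ _ ⟨n i, hn i, rfl⟩
    simp [hm0.ne']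
  · have h1 := norm_sum_sq_le (m := m) (c := fun i => L l (f (n i))) (fun i => hM l hl _)
      (fun i j hij => hr i j hij l hl)
    have h2 : L l (∑ i ∈ Finset.range m, (1 / (m : ℝ)) • f (n i))
        = (1 / (m : ℝ)) • ∑ i ∈ Finset.range m, L l (f (n i)) := by
      rw [← Finset.smul_sum, map_smul, map_sum]
    rw [h2, norm_smul, Real.norm_of_nonneg (by positivity), one_div, inv_mul_le_iff₀ hm0]
    refine (abs_le_of_sq_le_sq' (h1.trans ?_) (by positivity)).2
    rw [div_lt_iff₀ (by positivity)] at hm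
    nlinarith

end Averaging

/-! ### Positive contractions, without a chosen order -/

section PosContr

/-- `0 ≤ m ≤ 1`. -/
def IsPosContr {C : Type*} [CStarAlgebra C] (m : C) : Prop :=
  (∃ p, star p * p = m) ∧ ∃ q, star q * q = 1 - m

variable {C : Type*} [CStarAlgebra C]

lemma isPosContr_iff [PartialOrder C] [StarOrderedRing C] {m : C} :
    IsPosContr m ↔ 0 ≤ m ∧ m ≤ 1 := by
  rw [IsPosContr, ← sub_nonneg (b := m), CStarAlgebra.nonneg_iff_eq_star_mul_self,
    CStarAlgebra.nonneg_iff_eq_star_mul_self]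
  simp only [eq_comm]

lemma IsPosContr.star_eq {m : C} (h : IsPosContr m) : star m = m := by
  obtain ⟨⟨p, rfl⟩, -⟩ := h
  simp

lemma IsPosContr.zero : IsPosContr (0 : C) := ⟨⟨0, by simp⟩, ⟨1, by simp⟩⟩

lemma IsPosContr.one : IsPosContr (1 : C) := ⟨⟨1, by simp⟩, ⟨0, by simp⟩⟩

lemma IsPosContr.compl {m : C} (h : IsPosContr m) : IsPosContr (1 - m) :=
  ⟨h.2, by simpa using h.1⟩

lemma IsPosContr.norm_le {m : C} (h : IsPosContr m) : ‖m‖ ≤ 1 := by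
  obtain ⟨⟨p, rfl⟩, q, hq⟩ := h
  have h1 := norm_star_mul_self_le_add p q
  rw [hq, add_sub_cancel] at h1
  refine h1.trans ?_
  rcases subsingleton_or_nontrivial C with h | h
  · simp [Subsingleton.elim (1 : C) 0]
  · exact (CStarRing.norm_one).le

lemma isPosContr_star_mul_self {e : C} (he : ‖e‖ ≤ 1) : IsPosContr (star e * e) := by
  let _ := CStarAlgebra.spectralOrder C
  let _ := CStarAlgebra.spectralOrderedRing C
  rw [isPosContr_iff]
  refine ⟨star_mul_self_nonneg e, ?_⟩
  refine CStarAlgebra.star_mul_le_algebraMap_norm_sq.trans ?_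
  rw [← map_one (algebraMap ℝ C)]
  exact algebraMap_mono C (pow_le_one₀ (norm_nonneg _) he)

lemma convex_isPosContr : Convex ℝ {m : C | IsPosContr m} := by
  let _ := CStarAlgebra.spectralOrder C
  let _ := CStarAlgebra.spectralOrderedRing C
  have h : {m : C | IsPosContr m} = Set.Icc 0 1 := by
    ext m
    exact isPosContr_iff
  rw [h]
  exact convex_Icc 0 1

end PosContr

/-! ### Quasicentrality by averaging -/

section Quasicentral

variable {G : Type*} [Group G] [TopologicalSpace G]
variable {A : Type*} [NonUnitalCStarAlgebra A]

section

variable {C : Type*} [NonUnitalCStarAlgebra C]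
variable {α : CStarAction G A} {γ : CStarAction G C}

/-- The defect of `c ∈ C` from being an endomorphism of `x`. -/
def CocycleRep.defect (x : CocycleRep α γ) (τ : A ⊕ G) : C →ₗ[ℂ] C where
  toFun c := (x.val τ).snd c - (x.val τ).fst (twistAut A γ τ c)
  map_add' c d := by simp only [map_add]; abel
  map_smul' r c := by simp only [map_smul, smul_sub, RingHom.id_apply]

lemma CocycleRep.defect_apply (x : CocycleRep α γ) (τ : A ⊕ G) (c : C) :
    x.defect τ c = (x.val τ).snd c - (x.val τ).fst (twistAut A γ τ c) := rfl

lemma CocycleRep.coe_defect (x : CocycleRep α γ) (τ : A ⊕ G) (c : C) :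
    ((x.defect τ c : C) : 𝓜(ℂ, C)) = c * x.val τ - x.val τ * twist A γ τ (c : 𝓜(ℂ, C)) := by
  rw [x.defect_apply, coe_sub, twist_coe, mul_coe, coe_mul]

lemma CocycleRep.continuous_defect (x : CocycleRep α γ) (c : C) :
    Continuous fun τ => x.defect τ c :=
  (x.continuous_val_snd c).sub
    (x.continuous_val_fst_prod.comp (continuous_id.prodMk (continuous_twistAut c)))

lemma CocycleRep.norm_defect_le (x : CocycleRep α γ) (τ : A ⊕ G) {c : C} (hc : ‖c‖ ≤ 1) :
    ‖x.defect τ c‖ ≤ 2 * valBound A G τ := by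
  have h0 : 0 ≤ valBound A G τ := (norm_nonneg _).trans (x.norm_val_le_valBound τ)
  have h1 := (norm_snd_le (x.val τ) c).trans
    (mul_le_mul (x.norm_val_le_valBound τ) hc (norm_nonneg _) h0)
  have h2 := (norm_fst_le (x.val τ) (twistAut A γ τ c)).trans
    (mul_le_mul (x.norm_val_le_valBound τ) ((norm_aut _ _).trans_le hc) (norm_nonneg _) h0)
  rw [x.defect_apply]
  exact (norm_sub_le _ _).trans (by linarith)

/-- Write `v` for the value of `x` at `τ` and `σ` for the automorphism. Subtracting and adding `v*
d` gives `(v* f - σ(f) v*) d = v* (f d - d) - σ(f c - c)` with `c = σ⁻¹(v* d)`. Both terms are small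
once `f` is far out in an approximate unit, so defects of an approximate unit are asymptotically
orthogonal to any fixed element. -/
lemma norm_star_defect_mul_le (x : CocycleRep α γ) (τ : A ⊕ G) {f : C} (hf : star f = f) (d : C) :
    ‖star (x.defect τ f) * d‖ ≤ valBound A G τ * ‖f * d - d‖
      + ‖f * (twistAut A γ τ).symm ((star (x.val τ)).fst d)
          - (twistAut A γ τ).symm ((star (x.val τ)).fst d)‖ := by
  set σ := twistAut A γ τ
  have h1 : star (x.defect τ f) * d = (star (x.val τ)).fst (f * d - d)
      - σ (f * σ.symm ((star (x.val τ)).fst d) - σ.symm ((star (x.val τ)).fst d)) := by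
    apply coe_injective
    simp only [coe_mul_coe, coe_star, coe_sub, ← mul_coe, x.coe_defect, map_sub, map_mul,
      StarAlgEquiv.apply_symm_apply, twist_coe, star_sub, star_mul]
    rw [← coe_star, ← coe_star, hf]
    have h2 : star (twistAut A γ τ f) = σ f := by rw [← map_star, hf]
    rw [h2]
    noncomm_ring
  rw [h1]
  refine (norm_sub_le _ _).trans ?_
  rw [norm_aut]
  gcongr
  refine (norm_fst_le _ _).trans ?_
  rw [norm_star]
  gcongr
  exact x.norm_val_le_valBound τ

lemma eventually_norm_star_defect_mul_le [IsTopologicalGroup G] (x : CocycleRep α γ)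
    {f : ℕ → C} (hs : ∀ n, star (f n) = f n) (hn : ∀ n, ‖f n‖ ≤ 1)
    (hf : ∀ c, Filter.Tendsto (fun n => f n * c) Filter.atTop (nhds c))
    {K : Set (A ⊕ G)} (hK : IsCompact K) (c : C) {ε : ℝ} (hε : 0 < ε) :
    ∀ᶠ n in Filter.atTop, ∀ τ ∈ K, ‖star (x.defect τ (f n)) * x.defect τ c‖ ≤ ε := by
  obtain ⟨M, hM⟩ := hK.bddAbove_image (continuous_valBound (A := A) (G := G)).continuousOn
  have hM' (τ) (hτ : τ ∈ K) : valBound A G τ ≤ |M| + 1 :=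
    (hM ⟨τ, hτ, rfl⟩).trans ((le_abs_self M).trans (by linarith))
  have hc (n : ℕ) (v w : C) : ‖f n * v - f n * w‖ ≤ ‖v - w‖ := by
    rw [← mul_sub]
    exact (norm_mul_le _ _).trans (by nlinarith [norm_nonneg (v - w), hn n])
  -- The vectors on which `f n` must act almost as the identity form compact sets as `τ` runs
  -- through `K`. Pointwise convergence is uniform on them.
  have h1 := hK.image (x.continuous_defect c)
  have h2 := hK.image (f := fun τ =>
    (twistAut A γ τ).symm ((star (x.val τ)).fst (x.defect τ c)))
    (continuous_twistAut_symm_prod.comp (continuous_id.prodMk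
      (x.continuous_star_val_fst_prod.comp (continuous_id.prodMk (x.continuous_defect c)))))
  filter_upwards [eventually_forall_norm_sub_le (f := fun n c => f n * c) hc hf h1.totallyBounded
    (ε := ε / (2 * (|M| + 1))) (by positivity),
    eventually_forall_norm_sub_le (f := fun n c => f n * c) hc hf h2.totallyBounded
    (ε := ε / 2) (by positivity)] with n e1 e2 τ hτ
  refine (norm_star_defect_mul_le x τ (hs n) _).trans ?_
  have e3 : valBound A G τ * ‖f n * x.defect τ c - x.defect τ c‖
      ≤ (|M| + 1) * (ε / (2 * (|M| + 1))) :=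
    mul_le_mul (hM' τ hτ) (e1 _ ⟨τ, hτ, rfl⟩) (norm_nonneg _) (by positivity)
  have e4 : (|M| + 1) * (ε / (2 * (|M| + 1))) = ε / 2 := by field_simp
  linarith [e2 _ ⟨τ, hτ, rfl⟩]

end

variable {B : Type*} [NonUnitalCStarAlgebra B]
variable {α : CStarAction G A} {β : CStarAction G B}

lemma norm_constCLM (b : B) : ‖constCLM B b‖ ≤ ‖b‖ :=
  (ContinuousMap.norm_le _ (norm_nonneg b)).mpr fun _ => le_rfl

lemma IsSigmaUnital.exists_isPosContr (hB : IsSigmaUnital B) :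
    ∃ f : ℕ → B, (∀ n, IsPosContr (f n : 𝓜(ℂ, B))) ∧
      ∀ b, Filter.Tendsto (fun n => f n * b) Filter.atTop (nhds b) := by
  obtain ⟨e, he, hb⟩ := hB
  refine ⟨fun n => star (e n) * e n, fun n => ?_, fun b => ?_⟩
  · rw [coe_mul_coe, coe_star]
    exact isPosContr_star_mul_self (by rw [norm_coe]; exact he n)
  · have h1 : Filter.Tendsto (fun n => star (e n) * b) Filter.atTop (nhds b) := by
      simpa using (hb (star b)).2.star
    rw [tendsto_iff_norm_sub_tendsto_zero] at h1 ⊢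
    have h2 := (tendsto_iff_norm_sub_tendsto_zero.mp (hb b).1).add h1
    rw [add_zero] at h2
    refine squeeze_zero (fun _ => norm_nonneg _) (fun n => ?_) h2
    have h3 : star (e n) * e n * b - b = star (e n) * (e n * b - b) + (star (e n) * b - b) := by
      rw [mul_sub, mul_assoc]; abel
    rw [h3]
    refine (norm_add_le _ _).trans ?_
    gcongr
    refine (norm_mul_le _ _).trans ?_
    rw [norm_star]
    nlinarith [he n, norm_nonneg (e n * b - b)]

lemma IsPosContr.coe_star_eq {b : B} (h : IsPosContr (b : 𝓜(ℂ, B))) : star b = b :=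
  coe_injective (by simpa only [coe_star] using h.star_eq)

lemma IsPosContr.coe_norm_le {b : B} (h : IsPosContr (b : 𝓜(ℂ, B))) : ‖b‖ ≤ 1 := by
  rw [← norm_coe]
  exact h.norm_le

lemma contraction_mul {b : B} (h : ‖b‖ ≤ 1) (v w : B) : ‖b * v - b * w‖ ≤ ‖v - w‖ := by
  rw [← mul_sub]
  exact (norm_mul_le _ _).trans (by nlinarith [norm_nonneg (v - w)])

lemma norm_constCLM_mul_sub_le {e : B} {c : C(unitInterval, B)} {ε : ℝ} (hε : 0 ≤ ε)
    (h : ∀ v ∈ Set.range c, ‖e * v - v‖ ≤ ε) : ‖constCLM B e * c - c‖ ≤ ε :=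
  (ContinuousMap.norm_le _ hε).mpr fun s => h _ ⟨s, rfl⟩

lemma tendsto_constCLM_mul {f : ℕ → B} (hn : ∀ n, ‖f n‖ ≤ 1)
    (hf : ∀ b, Filter.Tendsto (fun n => f n * b) Filter.atTop (nhds b)) (c : C(unitInterval, B)) :
    Filter.Tendsto (fun n => constCLM B (f n) * c) Filter.atTop (nhds c) := by
  rw [Metric.tendsto_nhds]
  intro ε hε
  filter_upwards [eventually_forall_norm_sub_le (f := fun n c => f n * c)
    (fun n => contraction_mul (hn n)) hf (isCompact_range c.continuous).totallyBounded
    (half_pos hε)] with n h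
  rw [dist_eq_norm]
  exact (norm_constCLM_mul_sub_le (half_pos hε).le h).trans_lt (half_lt_self hε)

/-- The averages are taken in `B` and then viewed as constant functions. Smallness of the defect in
the norm of `B[0,1]` is then uniform over the interval, and one average serves all `X i` and all of
`K` at once. -/
lemma exists_convexHull_defect_le [IsTopologicalGroup G] {ι : Type*} [Finite ι]
    (X : ι → CocycleRep α β.cyl) {f : ℕ → B} (hp : ∀ n, IsPosContr (f n : 𝓜(ℂ, B)))
    (hf : ∀ b, Filter.Tendsto (fun n => f n * b) Filter.atTop (nhds b))
    {K : Set (A ⊕ G)} (hK : IsCompact K) {ε : ℝ} (hε : 0 < ε) (N : ℕ) :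
    ∃ e ∈ convexHull ℝ (f '' Set.Ici N), ∀ i, ∀ τ ∈ K, ‖(X i).defect τ (constCLM B e)‖ ≤ ε := by
  obtain ⟨M, hM⟩ := hK.bddAbove_image (continuous_valBound (A := A) (G := G)).continuousOn
  have hn (n : ℕ) : ‖constCLM B (f n)‖ ≤ 1 := (norm_constCLM _).trans (hp n).coe_norm_le
  have hs (n : ℕ) : star (constCLM B (f n)) = constCLM B (f n) :=
    ContinuousMap.ext fun _ => (hp n).coe_star_eq
  obtain ⟨e, he, h⟩ := exists_convexHull_norm_le (Λ := ι × (A ⊕ G)) (K := Set.univ ×ˢ K)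
    (fun l => (((X l.1).defect l.2).comp (constCLM B).toLinearMap).restrictScalars ℝ) f
    (M := 2 * M)
    (fun l hl n => ((X l.1).norm_defect_le l.2 (hn n)).trans (by
      have := hM ⟨l.2, hl.2, rfl⟩
      linarith))
    (fun j ε hε => by
      have h1 : ∀ᶠ n in Filter.atTop, ∀ i, ∀ τ ∈ K,
          ‖star ((X i).defect τ (constCLM B (f n))) * (X i).defect τ (constCLM B (f j))‖ ≤ ε :=
        Filter.eventually_all.mpr fun i => eventually_norm_star_defect_mul_le (X i) hs hn
          (tendsto_constCLM_mul (fun n => (hp n).coe_norm_le) hf) hK _ hε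
      filter_upwards [h1] with n h1 l hl
      exact h1 l.1 l.2 hl.2) hε N
  exact ⟨e, he, fun i τ hτ => h (i, τ) ⟨trivial, hτ⟩⟩

end Quasicentral

/-! ### An approximate unit adapted to a homotopy -/

section Adapted

/-- Given properties `P j` that hold eventually, there is a slowly growing `φ` such that
`P (φ k) k` holds eventually. -/
lemma exists_tendsto_eventually (P : ℕ → ℕ → Prop) (h : ∀ j, ∀ᶠ k in Filter.atTop, P j k) :
    ∃ φ : ℕ → ℕ, Filter.Tendsto φ Filter.atTop Filter.atTop ∧
      ∀ᶠ k in Filter.atTop, P (φ k) k := by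
  classical
  have h' (j : ℕ) : ∀ᶠ k in Filter.atTop, ∀ k' ≥ k, P j k' := by
    obtain ⟨N, hN⟩ := Filter.eventually_atTop.mp (h j)
    filter_upwards [Filter.eventually_ge_atTop N] with k hk k' hk'
    exact hN k' (hk.trans hk')
  refine ⟨fun k => Nat.findGreatest (fun j => ∀ k' ≥ k, P j k') k, ?_, ?_⟩
  · refine Filter.tendsto_atTop.mpr fun j => ?_
    filter_upwards [h' j, Filter.eventually_ge_atTop j] with k h1 h2
    exact Nat.le_findGreatest h2 h1
  · filter_upwards [h' 0] with k hk
    exact Nat.findGreatest_spec (P := fun j => ∀ k' ≥ k, P j k') (Nat.zero_le k) hk k le_rfl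

variable {G : Type*} [Group G] [TopologicalSpace G]
variable {A : Type*} [NonUnitalCStarAlgebra A] {B : Type*} [NonUnitalCStarAlgebra B]
variable {α : CStarAction G A} {β : CStarAction G B}

/-- The element `e` almost commutes with the values at `τ` of `X`, and the products of `e` with
these values vary slowly. -/
structure CocycleRep.AlmostCentral (X : CocycleRep α β.cyl) (e : B) (δ ε : ℝ) (τ : A ⊕ G) :
    Prop where
  defect_le : ‖X.defect τ (constCLM B e)‖ ≤ ε
  dist_le : ∀ s s' : unitInterval, dist s s' ≤ δ →
    ‖(X.val τ).snd (constCLM B e) s - (X.val τ).snd (constCLM B e) s'‖ ≤ ε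

lemma CocycleRep.AlmostCentral.mono {X : CocycleRep α β.cyl} {e : B} {δ ε ε' : ℝ} {τ : A ⊕ G}
    (h : X.AlmostCentral e δ ε τ) (hε : ε ≤ ε') : X.AlmostCentral e δ ε' τ :=
  ⟨h.defect_le.trans hε, fun s s' hs => (h.dist_le s s' hs).trans hε⟩

lemma CocycleRep.val_inl_add {C : Type*} [NonUnitalCStarAlgebra C] {γ : CStarAction G C}
    (x : CocycleRep α γ) (a b : A) : x.val (.inl (a + b)) = x.val (.inl a) + x.val (.inl b) :=
  map_add x.hom a b

/-- Passing from a dense subset of `A` to all of `A`. The defect grows by at most `2 * ε`, and so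
does the variation, since both end points contribute `ε`. -/
lemma CocycleRep.AlmostCentral.of_norm_sub_le {X : CocycleRep α β.cyl} {e : B} {δ ε : ℝ} {a a' : A}
    (h : X.AlmostCentral e δ ε (.inl a)) (he : ‖e‖ ≤ 1) (ha : ‖a' - a‖ ≤ ε) :
    X.AlmostCentral e δ (3 * ε) (.inl a') := by
  have hc : ‖constCLM B e‖ ≤ 1 := (norm_constCLM e).trans he
  have e0 : X.val (.inl a') = X.val (.inl a) + X.val (.inl (a' - a)) := by
    rw [← X.val_inl_add, add_sub_cancel]
  have hv : ‖X.val (.inl (a' - a))‖ ≤ ε := (X.norm_val_le_valBound _).trans ha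
  constructor
  · have e1 : X.defect (.inl a') (constCLM B e)
        = X.defect (.inl a) (constCLM B e) + X.defect (.inl (a' - a)) (constCLM B e) := by
      simp only [X.defect_apply, e0, DoubleCentralizer.add_fst, DoubleCentralizer.add_snd,
        _root_.add_apply]
      change _ = (_ - (X.val (.inl a)).fst (constCLM B e))
        + (_ - (X.val (.inl (a' - a))).fst (constCLM B e))
      change _ - ((X.val (.inl a)).fst (constCLM B e)
        + (X.val (.inl (a' - a))).fst (constCLM B e)) = _
      abel
    rw [e1]
    refine (norm_add_le _ _).trans ?_
    have h1 := X.norm_defect_le (.inl (a' - a)) hc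
    have h2 : valBound A G (.inl (a' - a)) ≤ ε := ha
    linarith [h.defect_le]
  · intro s s' hs
    set w := (X.val (.inl (a' - a))).snd (constCLM B e) with hw
    have hw' : ‖w‖ ≤ ε := by
      refine (norm_snd_le _ _).trans ?_
      nlinarith [norm_nonneg (X.val (.inl (a' - a)))]
    have e1 : (X.val (.inl a')).snd (constCLM B e)
        = (X.val (.inl a)).snd (constCLM B e) + w := by
      rw [e0, DoubleCentralizer.add_snd, _root_.add_apply]
    rw [e1, ContinuousMap.add_apply, ContinuousMap.add_apply, add_sub_add_comm]
    have h1 := h.dist_le s s' hs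
    have h2 := (norm_sub_le (w s) (w s')).trans
      (add_le_add (w.norm_coe_le_norm s) (w.norm_coe_le_norm s'))
    exact (norm_add_le _ _).trans (by linarith)

/-- A compact set of continuous functions is uniformly equicontinuous, by uniform continuity of
evaluation on its product with the interval. -/
lemma eventually_norm_sub_le_of_isCompact {S : Set C(unitInterval, B)} (hS : IsCompact S)
    {δ : ℕ → ℝ} (hδ : Filter.Tendsto δ Filter.atTop (nhds 0)) {ε : ℝ} (hε : 0 < ε) :
    ∀ᶠ k in Filter.atTop, ∀ c ∈ S, ∀ s s' : unitInterval, dist s s' ≤ δ k → ‖c s - c s'‖ ≤ ε := by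
  have h1 : UniformContinuousOn (fun p : C(unitInterval, B) × unitInterval => p.1 p.2)
      (S ×ˢ Set.univ) :=
    (hS.prod isCompact_univ).uniformContinuousOn_of_continuous
      (ContinuousEval.continuous_eval).continuousOn
  obtain ⟨r, hr, h2⟩ := Metric.uniformContinuousOn_iff.mp h1 ε hε
  filter_upwards [hδ.eventually (gt_mem_nhds hr)] with k hk c hc s s' hs
  rw [← dist_eq_norm]
  refine (h2 (c, s) ⟨hc, trivial⟩ (c, s') ⟨hc, trivial⟩ ?_).le
  rw [Prod.dist_eq, dist_self]
  exact max_lt hr (hs.trans_lt hk)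

/-- The displacements `δ` are prescribed, whereas the variation of `e` times the values of `X` over
a distance `δ k` depends on `e`. The remedy is to choose the quasicentral sequence first and then
run through it so slowly that `δ k` is already small for the current element. -/
lemma exists_adapted_sequence [IsTopologicalGroup G] [SigmaCompactSpace G]
    [TopologicalSpace.SeparableSpace A] (hB : IsSigmaUnital B) {ι : Type*} [Finite ι]
    (X : ι → CocycleRep α β.cyl) {δ : ℕ → ℝ} (hδ : Filter.Tendsto δ Filter.atTop (nhds 0)) :
    ∃ e : ℕ → B, e 0 = 0 ∧ (∀ k, IsPosContr (e k : 𝓜(ℂ, B))) ∧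
      (∀ b, Filter.Tendsto (fun k => e k * b) Filter.atTop (nhds b)) ∧
      ∀ i τ, ∀ ε > 0, ∀ᶠ k in Filter.atTop, (X i).AlmostCentral (e k) (δ k) ε τ := by
  obtain ⟨f, hp, hf⟩ := hB.exists_isPosContr
  -- The sets `K j` exhaust `G` and a dense sequence in `A`; this is where separability and
  -- `σ`-compactness enter.
  let K (j : ℕ) : Set (A ⊕ G) :=
    Sum.inl '' (TopologicalSpace.denseSeq A '' Set.Iic j) ∪ Sum.inr '' compactCovering G j
  have hK (j : ℕ) : IsCompact (K j) :=
    (((Set.finite_Iic j).image _).image _).isCompact.union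
      ((isCompact_compactCovering G j).image continuous_inr)
  have hr (j : ℕ) : (0 : ℝ) < 1 / (j + 1) := by positivity
  choose e he h using fun j => exists_convexHull_defect_le X hp hf (hK j) (hr j) j
  have hpe (j : ℕ) : IsPosContr (e j : 𝓜(ℂ, B)) := by
    have hconv : Convex ℝ {b : B | IsPosContr (b : 𝓜(ℂ, B))} := by
      intro b hb c hc r s hr hs hrs
      have h1 := convex_isPosContr hb hc hr hs hrs
      rw [Set.mem_ofPred_eq] at h1 ⊢
      rwa [coe_add, ← Complex.coe_smul r b, ← Complex.coe_smul s c, coe_smul, coe_smul,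
        Complex.coe_smul, Complex.coe_smul]
    refine convexHull_min ?_ hconv (he j)
    rintro _ ⟨n, -, rfl⟩
    exact hp n
  have hfe (b : B) : Filter.Tendsto (fun j => e j * b) Filter.atTop (nhds b) := by
    rw [Metric.tendsto_atTop]
    intro ε hε
    obtain ⟨N, hN⟩ := Metric.tendsto_atTop.mp (hf b) ε hε
    refine ⟨N, fun j hj => ?_⟩
    have hconv : Convex ℝ {c : B | c * b ∈ Metric.ball b ε} :=
      (convex_ball b ε).linear_preimage (LinearMap.mulRight ℝ b)
    refine convexHull_min ?_ hconv (he j)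
    rintro _ ⟨n, hn, rfl⟩
    exact hN n (hj.trans hn)
  obtain ⟨φ, hφ, hP⟩ := exists_tendsto_eventually (fun j k => ∀ i, ∀ τ ∈ K j,
      (X i).AlmostCentral (e j) (δ k) (1 / (j + 1)) τ) fun j => by
    have h1 : ∀ᶠ k in Filter.atTop, ∀ i, ∀ c ∈
        (fun τ => ((X i).val τ).snd (constCLM B (e j))) '' K j, ∀ s s' : unitInterval,
        dist s s' ≤ δ k → ‖c s - c s'‖ ≤ 1 / (j + 1) :=
      Filter.eventually_all.mpr fun i => eventually_norm_sub_le_of_isCompact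
        ((hK j).image ((X i).continuous_val_snd _)) hδ (hr j)
    filter_upwards [h1] with k h1 i τ hτ
    exact ⟨h j i τ hτ, h1 i _ ⟨τ, hτ, rfl⟩⟩
  have hlim : Filter.Tendsto (fun k => (1 : ℝ) / (φ k + 1)) Filter.atTop (nhds 0) :=
    tendsto_one_div_add_atTop_nhds_zero_nat.comp hφ
  -- The value `0` at `k = 0` is imposed by hand and affects no limit. It makes the rotation at
  -- level `0` the identity.
  refine ⟨fun k => if k = 0 then 0 else e (φ k), if_pos rfl, fun k => ?_, fun b => ?_,
    fun i τ ε hε => ?_⟩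
  · dsimp only
    split_ifs
    · rw [coe_zero]
      exact IsPosContr.zero
    · exact hpe _
  · refine ((hfe b).comp hφ).congr' ?_
    filter_upwards [Filter.eventually_gt_atTop 0] with k hk
    rw [if_neg hk.ne']
    rfl
  · rcases τ with a | g
    · obtain ⟨n, hn⟩ := (TopologicalSpace.denseRange_denseSeq A).exists_dist_lt a
        (show 0 < ε / 3 by positivity)
      filter_upwards [hP, hlim.eventually (gt_mem_nhds (show 0 < ε / 3 by positivity)),
        Filter.eventually_gt_atTop 0, hφ.eventually_ge_atTop n] with k h1 h2 h3 h4
      rw [if_neg h3.ne']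
      have h5 := ((h1 i (.inl (TopologicalSpace.denseSeq A n))
        (.inl ⟨_, ⟨n, h4, rfl⟩, rfl⟩)).mono h2.le).of_norm_sub_le (hpe _).coe_norm_le
        (a' := a) (by rw [← dist_eq_norm]; exact hn.le)
      exact h5.mono (by linarith)
    · obtain ⟨n, hn⟩ := Set.mem_iUnion.mp
        ((iUnion_compactCovering G).symm ▸ Set.mem_univ g : g ∈ ⋃ n, compactCovering G n)
      filter_upwards [hP, hlim.eventually (gt_mem_nhds hε), Filter.eventually_gt_atTop 0,
        hφ.eventually_ge_atTop n] with k h1 h2 h3 h4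
      rw [if_neg h3.ne']
      exact (h1 i _ (.inr ⟨g, compactCovering_subset G h4 hn, rfl⟩)).mono h2.le

end Adapted

/-! ### Square roots of positive contractions -/

section SquareRoot

variable {C : Type*} [CStarAlgebra C] {m n : C}

/-- The positive square root. -/
def psqrt (m : C) : C := cfc Real.sqrt m

lemma IsPosContr.spectrum_subset (h : IsPosContr m) : spectrum ℝ m ⊆ Set.Icc 0 1 := by
  let _ := CStarAlgebra.spectralOrder C
  let _ := CStarAlgebra.spectralOrderedRing C
  have hs : IsSelfAdjoint m := h.star_eq
  rw [isPosContr_iff] at h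
  intro r hr
  refine ⟨spectrum_nonneg_of_nonneg h.1 hr, ?_⟩
  have h1 : m ≤ algebraMap ℝ C 1 := by simpa using h.2
  exact (le_algebraMap_iff_spectrum_le hs).mp h1 r hr

lemma psqrt_mul_self (h : IsPosContr m) : psqrt m * psqrt m = m := by
  have hs : IsSelfAdjoint m := h.star_eq
  rw [psqrt, ← cfc_mul Real.sqrt Real.sqrt m]
  nth_rewrite 2 [← cfc_id' ℝ m]
  exact cfc_congr fun r hr => Real.mul_self_sqrt (h.spectrum_subset hr).1

lemma isPosContr_psqrt (h : IsPosContr m) : IsPosContr (psqrt m) := by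
  let _ := CStarAlgebra.spectralOrder C
  let _ := CStarAlgebra.spectralOrderedRing C
  have hs : IsSelfAdjoint m := h.star_eq
  rw [isPosContr_iff]
  refine ⟨cfc_nonneg fun r _ => Real.sqrt_nonneg r, cfc_le_one Real.sqrt m fun r hr => ?_⟩
  exact Real.sqrt_le_one.mpr (h.spectrum_subset hr).2

lemma psqrt_eq_of_mul_self (hn : IsPosContr n) (h : n * n = m) (hm : IsPosContr m) :
    psqrt m = n := by
  let _ := CStarAlgebra.spectralOrder C
  let _ := CStarAlgebra.spectralOrderedRing C
  rw [← CFC.sqrt_unique h (isPosContr_iff.mp hn).1]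
  exact (CFC.sqrt_unique (psqrt_mul_self hm)
    (isPosContr_iff.mp (isPosContr_psqrt hm)).1).symm

lemma psqrt_zero : psqrt (0 : C) = 0 :=
  psqrt_eq_of_mul_self IsPosContr.zero (by simp) IsPosContr.zero

lemma psqrt_one : psqrt (1 : C) = 1 :=
  psqrt_eq_of_mul_self IsPosContr.one (by simp) IsPosContr.one

lemma Commute.psqrt (h : IsPosContr m) (hmn : Commute m n) : Commute (psqrt m) n :=
  hmn.cfc (by rwa [h.star_eq]) _

lemma continuous_psqrt {X : Type*} [TopologicalSpace X] {f : X → C} (hf : Continuous f)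
    (h : ∀ x, IsPosContr (f x)) : Continuous fun x => psqrt (f x) :=
  Continuous.cfc (s := fun _ => Set.Icc 0 1) Real.sqrt hf (fun _ => isCompact_Icc)
    (fun _ => Filter.Eventually.of_forall fun x => (h x).spectrum_subset)
    (fun _ => Real.continuous_sqrt.continuousOn) (fun x => (h x).star_eq)

end SquareRoot

/-! ### Rotations -/

section Rotation

variable {G : Type*} [Group G] [TopologicalSpace G]
variable {A : Type*} [NonUnitalCStarAlgebra A] {B : Type*} [NonUnitalCStarAlgebra B]
variable {α : CStarAction G A} {β : CStarAction G B}

/-- The endomorphisms of `x` modulo `B`. -/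
def endAlgebra (x : CocycleRep α β) : StarSubalgebra ℝ 𝓜(ℂ, B) where
  carrier := {m | IsHom x x m}
  mul_mem' hm hn := IsHom.mul hm hn
  one_mem' := IsExact.one.isHom
  add_mem' hm hn := IsHom.add hm hn
  zero_mem' := (IsExact.zero x x).isHom
  algebraMap_mem' r := by
    rw [Algebra.algebraMap_eq_smul_one, ← Complex.coe_smul]
    exact IsExact.one.isHom.smul _
  star_mem' hm := IsHom.star hm

/-- The endomorphisms modulo `B` form a closed *-subalgebra, so they are stable under continuous
functional calculus. -/
lemma IsHom.psqrt {x : CocycleRep α β} {m : 𝓜(ℂ, B)} (h : IsHom x x m) : IsHom x x (psqrt m) :=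
  StarAlgebra.elemental.le_of_mem (S := endAlgebra x) (IsHom.isClosed x x) h
    (cfc_mem_elemental Real.sqrt m)

/-- With `s = √m`, the square `(s d)* (s d) = d* m d` lies in `B`, hence so does `s d`. Conditions
on `H` thus pass to the entries `√H` and `√(1 - H)` of a rotation. -/
lemma InIdeal.psqrt_mul (hB : IsSigmaUnital B) {m d : 𝓜(ℂ, B)} (hm : IsPosContr m)
    (h : InIdeal (m * d)) : InIdeal (CuntzThomsen.psqrt m * d) := by
  refine InIdeal.of_star_mul_self hB ?_
  rw [star_mul, (isPosContr_psqrt hm).star_eq, mul_assoc, ← mul_assoc (CuntzThomsen.psqrt m),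
    psqrt_mul_self hm]
  exact h.mul_left _

variable (t : CuntzIsometries β)

/-- The rotation matrix with cosine `√(1 - H)` and sine `√H`, followed by the unitary `U` off the
diagonal. -/
def rotation (H U : 𝓜(ℂ, B)) : 𝓜(ℂ, B) :=
  t.mat (psqrt (1 - H)) (psqrt H * star U) (-(U * psqrt H)) (psqrt (1 - H))

lemma continuous_rotation {X : Type*} [TopologicalSpace X] {H U : X → 𝓜(ℂ, B)}
    (hH : Continuous H) (hU : Continuous U) (h : ∀ s, IsPosContr (H s)) :
    Continuous fun s => rotation t (H s) (U s) := by
  have h1 := continuous_psqrt hH h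
  have h2 := continuous_psqrt (continuous_const.sub hH) fun s => (h s).compl
  exact t.continuous_mat h2 (h1.mul hU.star) (hU.mul h1).neg h2

lemma rotation_mem_unitary {H U : 𝓜(ℂ, B)} (hH : IsPosContr H) (hU : U ∈ unitary 𝓜(ℂ, B))
    (hc : Commute H U) : rotation t H U ∈ unitary 𝓜(ℂ, B) := by
  set c := psqrt (1 - H) with hcd
  set s := psqrt H with hsd
  have e1 : c * c = 1 - s * s := by
    rw [psqrt_mul_self hH, psqrt_mul_self hH.compl]
  have hcU : c * U = U * c := Commute.psqrt hH.compl ((Commute.one_left U).sub_left hc)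
  have hsU : s * U = U * s := Commute.psqrt hH hc
  have hcs : c * s = s * c := Commute.psqrt hH.compl
    ((Commute.one_left s).sub_left (Commute.psqrt hH (Commute.refl H)).symm)
  have hc' : star c = c := (isPosContr_psqrt hH.compl).star_eq
  have hs' : star s = s := (isPosContr_psqrt hH).star_eq
  have hcU' : c * star U = star U * c := by
    have := congrArg star hcU
    simpa [hc'] using this.symm
  have hsU' : s * star U = star U * s := by
    have := congrArg star hsU
    simpa [hs'] using this.symm
  have hUU (z : 𝓜(ℂ, B)) : star U * (U * z) = z := by rw [← mul_assoc, hU.1, one_mul]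
  have hUU' (z : 𝓜(ℂ, B)) : U * (star U * z) = z := by rw [← mul_assoc, hU.2, one_mul]
  rw [Unitary.mem_iff]
  simp only [rotation, ← hcd, ← hsd, t.mat_star, t.mat_mul, star_neg, star_mul, star_star, hc', hs']
  constructor
  · rw [← t.mat_one]
    congr 1
    · rw [neg_mul_neg, mul_assoc, hUU, e1, sub_add_cancel]
    · rw [← mul_assoc, hcs, neg_mul, mul_assoc s, mul_assoc s, hcU', add_neg_cancel]
    · rw [mul_assoc, ← hcs, ← mul_assoc, ← hcU, mul_neg, ← mul_assoc, add_neg_cancel]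
    · rw [mul_assoc, ← mul_assoc s, mul_assoc s, hsU', ← mul_assoc s, hsU', mul_assoc, hUU', e1,
        add_sub_cancel]
  · rw [← t.mat_one]
    congr 1
    · rw [mul_assoc, hUU, e1, sub_add_cancel]
    · rw [mul_neg, ← mul_assoc, hcs, mul_assoc s, mul_assoc s, hcU', neg_add_cancel]
    · rw [neg_mul, ← mul_assoc c, hcU, mul_assoc, mul_assoc, hcs, neg_add_cancel]
    · rw [neg_mul_neg, mul_assoc, ← mul_assoc s, mul_assoc s, hsU', ← mul_assoc s, hsU', mul_assoc,
        hUU', e1, add_sub_cancel]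

variable {x₁ x₂ y₁ y₂ : CocycleRep α β} {H U : 𝓜(ℂ, B)}

/-- The conditions under which a rotation matrix intertwines `x₁ ⊕ x₂` and `y₁ ⊕ y₂` modulo `B`. -/
structure Rotates (x₁ x₂ y₁ y₂ : CocycleRep α β) (H U : 𝓜(ℂ, B)) : Prop where
  isHom_tgt₁ : IsHom y₁ y₁ H
  isHom_tgt₂ : IsHom y₂ y₂ H
  isHom_src₂ : IsHom x₂ x₂ H
  diag₁ : ∀ τ, InIdeal ((1 - H) * (x₁.val τ - y₁.val τ))
  diag₂ : ∀ τ, InIdeal ((1 - H) * (x₂.val τ - y₂.val τ))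
  cross₁ : ∀ τ, InIdeal (H * (U * x₁.val τ - y₂.val τ * U))
  cross₂ : ∀ τ, InIdeal (H * (U * y₁.val τ - x₂.val τ * U))

lemma isHom_psqrt_of_diag (hB : IsSigmaUnital B) {x y : CocycleRep α β} {H : 𝓜(ℂ, B)}
    (hH : IsPosContr H) (h : IsHom y y H)
    (hd : ∀ τ, InIdeal (H * (x.val τ - y.val τ))) : IsHom x y (psqrt H) := fun τ => by
  have e : psqrt H * x.val τ - y.val τ * twist A β τ (psqrt H)
      = psqrt H * (x.val τ - y.val τ)
        + (psqrt H * y.val τ - y.val τ * twist A β τ (psqrt H)) := by noncomm_ring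
  rw [e]
  exact ((hd τ).psqrt_mul hB hH).add (h.psqrt τ)

lemma isHom_mul_psqrt_of_cross (hB : IsSigmaUnital B) {x y : CocycleRep α β} {H U : 𝓜(ℂ, B)}
    (hH : IsPosContr H) (hU : IsFixed β U) (hc : Commute H U) (h : IsHom y y H)
    (hd : ∀ τ, InIdeal (H * (U * x.val τ - y.val τ * U))) : IsHom x y (U * psqrt H) := fun τ => by
  have hsU : psqrt H * U = U * psqrt H := Commute.psqrt hH hc
  have hsU' : twist A β τ (psqrt H) * U = U * twist A β τ (psqrt H) := by
    have := congrArg (twist A β τ) hsU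
    rwa [map_mul, map_mul, hU.twist_eq] at this
  have e : U * psqrt H * x.val τ - y.val τ * twist A β τ (U * psqrt H)
      = psqrt H * (U * x.val τ - y.val τ * U)
        + (psqrt H * y.val τ - y.val τ * twist A β τ (psqrt H)) * U := by
    rw [map_mul, hU.twist_eq, ← hsU, ← hsU']
    noncomm_ring
  rw [e]
  exact ((hd τ).psqrt_mul hB hH).add ((h.psqrt τ).mul_right U)

/-- Each entry is an intertwiner of the corresponding summands modulo `B`. The diagonal ones work
because `√(1 - H)` absorbs the differences `x - y`, the others because `√H` absorbs the failure of
`U` to intertwine across the summands. The upper right entry is the adjoint of an intertwiner from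
`y₁` to `x₂`. -/
lemma Rotates.rotation_mem (h : Rotates x₁ x₂ y₁ y₂ H U) (hB : IsSigmaUnital B)
    (hH : IsPosContr H) (hU : IsFixed β U) (hU' : U ∈ unitary 𝓜(ℂ, B)) (hc : Commute H U) :
    rotation t H U ∈ unitaryHom (x₁.cuntzSum t x₂) (y₁.cuntzSum t y₂) := by
  refine ⟨rotation_mem_unitary t hH hU' hc, IsHom.mat t ?_ ?_ ?_ ?_⟩
  · exact isHom_psqrt_of_diag hB hH.compl (IsExact.one.isHom.sub h.isHom_tgt₁) h.diag₁
  · have h1 := (isHom_mul_psqrt_of_cross hB hH hU hc h.isHom_src₂ h.cross₂).star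
    rwa [star_mul, (isPosContr_psqrt hH).star_eq] at h1
  · exact (isHom_mul_psqrt_of_cross hB hH hU hc h.isHom_tgt₂ h.cross₁).neg
  · exact isHom_psqrt_of_diag hB hH.compl (IsExact.one.isHom.sub h.isHom_tgt₂) h.diag₂

/-- All conditions are affine in `H`, although the rotation itself is not. A homotopy of rotations
is therefore a segment of admissible `H`. -/
lemma Rotates.convex {H H' : 𝓜(ℂ, B)} (h : Rotates x₁ x₂ y₁ y₂ H U)
    (h' : Rotates x₁ x₂ y₁ y₂ H' U) {r s : ℂ} (hrs : r + s = 1) :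
    Rotates x₁ x₂ y₁ y₂ (r • H + s • H') U := by
  have e (d : 𝓜(ℂ, B)) : (1 - (r • H + s • H')) * d
      = r • ((1 - H) * d) + s • ((1 - H') * d) := by
    have : (1 : 𝓜(ℂ, B)) = r • 1 + s • 1 := by rw [← add_smul, hrs, one_smul]
    nth_rewrite 1 [this]
    simp only [← smul_mul_assoc, ← add_mul, smul_sub]
    congr 1
    abel
  have e' (d : 𝓜(ℂ, B)) : (r • H + s • H') * d = r • (H * d) + s • (H' * d) := by
    simp only [add_mul, smul_mul_assoc]
  constructor
  · exact (h.isHom_tgt₁.smul r).add (h'.isHom_tgt₁.smul s)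
  · exact (h.isHom_tgt₂.smul r).add (h'.isHom_tgt₂.smul s)
  · exact (h.isHom_src₂.smul r).add (h'.isHom_src₂.smul s)
  · exact fun τ => by rw [e]; exact ((h.diag₁ τ).smul r).add ((h'.diag₁ τ).smul s)
  · exact fun τ => by rw [e]; exact ((h.diag₂ τ).smul r).add ((h'.diag₂ τ).smul s)
  · exact fun τ => by rw [e']; exact ((h.cross₁ τ).smul r).add ((h'.cross₁ τ).smul s)
  · exact fun τ => by rw [e']; exact ((h.cross₂ τ).smul r).add ((h'.cross₂ τ).smul s)

lemma Rotates.combination {U' : 𝓜(ℂ, B)} (h : Rotates x₁ x₂ y₁ y₂ H U)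
    (h' : Rotates x₁ x₂ y₁ y₂ H U') (r s : ℂ) : Rotates x₁ x₂ y₁ y₂ H (r • U + s • U') := by
  have e (a b : 𝓜(ℂ, B)) : H * ((r • U + s • U') * a - b * (r • U + s • U'))
      = r • (H * (U * a - b * U)) + s • (H * (U' * a - b * U')) := by
    simp only [mul_sub, mul_add, add_mul, smul_mul_assoc, mul_smul_comm, smul_sub]
    abel
  refine ⟨h.isHom_tgt₁, h.isHom_tgt₂, h.isHom_src₂, h.diag₁, h.diag₂, fun τ => ?_, fun τ => ?_⟩
  · rw [e]; exact ((h.cross₁ τ).smul r).add ((h'.cross₁ τ).smul s)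
  · rw [e]; exact ((h.cross₂ τ).smul r).add ((h'.cross₂ τ).smul s)

/-- Rotations by two angles are homotopic. -/
lemma Rotates.joinedIn {H' : 𝓜(ℂ, B)} (h : Rotates x₁ x₂ y₁ y₂ H 1)
    (h' : Rotates x₁ x₂ y₁ y₂ H' 1) (hB : IsSigmaUnital B) (hH : IsPosContr H)
    (hH' : IsPosContr H') :
    JoinedIn (unitaryHom (x₁.cuntzSum t x₂) (y₁.cuntzSum t y₂)) (rotation t H 1)
      (rotation t H' 1) := by
  have hp (s : unitInterval) : IsPosContr (((1 - s : ℝ) : ℂ) • H + ((s : ℝ) : ℂ) • H') := by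
    rw [Complex.coe_smul, Complex.coe_smul]
    exact convex_isPosContr hH hH' (sub_nonneg.mpr s.2.2) s.2.1 (by ring)
  refine ⟨⟨⟨fun s => rotation t (((1 - s : ℝ) : ℂ) • H + ((s : ℝ) : ℂ) • H') 1,
    continuous_rotation t ?_ continuous_const hp⟩, ?_, ?_⟩, fun s => ?_⟩
  · exact ((Complex.continuous_ofReal.comp (continuous_const.sub continuous_subtype_val)).smul
      continuous_const).add ((Complex.continuous_ofReal.comp continuous_subtype_val).smul
      continuous_const)
  · simp
  · simp
  · exact (h.convex h' (by push_cast; ring)).rotation_mem t hB (hp s) IsFixed.one (one_mem _)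
      (Commute.one_right _)

/-- Rotations with and without a symmetry `P` off the diagonal are homotopic. -/
lemma Rotates.joinedIn_symmetry {P : 𝓜(ℂ, B)} (h : Rotates x₁ x₂ y₁ y₂ H 1)
    (h' : Rotates x₁ x₂ y₁ y₂ H P) (hB : IsSigmaUnital B) (hH : IsPosContr H)
    (hP : IsFixed β P) (hPs : star P = P) (hPP : P * P = 1) (hc : Commute H P) :
    JoinedIn (unitaryHom (x₁.cuntzSum t x₂) (y₁.cuntzSum t y₂)) (rotation t H 1)
      (rotation t H P) := by
  -- With `z` running along the half circle from `1` to `-1`, the unitary `V = (1 + P) / 2 + z (1 -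
  -- P) / 2` runs from `1` to `P` inside the span of `1` and `P`. It remains admissible because the
  -- cross conditions are linear in `U`.
  let z (s : unitInterval) : ℂ := Complex.exp ((Real.pi * s : ℝ) * Complex.I)
  let V (s : unitInterval) : 𝓜(ℂ, B) := ((1 + z s) / 2) • 1 + ((1 - z s) / 2) • P
  have hz : Continuous z := by
    simp only [z]
    fun_prop
  have hV : Continuous V := by
    simp only [V]
    fun_prop
  have hzz (s : unitInterval) : z s * star (z s) = 1 := by
    have h1 : ‖z s‖ = 1 := Complex.norm_exp_ofReal_mul_I _
    have h2 := Complex.mul_conj' (z s)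
    rw [h1] at h2
    simpa using h2
  have hVs (s : unitInterval) : star (V s)
      = ((1 + star (z s)) / 2) • 1 + ((1 - star (z s)) / 2) • P := by
    simp only [V, star_add, star_smul, star_one, hPs, star_div₀, star_sub, star_ofNat]
  have hmul (a b c d : ℂ) : (a • (1 : 𝓜(ℂ, B)) + b • P) * (c • 1 + d • P)
      = (a * c + b * d) • 1 + (a * d + b * c) • P := by
    simp only [add_mul, mul_add, smul_mul_smul_comm, hPP, one_mul, mul_one, add_smul]
    abel
  have hVu (s : unitInterval) : V s ∈ unitary 𝓜(ℂ, B) := by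
    rw [Unitary.mem_iff, hVs]
    have e1 : (1 + star (z s)) / 2 * ((1 + z s) / 2) + (1 - star (z s)) / 2 * ((1 - z s) / 2)
        = 1 := by linear_combination (1 / 2) * hzz s
    have e2 : (1 + star (z s)) / 2 * ((1 - z s) / 2) + (1 - star (z s)) / 2 * ((1 + z s) / 2)
        = 0 := by linear_combination (-1 / 2) * hzz s
    have e3 : (1 + z s) / 2 * ((1 + star (z s)) / 2) + (1 - z s) / 2 * ((1 - star (z s)) / 2)
        = 1 := by linear_combination (1 / 2) * hzz s
    have e4 : (1 + z s) / 2 * ((1 - star (z s)) / 2) + (1 - z s) / 2 * ((1 + star (z s)) / 2)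
        = 0 := by linear_combination (-1 / 2) * hzz s
    simp only [V, hmul, e1, e2, e3, e4]
    simp
  have hVf (s : unitInterval) : IsFixed β (V s) := (IsFixed.one.smul _).add (hP.smul _)
  have hVc (s : unitInterval) : Commute H (V s) :=
    ((Commute.one_right H).smul_right _).add_right (hc.smul_right _)
  refine ⟨⟨⟨fun s => rotation t H (V s), continuous_rotation t continuous_const hV fun _ => hH⟩,
    ?_, ?_⟩, fun s => (h.combination h' _ _).rotation_mem t hB hH (hVf s) (hVu s) (hVc s)⟩
  · simp [V, z]
  · simp [V, z]

end Rotation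

/-! ### Rotations between direct sums -/

section DirectSum

variable {G : Type*} [Group G] [TopologicalSpace G]
variable {A : Type*} [NonUnitalCStarAlgebra A] {B : Type*} [NonUnitalCStarAlgebra B]
variable {α : CStarAction G A} {β : CStarAction G B}
variable {ι κ : Type*}

namespace IsoFrame

variable {R R' : IsoFrame β ι}

lemma bdd_of_star_mul_self {p h : ι → 𝓜(ℂ, B)} (hp : ∀ i, star (p i) * p i = h i)
    (hh : ∀ i, ‖h i‖ ≤ 1) : Bdd p := bdd_of_le_one fun i => by
  have h1 := hh i
  rw [← hp, CStarRing.norm_star_mul_self] at h1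
  nlinarith [norm_nonneg (p i)]

lemma bdd_of_isPosContr {h : ι → 𝓜(ℂ, B)} (hh : ∀ i, IsPosContr (h i)) : Bdd h :=
  bdd_of_le_one fun i => (hh i).norm_le

lemma isPosContr_op {h : ι → 𝓜(ℂ, B)} (hh : ∀ i, IsPosContr (h i)) : IsPosContr (op R R h) := by
  choose p hp using fun i => (hh i).1
  choose q hq using fun i => (hh i).2
  have bp : Bdd p := bdd_of_star_mul_self hp fun i => (hh i).norm_le
  have bq : Bdd q := bdd_of_star_mul_self hq fun i => (hh i).compl.norm_le
  refine ⟨⟨op R R p, ?_⟩, ⟨op R R q, ?_⟩⟩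
  · rw [op_star bp, op_mul_op bp bp.star]
    simp only [hp]
  · rw [op_star bq, op_mul_op bq bq.star]
    simp only [hq]
    rw [op_sub (Bdd.const 1) (bdd_of_isPosContr hh), op_one]

lemma psqrt_op {h : ι → 𝓜(ℂ, B)} (hh : ∀ i, IsPosContr (h i)) :
    psqrt (op R R h) = op R R fun i => psqrt (h i) := by
  have hs (i) := isPosContr_psqrt (hh i)
  refine psqrt_eq_of_mul_self (isPosContr_op hs) ?_ (isPosContr_op hh)
  rw [op_mul_op (bdd_of_isPosContr hs) (bdd_of_isPosContr hs)]
  simp only [psqrt_mul_self (hh _)]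

lemma psqrt_op_mul_r {h : ι → 𝓜(ℂ, B)} (hh : ∀ i, IsPosContr (h i)) (i : ι) :
    psqrt (op R R h) * R.r i = R.r i * psqrt (h i) := by
  rw [psqrt_op hh, op_mul_r (bdd_of_isPosContr fun i => isPosContr_psqrt (hh i))]

lemma psqrt_one_sub_op_mul_r {h : ι → 𝓜(ℂ, B)} (hh : ∀ i, IsPosContr (h i)) (i : ι) :
    psqrt (1 - op R R h) * R.r i = R.r i * psqrt (1 - h i) := by
  have e : 1 - op R R h = op R R fun i => 1 - h i := by
    rw [op_sub (Bdd.const 1) (bdd_of_isPosContr hh), op_one]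
  rw [e, psqrt_op_mul_r fun i => (hh i).compl]

lemma isExact_r (R : IsoFrame β ι) (x : ι → CocycleRep α β) (i : ι) :
    IsExact (x i) (CocycleRep.directSum R x) (R.r i) := fun τ => by
  rw [CocycleRep.val_directSum, (R.fixed i).twist_eq, op_mul_r (CocycleRep.bdd_val x τ)]

/-- The operator carries one decomposition into the summands `x i` to another, so a representation
is determined by its summands up to exact unitary equivalence. -/
lemma isExact_op_one {x : ι → CocycleRep α β} {z z' : CocycleRep α β}
    (hz : ∀ i, IsExact (x i) z (R.r i)) (hz' : ∀ i, IsExact (x i) z' (R'.r i)) :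
    IsExact z z' (op R R' fun _ => 1) := fun τ => by
  have hb : Bdd fun _ : ι => (1 : 𝓜(ℂ, B)) := Bdd.const 1
  refine R.eq_of_mul_eq fun i => ?_
  have h1 := hz i τ
  have h2 := hz' i τ
  rw [(R.fixed i).twist_eq] at h1
  rw [(R'.fixed i).twist_eq] at h2
  have h3 : (fun i : ι => twist A β τ (1 : 𝓜(ℂ, B))) = fun _ => 1 := by simp
  rw [mul_assoc, ← h1, ← mul_assoc, op_mul_r hb, mul_one, h2, op_twist τ hb, h3, mul_assoc,
    op_mul_r hb, mul_one]

end IsoFrame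

open IsoFrame

/-- The intertwiner `p` is, up to exact equivalence, the direct sum of the rotations with cosines
`c i` and sines `s i`. -/
def ModUnitary.IsRotation (p : ModUnitary α β) (x₁ x₂ y₁ y₂ : ι → CocycleRep α β)
    (c s : ι → 𝓜(ℂ, B)) : Prop :=
  ∃ F F' : IsoFrame β (ι ⊕ ι), (∀ j, IsExact (Sum.elim x₁ x₂ j) p.src (F.r j)) ∧
    (∀ j, IsExact (Sum.elim y₁ y₂ j) p.tgt (F'.r j)) ∧
    (∀ i, p.u * F.r (.inl i) = F'.r (.inl i) * c i - F'.r (.inr i) * s i) ∧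
    ∀ i, p.u * F.r (.inr i) = F'.r (.inl i) * s i + F'.r (.inr i) * c i

namespace ModUnitary.IsRotation

variable {p q : ModUnitary α β} {x₁ x₂ y₁ y₂ : ι → CocycleRep α β} {c s : ι → 𝓜(ℂ, B)}

/-- The unitaries that match the frames of the two sources and of the two targets are exact
intertwiners. Hence the class depends only on the summands and angles, and infinite sums can be
regrouped freely. -/
lemma iso (hp : p.IsRotation x₁ x₂ y₁ y₂ c s) (hq : q.IsRotation x₁ x₂ y₁ y₂ c s) : p.Iso q := by
  obtain ⟨F, F', h1, h2, h3, h4⟩ := hp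
  obtain ⟨E, E', k1, k2, k3, k4⟩ := hq
  have hb : Bdd fun _ : ι ⊕ ι => (1 : 𝓜(ℂ, B)) := Bdd.const 1
  have e (F E : IsoFrame β (ι ⊕ ι)) (j) : op F E (fun _ => 1) * F.r j = E.r j := by
    rw [op_mul_r hb, mul_one]
  refine ⟨op F E fun _ => 1, op F' E' fun _ => 1, op_mem_unitary fun _ => one_mem _,
    op_mem_unitary fun _ => one_mem _, isExact_op_one h1 k1, isExact_op_one h2 k2,
    F.eq_of_mul_eq ?_⟩
  rintro (i | i)
  · rw [mul_assoc, e, k3, mul_assoc, h3, mul_sub, ← mul_assoc, ← mul_assoc, e, e]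
  · rw [mul_assoc, e, k4, mul_assoc, h4, mul_add, ← mul_assoc, ← mul_assoc, e, e]

lemma reindex (hp : p.IsRotation x₁ x₂ y₁ y₂ c s) (e : κ ≃ ι) :
    p.IsRotation (x₁ ∘ e) (x₂ ∘ e) (y₁ ∘ e) (y₂ ∘ e) (c ∘ e) (s ∘ e) := by
  obtain ⟨F, F', h1, h2, h3, h4⟩ := hp
  refine ⟨F.reindex (e.sumCongr e), F'.reindex (e.sumCongr e), ?_, ?_, fun i => h3 (e i),
    fun i => h4 (e i)⟩
  · rintro (i | i)
    · exact h1 (.inl (e i))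
    · exact h1 (.inr (e i))
  · rintro (i | i)
    · exact h2 (.inl (e i))
    · exact h2 (.inr (e i))

lemma add (t : CuntzIsometries β) {x₁' x₂' y₁' y₂' : κ → CocycleRep α β} {c' s' : κ → 𝓜(ℂ, B)}
    (hp : p.IsRotation x₁ x₂ y₁ y₂ c s) (hq : q.IsRotation x₁' x₂' y₁' y₂' c' s') :
    (p.add t q).IsRotation (Sum.elim x₁ x₁') (Sum.elim x₂ x₂') (Sum.elim y₁ y₁')
      (Sum.elim y₂ y₂') (Sum.elim c c') (Sum.elim s s') := by
  obtain ⟨F, F', h1, h2, h3, h4⟩ := hp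
  obtain ⟨E, E', k1, k2, k3, k4⟩ := hq
  have e1 (a b d : 𝓜(ℂ, B)) : t.sum a b * (t.t₁ * d) = t.t₁ * (a * d) := by
    rw [← mul_assoc, t.sum_eq_mat, t.mat_mul_t₁, mul_zero, add_zero, mul_assoc]
  have e2 (a b d : 𝓜(ℂ, B)) : t.sum a b * (t.t₂ * d) = t.t₂ * (b * d) := by
    rw [← mul_assoc, t.sum_eq_mat, t.mat_mul_t₂, mul_zero, zero_add, mul_assoc]
  refine ⟨(IsoFrame.sum t F E).reindex (Equiv.sumSumSumComm ι κ ι κ),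
    (IsoFrame.sum t F' E').reindex (Equiv.sumSumSumComm ι κ ι κ), ?_, ?_, ?_, ?_⟩
  · rintro ((i | i) | (i | i))
    · exact (isExact_t₁ t _ _).mul (h1 (.inl i))
    · exact (isExact_t₂ t _ _).mul (k1 (.inl i))
    · exact (isExact_t₁ t _ _).mul (h1 (.inr i))
    · exact (isExact_t₂ t _ _).mul (k1 (.inr i))
  · rintro ((i | i) | (i | i))
    · exact (isExact_t₁ t _ _).mul (h2 (.inl i))
    · exact (isExact_t₂ t _ _).mul (k2 (.inl i))
    · exact (isExact_t₁ t _ _).mul (h2 (.inr i))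
    · exact (isExact_t₂ t _ _).mul (k2 (.inr i))
  · rintro (i | i)
    · exact (e1 _ _ _).trans (by rw [h3, mul_sub, ← mul_assoc, ← mul_assoc]; rfl)
    · exact (e2 _ _ _).trans (by rw [k3, mul_sub, ← mul_assoc, ← mul_assoc]; rfl)
  · rintro (i | i)
    · exact (e1 _ _ _).trans (by rw [h4, mul_add, ← mul_assoc, ← mul_assoc]; rfl)
    · exact (e2 _ _ _).trans (by rw [k4, mul_add, ← mul_assoc, ← mul_assoc]; rfl)

end ModUnitary.IsRotation

/-- The direct sum of two intertwiners, as a trivial rotation. -/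
lemma ModUnitary.isRotation_add (t : CuntzIsometries β) {p q : ModUnitary α β} (hp : p.u = 1)
    (hq : q.u = 1) : (p.add t q).IsRotation (fun _ : Unit => p.src) (fun _ => q.src)
      (fun _ => p.tgt) (fun _ => q.tgt) (fun _ => 1) (fun _ => 0) := by
  have e : (p.add t q).u = 1 := by
    change t.sum p.u q.u = 1
    rw [hp, hq, t.sum_one]
  refine ⟨IsoFrame.sum t (.unit β) (.unit β), IsoFrame.sum t (.unit β) (.unit β), ?_, ?_, ?_, ?_⟩
  · rintro (i | i)
    · exact (isExact_t₁ t _ _).mul IsExact.one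
    · exact (isExact_t₂ t _ _).mul IsExact.one
  · rintro (i | i)
    · exact (isExact_t₁ t _ _).mul IsExact.one
    · exact (isExact_t₂ t _ _).mul IsExact.one
  · intro i
    rw [e]
    simp
  · intro i
    rw [e]
    simp

section

variable (t : CuntzIsometries β) (R : IsoFrame β ι) (P : Equiv.Perm ι)
variable {x₁ x₂ y₁ y₂ : ι → CocycleRep α β} {h : ι → 𝓜(ℂ, B)}

/-- The unitary that permutes the summands of a frame. -/
def permUnitary : 𝓜(ℂ, B) := op R (R.reindex P) fun _ => 1

lemma permUnitary_mul_r (i : ι) : permUnitary R P * R.r i = R.r (P i) := by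
  rw [permUnitary, op_mul_r (Bdd.const 1), mul_one]
  rfl

lemma permUnitary_mem_unitary : permUnitary R P ∈ unitary 𝓜(ℂ, B) :=
  op_mem_unitary fun _ => one_mem _

lemma permUnitary_isFixed : IsFixed β (permUnitary R P) := fun g =>
  R.eq_of_mul_eq fun i => by
    have h1 := congrArg (β.mult g) (permUnitary_mul_r R P i)
    rwa [map_mul, R.fixed i g, R.fixed (P i) g, ← permUnitary_mul_r R P i] at h1

lemma permUnitary_one : permUnitary R 1 = 1 :=
  R.eq_of_mul_eq fun i => by rw [permUnitary_mul_r, one_mul]; rfl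

variable {P} in
lemma permUnitary_mul_self (hP : ∀ i, P (P i) = i) : permUnitary R P * permUnitary R P = 1 :=
  R.eq_of_mul_eq fun i => by
    rw [mul_assoc, permUnitary_mul_r, permUnitary_mul_r, hP, one_mul]

variable {P} in
lemma permUnitary_star (hP : ∀ i, P (P i) = i) : star (permUnitary R P) = permUnitary R P := by
  have h1 := (permUnitary_mem_unitary R P).1
  calc star (permUnitary R P) = star (permUnitary R P) * (permUnitary R P * permUnitary R P) := by
        rw [permUnitary_mul_self R hP, mul_one]
    _ = permUnitary R P := by rw [← mul_assoc, h1, one_mul]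

variable {R P} in
lemma commute_permUnitary (hb : Bdd h) (hP : ∀ i, h (P i) = h i) :
    Commute (op R R h) (permUnitary R P) :=
  R.eq_of_mul_eq fun i => by
    rw [mul_assoc, permUnitary_mul_r, op_mul_r hb, mul_assoc, op_mul_r hb, ← mul_assoc,
      permUnitary_mul_r, hP]

/-- A rotation between direct sums. -/
def sumRotation (hm : rotation t (op R R h) (permUnitary R P) ∈
      unitaryHom ((CocycleRep.directSum R x₁).cuntzSum t (CocycleRep.directSum R x₂))
        ((CocycleRep.directSum R y₁).cuntzSum t (CocycleRep.directSum R y₂))) :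
    ModUnitary α β := ⟨_, _, _, hm⟩

/-- Reindexing the second half of the frame by `P` absorbs the unitary off the diagonal. The
summands `x₂` and `y₂` are permuted in return; the angles are unaffected since `h` is invariant
under `P`. -/
lemma sumRotation_isRotation (hh : ∀ i, IsPosContr (h i)) (hP : ∀ i, h (P i) = h i)
    (hm : rotation t (op R R h) (permUnitary R P) ∈
      unitaryHom ((CocycleRep.directSum R x₁).cuntzSum t (CocycleRep.directSum R x₂))
        ((CocycleRep.directSum R y₁).cuntzSum t (CocycleRep.directSum R y₂))) :
    (sumRotation t R P hm).IsRotation x₁ (x₂ ∘ P) y₁ (y₂ ∘ P)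
      (fun i => psqrt (1 - h i)) (fun i => psqrt (h i)) := by
  have hst (i : ι) : star (permUnitary R P) * R.r (P i) = R.r i := by
    rw [← permUnitary_mul_r R P, ← mul_assoc, (permUnitary_mem_unitary R P).1, one_mul]
  let F : IsoFrame β (ι ⊕ ι) := (IsoFrame.sum t R (R.reindex P))
  have hl (i : ι) : F.r (.inl i) = t.t₁ * R.r i := rfl
  have hr (i : ι) : F.r (.inr i) = t.t₂ * R.r (P i) := rfl
  refine ⟨F, F, ?_, ?_, fun i => ?_, fun i => ?_⟩
  · rintro (i | i)
    · exact (isExact_t₁ t _ _).mul (isExact_r R x₁ i)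
    · exact (isExact_t₂ t _ _).mul (isExact_r R x₂ (P i))
  · rintro (i | i)
    · exact (isExact_t₁ t _ _).mul (isExact_r R y₁ i)
    · exact (isExact_t₂ t _ _).mul (isExact_r R y₂ (P i))
  · change rotation t _ _ * _ = _
    rw [hl, hr, rotation, ← mul_assoc, t.mat_mul_t₁, add_mul, mul_assoc, psqrt_one_sub_op_mul_r hh,
      mul_neg, neg_mul, mul_assoc, mul_assoc, psqrt_op_mul_r hh, ← mul_assoc (permUnitary R P),
      permUnitary_mul_r, ← sub_eq_add_neg]
    simp only [mul_assoc]
  · change rotation t _ _ * _ = _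
    rw [hl, hr, rotation, ← mul_assoc, t.mat_mul_t₂, add_mul, mul_assoc, mul_assoc, hst,
      psqrt_op_mul_r hh, mul_assoc, psqrt_one_sub_op_mul_r hh, hP]
    simp only [mul_assoc]

end

end DirectSum

/-! ### Stable operator homotopy from homotopy invariance -/

section Reduction

variable {G : Type*} [Group G] [TopologicalSpace G]
variable {A : Type*} [NonUnitalCStarAlgebra A] {B : Type*} [NonUnitalCStarAlgebra B]
variable {α : CStarAction G A} {β : CStarAction G B}

open ModClass

namespace IsCuntzPair

variable {x y : CocycleRep α β}

lemma val_sub (h : IsCuntzPair x y) (τ : A ⊕ G) : InIdeal (x.val τ - y.val τ) := by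
  rcases τ with a | g
  · exact h.hom_sub a
  · exact h.coc_sub g

/-- The two representations agree modulo the ideal. Unitary intertwiners from `x` to `y` modulo `B`
are thus the unitaries of the algebra attached to `x`. -/
lemma isHom_iff (h : IsCuntzPair x y) {m : 𝓜(ℂ, B)} : IsHom x y m ↔ IsHom x x m := by
  refine forall_congr' fun τ => ?_
  have e : m * x.val τ - y.val τ * twist A β τ m
      = m * x.val τ - x.val τ * twist A β τ m + (x.val τ - y.val τ) * twist A β τ m := by
    noncomm_ring
  rw [e]
  have h' := (h.val_sub τ).mul_right (twist A β τ m)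
  exact ⟨fun h1 => by simpa using h1.sub h', fun h1 => h1.add h'⟩

end IsCuntzPair

lemma mem_dualSet_iff {x : CocycleRep α β} {m : 𝓜(ℂ, B)} : m ∈ x.dualSet ↔ IsHom x x m := by
  have e (g : G) : m - x.coc g * β.mult g m * star (x.coc g)
      = (m * x.coc g - x.coc g * β.mult g m) * star (x.coc g) := by
    rw [sub_mul, mul_assoc m, x.coc_mul_star, mul_one]
  constructor
  · rintro ⟨h, h'⟩ (a | g)
    · exact h' a
    · have := (h g).mul_right (x.coc g)
      rwa [e, mul_assoc, x.star_mul_coc, mul_one] at this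
  · intro h
    refine ⟨fun g => ?_, fun a => h (.inl a)⟩
    rw [e]
    exact (h (.inr g)).mul_right _

lemma IsExact.isConjugate {x y : CocycleRep α β} {w : 𝓜(ℂ, B)} (h : IsExact x y w)
    (hw : w ∈ unitary 𝓜(ℂ, B)) : CocycleRep.IsConjugate w x y := by
  constructor
  · intro a
    have h1 : w * x.hom a = y.hom a * w := h (.inl a)
    rw [h1, mul_assoc, hw.2, mul_one]
  · intro g
    have h1 : w * x.coc g = y.coc g * β.mult g w := h (.inr g)
    rw [h1, mul_assoc, ← map_star, ← map_mul, hw.2, map_one, mul_one]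

namespace CuntzPair

/-- The identity of `𝓜(B)`, as a unitary intertwiner of the two parts of a Cuntz pair. -/
def toModUnitary (p : CuntzPair α β) : ModUnitary α β where
  src := p.left
  tgt := p.right
  u := 1
  mem := ⟨one_mem _, p.isCuntzPair.isHom_iff.mpr IsExact.one.isHom⟩

variable (t : CuntzIsometries β)

/-- The class of a Cuntz pair. -/
def modClass (p : CuntzPair α β) : ModClass α t := ModClass.mk t p.toModUnitary

lemma modClass_congr {p q : CuntzPair α β} (h : ∀ τ, p.left.val τ = q.left.val τ)
    (h' : ∀ τ, p.right.val τ = q.right.val τ) : p.modClass t = q.modClass t :=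
  mk_eq (p := p.toModUnitary) (q := q.toModUnitary) ⟨1, 1, one_mem _, one_mem _,
    fun τ => by simp [toModUnitary, h], fun τ => by simp [toModUnitary, h'],
    by simp [toModUnitary]⟩

lemma modClass_cuntzSum (t' : CuntzIsometries β) (p q : CuntzPair α β) :
    (p.cuntzSum t' q).modClass t = p.modClass t + q.modClass t := by
  have h : ModClass.mk t (p.toModUnitary.add t' q.toModUnitary) = p.modClass t + q.modClass t :=
    mk_eq (ModUnitary.Iso.add_change t' t _ _)
  rw [← h]
  refine mk_eq ⟨1, 1, one_mem _, one_mem _, IsExact.one, IsExact.one, ?_⟩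
  simp [toModUnitary, ModUnitary.add, t'.sum_one]

/-- After adding `z`, the unitary of the pair is still `1`, and the set of intertwiners is the
unitary group of the algebra of the left part. A path from `1` to an exact `w` places `w` in the
component of `1`, and exactness means conjugacy by `w`. -/
lemma operatorHomotopic_of_isStablyTrivial (p : CuntzPair α β)
    (h : IsStablyTrivial (p.modClass t)) : p.left.StablyOperatorHomotopic p.right := by
  obtain ⟨z, hz⟩ := h
  refine ⟨⟨t⟩, z, fun t' => ?_⟩
  have h1 : ModUnitary.HomotopicToExact (p.toModUnitary.add t (.id z)) :=
    isTrivial_mk (t := t).mp hz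
  obtain ⟨w, hw, hj⟩ := h1.congr (ModUnitary.Iso.add_change t t' _ _)
  have hp : IsCuntzPair (p.left.cuntzSum t' z) (p.right.cuntzSum t' z) :=
    (p.cuntzSum t' ⟨z, z, fun a => by simpa using InIdeal.zero,
      fun a => by simpa using InIdeal.zero⟩).isCuntzPair
  have hS : unitaryHom (p.left.cuntzSum t' z) (p.right.cuntzSum t' z)
      = {w | w ∈ unitary 𝓜(ℂ, B) ∧ w ∈ (p.left.cuntzSum t' z).dualSet} := by
    ext m
    exact and_congr_right fun _ => hp.isHom_iff.trans mem_dualSet_iff.symm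
  have hj' : JoinedIn {w | w ∈ unitary 𝓜(ℂ, B) ∧ w ∈ (p.left.cuntzSum t' z).dualSet} 1 w := by
    rw [← hS]
    have h2 : (p.toModUnitary.add t' (.id z)).u = 1 := t'.sum_one
    rw [h2] at hj
    exact hj
  refine ⟨w, ?_, hw.isConjugate hj'.target_mem.1⟩
  exact (isPathConnected_pathComponentIn hj'.source_mem).isConnected.isPreconnected
    |>.subset_connectedComponentIn (mem_pathComponentIn_self hj'.source_mem)
      pathComponentIn_subset hj'

lemma evMult_zero (s : unitInterval) : evMult s (0 : 𝓜(ℂ, C(unitInterval, B))) = 0 := by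
  ext b <;> rfl

lemma Homotopic.cocyclePair {p q : CuntzPair α β} (h : p.Homotopic q) :
    p.cocyclePair.Homotopic q.cocyclePair := by
  obtain ⟨P, h1, h2, h3, h4⟩ := h
  exact ⟨P.cocyclePair, ⟨fun _ => evMult_zero _, h1.2⟩, ⟨fun _ => evMult_zero _, h2.2⟩,
    ⟨fun _ => evMult_zero _, h3.2⟩, ⟨fun _ => evMult_zero _, h4.2⟩⟩

lemma modClass_cocyclePair_cuntzSum (t' : CuntzIsometries β) {p d : CuntzPair α β}
    (hd : d.IsCocyclePair) :
    (p.cuntzSum t' d).cocyclePair.modClass t = p.cocyclePair.modClass t + d.modClass t := by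
  rw [← modClass_cuntzSum t t']
  refine modClass_congr t ?_ ?_
  · rintro (a | g)
    · change (0 : 𝓜(ℂ, B)) = t'.sum 0 (d.left.hom a)
      rw [hd.1]
      simp [CuntzIsometries.sum]
    · rfl
  · rintro (a | g)
    · change (0 : 𝓜(ℂ, B)) = t'.sum 0 (d.right.hom a)
      rw [hd.2]
      simp [CuntzIsometries.sum]
    · rfl

/-- A pair and its cocycle pair change by the same class when a cocycle pair is added, so the formal
difference is unaffected. Homotopies restrict to cocycle pairs, so homotopy invariance applies to
both terms. -/
lemma Equivalent.isStablyTrivial_iff (hom_inv : ∀ p q : CuntzPair α β, p.Homotopic q →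
    IsStablyTrivial (p.modClass t + -q.modClass t)) {p q : CuntzPair α β} (h : p.Equivalent q) :
    IsStablyTrivial (p.modClass t + -p.cocyclePair.modClass t) ↔
      IsStablyTrivial (q.modClass t + -q.cocyclePair.modClass t) := by
  obtain ⟨t', d₁, d₂, hd₁, hd₂, h⟩ := h
  have h1 := hom_inv _ _ h
  have h2 := hom_inv _ _ h.cocyclePair
  rw [modClass_cuntzSum, modClass_cuntzSum] at h1
  rw [modClass_cocyclePair_cuntzSum t t' hd₁, modClass_cocyclePair_cuntzSum t t' hd₂] at h2
  have key : ∀ P P' Q Q' D₁ D₂ : ModClass α t, IsStablyTrivial (P + D₁ + -(Q + D₂)) →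
      IsStablyTrivial (P' + D₁ + -(Q' + D₂)) → IsStablyTrivial (P + -P') →
      IsStablyTrivial (Q + -Q') := by
    intro P P' Q Q' D₁ D₂ h1 h2 h3
    -- The negative of a stably trivial class is stably trivial by cancellation. The sum of the
    -- three classes is then `Q + -Q'` plus four classes of the form `c + -c`.
    have h1' : IsStablyTrivial (-(P + D₁ + -(Q + D₂))) := by
      refine IsStablyTrivial.of_add (d := P + D₁ + -(Q + D₂)) ?_ h1
      rw [add_comm]
      exact isStablyTrivial_add_neg _
    have h4 := (h1'.add h2).add h3
    refine IsStablyTrivial.of_add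
      (d := (P + -P) + (D₁ + -D₁) + (D₂ + -D₂) + (P' + -P')) ?_
      (((isStablyTrivial_add_neg _).add (isStablyTrivial_add_neg _)).add
        (isStablyTrivial_add_neg _) |>.add (isStablyTrivial_add_neg _))
    simp only [ModClass.neg_add, ModClass.neg_neg] at h4
    generalize -P = nP, -P' = nP', -Q' = nQ', -D₁ = nD₁, -D₂ = nD₂ at h4 ⊢
    convert h4 using 1
    ac_rfl
  refine ⟨key _ _ _ _ _ _ h1 h2, key _ _ _ _ (d₂.modClass t) (d₁.modClass t) ?_ ?_⟩
  · refine IsStablyTrivial.of_add (d := p.modClass t + d₁.modClass t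
      + -(q.modClass t + d₂.modClass t)) ?_ h1
    have := (isStablyTrivial_add_neg (p.modClass t + d₁.modClass t)).add
      (isStablyTrivial_add_neg (q.modClass t + d₂.modClass t))
    convert this using 1
    ac_rfl
  · refine IsStablyTrivial.of_add (d := p.cocyclePair.modClass t + d₁.modClass t
      + -(q.cocyclePair.modClass t + d₂.modClass t)) ?_ h2
    have := (isStablyTrivial_add_neg (p.cocyclePair.modClass t + d₁.modClass t)).add
      (isStablyTrivial_add_neg (q.cocyclePair.modClass t + d₂.modClass t))
    convert this using 1
    ac_rfl

lemma stablyOperatorHomotopic_of_mk_eq_zero (hom_inv : ∀ p q : CuntzPair α β, p.Homotopic q →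
    IsStablyTrivial (p.modClass t + -q.modClass t)) {p : CuntzPair α β} (hp : p.Anchored)
    (h0 : KKG.mk p = 0) : p.left.StablyOperatorHomotopic p.right := by
  refine operatorHomotopic_of_isStablyTrivial t p ?_
  have h1 : IsStablyTrivial (p.modClass t + -p.cocyclePair.modClass t) := by
    -- Equality in the quotient gives a chain of equivalences in either direction, which is why the
    -- invariance above is stated as an equivalence.
    have h2 : Relation.EqvGen Equivalent p (zero α β) := Quot.eqvGen_exact h0
    have h3 : IsStablyTrivial (p.modClass t + -p.cocyclePair.modClass t) ↔
        IsStablyTrivial ((zero α β).modClass t + -(zero α β).cocyclePair.modClass t) := by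
      clear hp h0
      generalize zero α β = q at h2
      induction h2 with
      | rel _ _ h => exact h.isStablyTrivial_iff t hom_inv
      | refl _ => exact Iff.rfl
      | symm _ _ _ ih => exact ih.symm
      | trans _ _ _ _ _ ih ih' => exact ih.trans ih'
    rw [h3]
    have h4 : (zero α β).cocyclePair.modClass t = (zero α β).modClass t :=
      modClass_congr t (fun τ => by rcases τ with a | g <;> rfl)
        (fun τ => by rcases τ with a | g <;> rfl)
    rw [h4]
    exact isStablyTrivial_add_neg _
  have hz : (zero α β).modClass t = ModClass.mk t (ModUnitary.id (CocycleRep.zero α β)) := rfl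
  have hz' : -(zero α β).modClass t = ModClass.mk t (ModUnitary.id (CocycleRep.zero α β)) := by
    rw [hz, ← mk_symm]
    refine mk_eq ⟨1, 1, one_mem _, one_mem _, IsExact.one, IsExact.one, ?_⟩
    simp [ModUnitary.id, ModUnitary.symm]
  have h5 : IsStablyTrivial (p.cocyclePair.modClass t) := by
    refine IsStablyTrivial.of_add (hom_inv _ _ hp) ?_
    rw [hz']
    exact (isTrivial_id _).isStablyTrivial
  refine IsStablyTrivial.of_add ?_ (isStablyTrivial_add_neg (p.cocyclePair.modClass t))
  have := h1.add h5
  convert this using 1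
  ac_rfl

end CuntzPair

end Reduction

/-! ### Dyadic shifts of the rational points of the interval -/

section Dyadic

/-- The rational numbers in `[0, 1)`. -/
abbrev UnitRat : Type := {q : ℚ // 0 ≤ q ∧ q < 1}

namespace UnitRat

/-- A rational number in `[0, 1)` as a point of the interval. -/
def pt (q : UnitRat) : unitInterval :=
  ⟨((q : ℚ) : ℝ), by exact_mod_cast q.2.1, by exact_mod_cast q.2.2.le⟩

/-- The integer multiples of `2⁻ᵏ`. -/
def grid (k : ℕ) : Set UnitRat := {q | ∃ n : ℕ, (q : ℚ) = n / 2 ^ k}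

lemma finite_grid (k : ℕ) : (grid k).Finite := by
  refine Set.Finite.of_finite_image (f := fun q : UnitRat => (q : ℚ)) ?_
    Subtype.val_injective.injOn
  refine ((Finset.range (2 ^ k)).finite_toSet.image fun n : ℕ => (n : ℚ) / 2 ^ k).subset ?_
  rintro _ ⟨q, ⟨n, hn⟩, rfl⟩
  refine ⟨n, ?_, hn.symm⟩
  have h := q.2.2
  rw [hn, div_lt_one (by positivity)] at h
  rw [Finset.coe_range, Set.mem_Iio]
  exact_mod_cast h

lemma grid_subset (k : ℕ) : grid k ⊆ grid (k + 1) := by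
  rintro q ⟨n, hn⟩
  refine ⟨2 * n, ?_⟩
  rw [hn, pow_succ]
  push_cast
  field_simp

lemma add_le_one {k : ℕ} {q : UnitRat} (h : q ∈ grid k) : (q : ℚ) + 1 / 2 ^ k ≤ 1 := by
  obtain ⟨n, hn⟩ := h
  have h := q.2.2
  rw [hn, div_lt_one (by positivity)] at h
  have h' : n + 1 ≤ 2 ^ k := by exact_mod_cast h
  rw [hn, ← add_div, div_le_one (by positivity)]
  exact_mod_cast h'

lemma sub_of_mem {k : ℕ} {q : UnitRat} (h : q ∈ grid (k + 1)) (h' : q ∉ grid k) :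
    ∃ n : ℕ, (q : ℚ) - 1 / 2 ^ (k + 1) = n / 2 ^ k := by
  obtain ⟨n, hn⟩ := h
  rcases Nat.even_or_odd' n with ⟨m, rfl | rfl⟩
  · refine absurd ⟨m, ?_⟩ h'
    rw [hn, pow_succ]
    push_cast
    field_simp
  · refine ⟨m, ?_⟩
    rw [hn, pow_succ]
    push_cast
    field_simp
    ring

lemma odd_notMem {k : ℕ} {q : UnitRat} {n : ℕ} (h : (q : ℚ) = n / 2 ^ k + 1 / 2 ^ (k + 1)) :
    q ∉ grid k := by
  rintro ⟨m, hm⟩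
  rw [hm, pow_succ] at h
  field_simp at h
  have h' : 2 * m = 2 * n + 1 := by
    have : (2 : ℚ) * m = 2 * n + 1 := by linarith
    exact_mod_cast this
  omega

open Classical in
/-- The shift by `2⁻ᵏ` on the multiples of `2⁻ᵏ`. -/
def shift (k : ℕ) (q : UnitRat) : unitInterval :=
  if h : q ∈ grid k then
    ⟨((q : ℚ) + 1 / 2 ^ k : ℚ), by have := q.2.1; exact_mod_cast (by positivity),
      by exact_mod_cast add_le_one h⟩
  else q.pt

lemma shift_of_mem {k : ℕ} {q : UnitRat} (h : q ∈ grid k) :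
    (shift k q : ℝ) = ((q : ℚ) + 1 / 2 ^ k : ℚ) := by rw [shift, dif_pos h]

lemma shift_of_notMem {k : ℕ} {q : UnitRat} (h : q ∉ grid k) : shift k q = q.pt := dif_neg h

lemma dist_shift_le (k : ℕ) (q : UnitRat) : dist q.pt (shift k q) ≤ 1 / 2 ^ k := by
  by_cases h : q ∈ grid k
  · rw [Subtype.dist_eq, shift_of_mem h, dist_comm, Real.dist_eq]
    have : ((((q : ℚ) + 1 / 2 ^ k : ℚ) : ℝ) - (q.pt : ℝ)) = 1 / 2 ^ k := by
      simp [pt]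
    rw [this, abs_of_nonneg (by positivity)]
  · rw [shift_of_notMem h, dist_self]
    positivity

open Classical in
/-- The involution relating the shifts by `2⁻ᵏ` and by `2⁻ᵏ⁻¹`. -/
def swapFun (k : ℕ) (q : UnitRat) : UnitRat :=
  if h : q ∈ grid k then
    ⟨q + 1 / 2 ^ (k + 1), by have := q.2.1; positivity, by
      have h1 := add_le_one h
      have h2 : (1 : ℚ) / 2 ^ k = 2 * (1 / 2 ^ (k + 1)) := by rw [pow_succ]; field_simp
      have h3 : (0 : ℚ) < 1 / 2 ^ (k + 1) := by positivity
      linarith⟩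
  else if h' : q ∈ grid (k + 1) then
    ⟨q - 1 / 2 ^ (k + 1), by
      obtain ⟨n, hn⟩ := sub_of_mem h' h
      rw [hn]
      positivity, by
      have h3 : (0 : ℚ) < 1 / 2 ^ (k + 1) := by positivity
      linarith [q.2.2]⟩
  else q

lemma swapFun_of_mem {k : ℕ} {q : UnitRat} (h : q ∈ grid k) :
    (swapFun k q : ℚ) = q + 1 / 2 ^ (k + 1) := by rw [swapFun, dif_pos h]

lemma swapFun_of_mem_succ {k : ℕ} {q : UnitRat} (h : q ∉ grid k) (h' : q ∈ grid (k + 1)) :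
    (swapFun k q : ℚ) = q - 1 / 2 ^ (k + 1) := by rw [swapFun, dif_neg h, dif_pos h']

lemma swapFun_of_notMem {k : ℕ} {q : UnitRat} (h : q ∉ grid (k + 1)) : swapFun k q = q := by
  rw [swapFun, dif_neg fun h' => h (grid_subset k h'), dif_neg h]

lemma swapFun_mem {k : ℕ} {q : UnitRat} (h : q ∈ grid k) :
    swapFun k q ∉ grid k ∧ swapFun k q ∈ grid (k + 1) := by
  obtain ⟨n, hn⟩ := id h
  have h1 : (swapFun k q : ℚ) = n / 2 ^ k + 1 / 2 ^ (k + 1) := by rw [swapFun_of_mem h, hn]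
  refine ⟨odd_notMem h1, 2 * n + 1, ?_⟩
  rw [h1, pow_succ]
  push_cast
  field_simp

lemma swapFun_mem_grid {k : ℕ} {q : UnitRat} (h : q ∉ grid k) (h' : q ∈ grid (k + 1)) :
    swapFun k q ∈ grid k := by
  obtain ⟨n, hn⟩ := sub_of_mem h' h
  exact ⟨n, by rw [swapFun_of_mem_succ h h', hn]⟩

lemma swapFun_involutive (k : ℕ) : Function.Involutive (swapFun k) := fun q => by
  by_cases h : q ∈ grid k
  · apply Subtype.ext
    rw [swapFun_of_mem_succ (swapFun_mem h).1 (swapFun_mem h).2, swapFun_of_mem h]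
    ring
  · by_cases h' : q ∈ grid (k + 1)
    · apply Subtype.ext
      rw [swapFun_of_mem (swapFun_mem_grid h h'), swapFun_of_mem_succ h h']
      ring
    · rw [swapFun_of_notMem h', swapFun_of_notMem h']

/-- On a multiple `q` of `2⁻ᵏ` the swap already moves by half a step and lands on a point fixed by
`shift k`. On an odd multiple of `2⁻ᵏ⁻¹` it goes half a step back, and `shift k` then moves a full
step forward. In both cases the net displacement is half a step. -/
lemma shift_swapFun (k : ℕ) (q : UnitRat) : shift k (swapFun k q) = shift (k + 1) q := by
  apply Subtype.ext
  by_cases h : q ∈ grid k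
  · rw [shift_of_notMem (swapFun_mem h).1, shift_of_mem (grid_subset k h)]
    change ((swapFun k q : ℚ) : ℝ) = _
    rw [swapFun_of_mem h]
  · by_cases h' : q ∈ grid (k + 1)
    · rw [shift_of_mem (swapFun_mem_grid h h'), shift_of_mem h', swapFun_of_mem_succ h h']
      have : (1 : ℚ) / 2 ^ k = 2 * (1 / 2 ^ (k + 1)) := by rw [pow_succ]; field_simp
      rw [this]
      push_cast
      ring
    · rw [swapFun_of_notMem h', shift_of_notMem h', shift_of_notMem fun h1 => h' (grid_subset k h1)]

lemma swapFun_mem_grid_succ (k : ℕ) (q : UnitRat) :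
    swapFun k q ∈ grid (k + 1) ↔ q ∈ grid (k + 1) := by
  have key (q : UnitRat) (hq : q ∈ grid (k + 1)) : swapFun k q ∈ grid (k + 1) := by
    by_cases h : q ∈ grid k
    · exact (swapFun_mem h).2
    · exact grid_subset k (swapFun_mem_grid h hq)
  refine ⟨fun h => ?_, key q⟩
  have := key _ h
  rwa [swapFun_involutive k q] at this

instance : Zero UnitRat := ⟨⟨0, le_rfl, one_pos⟩⟩

lemma coe_zero' : ((0 : UnitRat) : ℚ) = 0 := rfl

lemma pt_zero : pt 0 = 0 := by
  apply Subtype.ext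
  simp [pt, coe_zero']

lemma mem_grid_zero {q : UnitRat} : q ∈ grid 0 ↔ q = 0 := by
  constructor
  · rintro ⟨n, hn⟩
    have h := q.2.2
    rw [hn, pow_zero, div_one] at h
    have h0 : n = 0 := by
      have : n < 1 := by exact_mod_cast h
      omega
    subst h0
    apply Subtype.ext
    rw [hn, coe_zero']
    simp
  · rintro rfl
    exact ⟨0, by simp [coe_zero']⟩

lemma shift_zero_zero : shift 0 0 = 1 := by
  apply Subtype.ext
  rw [shift_of_mem (mem_grid_zero.mpr rfl), coe_zero']
  simp

/-- Splitting off the first row of `ℕ × [0, 1)`, and the point `0` in it. -/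
def splitEquiv : (Unit ⊕ {q : UnitRat // q ≠ 0}) ⊕ (ℕ × UnitRat) ≃ ℕ × UnitRat :=
  Equiv.ofBijective
    (Sum.elim (Sum.elim (fun _ => (0, 0)) fun q => (0, q.1)) fun i => (i.1 + 1, i.2)) <| by
  constructor
  · rintro ((i | i) | i) ((j | j) | j) h
    · rfl
    · exact absurd (congrArg Prod.snd h).symm j.2
    · exact absurd (congrArg Prod.fst h) (Nat.succ_ne_zero _).symm
    · exact absurd (congrArg Prod.snd h) i.2
    · exact congrArg (Sum.inl ∘ Sum.inr) (Subtype.ext (congrArg Prod.snd h))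
    · exact absurd (congrArg Prod.fst h) (Nat.succ_ne_zero _).symm
    · exact absurd (congrArg Prod.fst h) (Nat.succ_ne_zero _)
    · exact absurd (congrArg Prod.fst h) (Nat.succ_ne_zero _)
    · obtain ⟨h1, h2⟩ := Prod.ext_iff.mp h
      exact congrArg Sum.inr (Prod.ext (Nat.succ_injective h1) h2)
  · rintro ⟨_ | k, q⟩
    · by_cases hq : q = 0
      · exact ⟨.inl (.inl ()), by rw [hq]; rfl⟩
      · exact ⟨.inl (.inr ⟨q, hq⟩), rfl⟩
    · exact ⟨.inr (k, q), rfl⟩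

end UnitRat

end Dyadic

/-! ### Homotopy invariance -/

section Swindle

variable {G : Type*} [Group G] [TopologicalSpace G]
variable {A : Type*} [NonUnitalCStarAlgebra A] {B : Type*} [NonUnitalCStarAlgebra B]
variable {α : CStarAction G A} {β : CStarAction G B} {D : Type*}

open IsoFrame ModClass

/-- The data for a rotation between infinite direct sums of values of `X` and `Y`: points `pt q` of
the interval and shifted points `W k q`, which differ only for `q` in the finite set `E k`. -/
structure IsSwindle (X Y : CocycleRep α β.cyl) (pt : D → unitInterval)
    (W : ℕ → D → unitInterval) (E : ℕ → Set D) (e : ℕ → B) (δ : ℕ → ℝ) : Prop where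
  finite : ∀ k, (E k).Finite
  isPosContr : ∀ k, IsPosContr (e k : 𝓜(ℂ, B))
  tendsto : ∀ b, Filter.Tendsto (fun k => e k * b) Filter.atTop (nhds b)
  eq_pt : ∀ k q, q ∉ E k → W k q = pt q
  dist_le : ∀ k q, dist (pt q) (W k q) ≤ δ k
  central₁ : ∀ τ, ∀ ε > 0, ∀ᶠ k in Filter.atTop, X.AlmostCentral (e k) (δ k) ε τ
  central₂ : ∀ τ, ∀ ε > 0, ∀ᶠ k in Filter.atTop, Y.AlmostCentral (e k) (δ k) ε τ

open Classical in
/-- The diagonal entries of the rotation. -/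
def swindleEntry (E : ℕ → Set D) (e : ℕ → B) (i : ℕ × D) : 𝓜(ℂ, B) :=
  if i.2 ∈ E i.1 then (e i.1 : 𝓜(ℂ, B)) else 1

lemma swindleEntry_of_mem {E : ℕ → Set D} {e : ℕ → B} {k : ℕ} {q : D} (h : q ∈ E k) :
    swindleEntry E e (k, q) = e k := if_pos h

lemma swindleEntry_of_notMem {E : ℕ → Set D} {e : ℕ → B} {k : ℕ} {q : D} (h : q ∉ E k) :
    swindleEntry E e (k, q) = 1 := if_neg h

lemma isPosContr_swindleEntry {E : ℕ → Set D} {e : ℕ → B}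
    (he : ∀ k, IsPosContr (e k : 𝓜(ℂ, B))) (i : ℕ × D) : IsPosContr (swindleEntry E e i) := by
  rw [swindleEntry]
  split_ifs
  · exact he _
  · exact IsPosContr.one

/-- A family of elements of `B`, supported in the finite sets `E k` and tending to zero uniformly,
adds up to an element of `B`. -/
lemma op_inIdeal_of_rows {R : IsoFrame β (ℕ × D)} {E : ℕ → Set D} (hE : ∀ k, (E k).Finite)
    {z : ℕ × D → 𝓜(ℂ, B)} (h0 : ∀ k q, q ∉ E k → z (k, q) = 0)
    (hz : ∀ k, ∀ q ∈ E k, InIdeal (z (k, q)))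
    (hlim : ∀ ε > 0, ∀ᶠ k in Filter.atTop, ∀ q ∈ E k, ‖z (k, q)‖ ≤ ε) :
    InIdeal (op R R z) := by
  refine op_inIdeal (fun i => ?_) ?_
  · by_cases h : i.2 ∈ E i.1
    · exact hz _ _ h
    · have : z i = 0 := h0 _ _ h
      rw [this]
      exact InIdeal.zero
  · rw [Metric.tendsto_nhds]
    intro ε hε
    obtain ⟨N, hN⟩ := Filter.eventually_atTop.mp (hlim (ε / 2) (half_pos hε))
    rw [Filter.eventually_cofinite]
    refine ((Set.finite_Iio N).biUnion fun k _ => (hE k).image (Prod.mk k)).subset ?_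
    rintro ⟨k, q⟩ hkq
    have hkq' : ε ≤ ‖z (k, q)‖ := by simpa using hkq
    by_cases hq : q ∈ E k
    · refine Set.mem_biUnion (show k < N from ?_) ⟨q, hq, rfl⟩
      by_contra! hk
      linarith [hN k hk q hq]
    · rw [h0 k q hq, norm_zero] at hkq'
      linarith

section

variable {R : IsoFrame β (ℕ × D)} {E : ℕ → Set D} {e : ℕ → B} {w w' : ℕ × D → unitInterval}

/-- Entries `1` commute with everything. The remaining entries give values of defects, which lie in
`B` and tend to zero along the rows, with finitely many in each row. -/
lemma isHom_op_swindleEntry (hE : ∀ k, (E k).Finite) (he : ∀ k, IsPosContr (e k : 𝓜(ℂ, B)))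
    (X : CocycleRep α β.cyl) {δ : ℕ → ℝ}
    (h : ∀ τ, ∀ ε > 0, ∀ᶠ k in Filter.atTop, X.AlmostCentral (e k) (δ k) ε τ) :
    IsHom (CocycleRep.directSum R fun i => X.eval (w i))
      (CocycleRep.directSum R fun i => X.eval (w i)) (op R R (swindleEntry E e)) := fun τ => by
  have hb := bdd_of_isPosContr (isPosContr_swindleEntry (E := E) he)
  have hv := CocycleRep.bdd_val (fun i => X.eval (w i)) τ
  rw [CocycleRep.val_directSum, op_twist τ hb, op_mul_op hv hb, op_mul_op (hb.twist τ) hv,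
    ← op_sub (hb.mul hv) (hv.mul (hb.twist τ))]
  have key (k : ℕ) (q : D) (hq : q ∈ E k) :
      swindleEntry E e (k, q) * (X.eval (w (k, q))).val τ
        - (X.eval (w (k, q))).val τ * twist A β τ (swindleEntry E e (k, q))
      = (X.defect τ (constCLM B (e k)) (w (k, q)) : B) := by
    rw [swindleEntry_of_mem hq, X.val_eval, ← evHom_coe, X.coe_defect, map_sub, map_mul, map_mul,
      evHom_twist, evHom_coe]
    rfl
  refine op_inIdeal_of_rows hE (fun k q hq => ?_) (fun k q hq => ?_) fun ε hε => ?_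
  · rw [swindleEntry_of_notMem hq]
    simp
  · rw [key k q hq]
    exact inIdeal_coe _
  · filter_upwards [h τ ε hε] with k hk q hq
    rw [key k q hq, norm_coe]
    exact (ContinuousMap.norm_coe_le_norm _ _).trans hk.defect_le

/-- The difference of `X` and `Y` at `τ` is an element `c` of `B[0,1]`. The approximate unit acts on
it uniformly over the interval, so the entries, which are values of `c - e k c`, tend to zero. -/
lemma diag_op_swindleEntry (hE : ∀ k, (E k).Finite) (he : ∀ k, IsPosContr (e k : 𝓜(ℂ, B)))
    (hlim : ∀ b, Filter.Tendsto (fun k => e k * b) Filter.atTop (nhds b))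
    {X Y : CocycleRep α β.cyl} (hXY : IsCuntzPair X Y) (τ : A ⊕ G) :
    InIdeal ((1 - op R R (swindleEntry E e))
      * ((CocycleRep.directSum R fun i => X.eval (w i)).val τ
        - (CocycleRep.directSum R fun i => Y.eval (w i)).val τ)) := by
  have hb := bdd_of_isPosContr (isPosContr_swindleEntry (E := E) he)
  have hv := CocycleRep.bdd_val (fun i => X.eval (w i)) τ
  have hv' := CocycleRep.bdd_val (fun i => Y.eval (w i)) τ
  obtain ⟨c, hc⟩ := hXY.val_sub τ
  have e1 : (1 : 𝓜(ℂ, B)) - op R R (swindleEntry E e)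
      = op R R fun i => 1 - swindleEntry E e i := by rw [op_sub (Bdd.const 1) hb, op_one]
  rw [CocycleRep.val_directSum, CocycleRep.val_directSum, e1, ← op_sub hv hv',
    op_mul_op (hv.sub hv') ((Bdd.const 1).sub hb)]
  have key (k : ℕ) (q : D) (hq : q ∈ E k) : (1 - swindleEntry E e (k, q))
      * ((X.eval (w (k, q))).val τ - (Y.eval (w (k, q))).val τ)
      = ((c - constCLM B (e k) * c) (w (k, q)) : B) := by
    rw [swindleEntry_of_mem hq, X.val_eval, Y.val_eval, ← map_sub, hc, evHom_coe, sub_mul, one_mul,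
      ← coe_mul_coe, ← coe_sub]
    rfl
  refine op_inIdeal_of_rows hE (fun k q hq => ?_) (fun k q hq => ?_) fun ε hε => ?_
  · rw [swindleEntry_of_notMem hq]
    simp
  · rw [key k q hq]
    exact inIdeal_coe _
  · have h1 := tendsto_constCLM_mul (fun k => (he k).coe_norm_le) hlim c
    rw [tendsto_iff_norm_sub_tendsto_zero] at h1
    filter_upwards [h1.eventually (gt_mem_nhds hε)] with k hk q hq
    rw [key k q hq, norm_coe]
    refine (ContinuousMap.norm_coe_le_norm _ _).trans ?_
    rw [norm_sub_rev]
    exact hk.le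

/-- At unmoved points the two values of `X` agree. At moved points, multiplication by `e k` gives a
function with values in `B` that varies little over the distance `δ k`. -/
lemma cross_op_swindleEntry (hE : ∀ k, (E k).Finite) (he : ∀ k, IsPosContr (e k : 𝓜(ℂ, B)))
    (X : CocycleRep α β.cyl) {δ : ℕ → ℝ}
    (h : ∀ τ, ∀ ε > 0, ∀ᶠ k in Filter.atTop, X.AlmostCentral (e k) (δ k) ε τ)
    (hw : ∀ k q, q ∉ E k → w' (k, q) = w (k, q))
    (hd : ∀ k q, dist (w (k, q)) (w' (k, q)) ≤ δ k) (τ : A ⊕ G) :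
    InIdeal (op R R (swindleEntry E e)
      * (1 * (CocycleRep.directSum R fun i => X.eval (w i)).val τ
        - (CocycleRep.directSum R fun i => X.eval (w' i)).val τ * 1)) := by
  have hb := bdd_of_isPosContr (isPosContr_swindleEntry (E := E) he)
  have hv := CocycleRep.bdd_val (fun i => X.eval (w i)) τ
  have hv' := CocycleRep.bdd_val (fun i => X.eval (w' i)) τ
  rw [one_mul, mul_one, CocycleRep.val_directSum, CocycleRep.val_directSum, ← op_sub hv hv',
    op_mul_op (hv.sub hv') hb]
  have key' (k : ℕ) (s : unitInterval) : (e k : 𝓜(ℂ, B)) * evHom s (X.val τ)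
      = ((X.val τ).snd (constCLM B (e k)) s : B) := by
    rw [← evHom_coe, ← coe_mul, map_mul, evHom_coe]
    rfl
  have key (k : ℕ) (q : D) (hq : q ∈ E k) : swindleEntry E e (k, q)
      * ((X.eval (w (k, q))).val τ - (X.eval (w' (k, q))).val τ)
      = ((X.val τ).snd (constCLM B (e k)) (w (k, q))
        - (X.val τ).snd (constCLM B (e k)) (w' (k, q)) : B) := by
    rw [swindleEntry_of_mem hq, X.val_eval, X.val_eval, mul_sub, key', key', coe_sub]
  refine op_inIdeal_of_rows hE (fun k q hq => ?_) (fun k q hq => ?_) fun ε hε => ?_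
  · rw [hw k q hq, sub_self, mul_zero]
  · rw [key k q hq]
    exact inIdeal_coe _
  · filter_upwards [h τ ε hε] with k hk q hq
    rw [key k q hq, norm_coe]
    exact hk.dist_le _ _ (hd k q)

end

lemma IsSwindle.rotates {X Y : CocycleRep α β.cyl} {pt : D → unitInterval}
    {W : ℕ → D → unitInterval} {E : ℕ → Set D} {e : ℕ → B} {δ : ℕ → ℝ}
    (h : IsSwindle X Y pt W E e δ) (hXY : IsCuntzPair X Y) (R : IsoFrame β (ℕ × D)) :
    Rotates (CocycleRep.directSum R fun i => X.eval (pt i.2))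
      (CocycleRep.directSum R fun i => Y.eval (W i.1 i.2))
      (CocycleRep.directSum R fun i => Y.eval (pt i.2))
      (CocycleRep.directSum R fun i => X.eval (W i.1 i.2)) (op R R (swindleEntry E e)) 1 := by
  have hYX : IsCuntzPair Y X :=
    ⟨fun a => by simpa using (hXY.hom_sub a).neg, fun g => by simpa using (hXY.coc_sub g).neg⟩
  exact ⟨isHom_op_swindleEntry h.finite h.isPosContr Y h.central₂,
    isHom_op_swindleEntry h.finite h.isPosContr X h.central₁,
    isHom_op_swindleEntry h.finite h.isPosContr Y h.central₂,
    diag_op_swindleEntry h.finite h.isPosContr h.tendsto hXY,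
    diag_op_swindleEntry h.finite h.isPosContr h.tendsto hYX,
    cross_op_swindleEntry h.finite h.isPosContr X h.central₁ (fun k q hq => h.eq_pt k q hq)
      h.dist_le,
    cross_op_swindleEntry h.finite h.isPosContr Y h.central₂ (fun k q hq => h.eq_pt k q hq)
      h.dist_le⟩

lemma val_directSum_mul_permUnitary {ι : Type*} (R : IsoFrame β ι) (P : Equiv.Perm ι)
    (x : ι → CocycleRep α β) (τ : A ⊕ G) :
    (CocycleRep.directSum R x).val τ * permUnitary R P
      = permUnitary R P * (CocycleRep.directSum R (x ∘ P)).val τ := by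
  refine R.eq_of_mul_eq fun i => ?_
  rw [CocycleRep.val_directSum, CocycleRep.val_directSum, mul_assoc, permUnitary_mul_r,
    op_mul_r (CocycleRep.bdd_val x τ), mul_assoc, op_mul_r (CocycleRep.bdd_val (x ∘ P) τ),
    ← mul_assoc, permUnitary_mul_r]
  rfl

/-- Permuting the second summands. -/
lemma Rotates.permUnitary {ι : Type*} {R : IsoFrame β ι} {P : Equiv.Perm ι} {H : 𝓜(ℂ, B)}
    {x₁ y₁ : CocycleRep α β} {x₂ y₂ : ι → CocycleRep α β}
    (h : Rotates x₁ (CocycleRep.directSum R x₂) y₁ (CocycleRep.directSum R y₂) H 1)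
    (h' : Rotates x₁ (CocycleRep.directSum R (x₂ ∘ P)) y₁ (CocycleRep.directSum R (y₂ ∘ P)) H 1)
    (hc : Commute H (permUnitary R P)) :
    Rotates x₁ (CocycleRep.directSum R x₂) y₁ (CocycleRep.directSum R y₂) H
      (CuntzThomsen.permUnitary R P) := by
  have e (a b : 𝓜(ℂ, B)) : H * (CuntzThomsen.permUnitary R P * a - CuntzThomsen.permUnitary R P * b)
      = CuntzThomsen.permUnitary R P * (H * (1 * a - b * 1)) := by
    rw [← mul_sub, ← mul_assoc, hc.eq, mul_assoc, one_mul, mul_one]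
  refine ⟨h.isHom_tgt₁, h.isHom_tgt₂, h.isHom_src₂, h.diag₁, h.diag₂, fun τ => ?_, fun τ => ?_⟩
  · rw [val_directSum_mul_permUnitary, e]
    exact (h'.cross₁ τ).mul_left _
  · rw [val_directSum_mul_permUnitary, e]
    exact (h'.cross₂ τ).mul_left _

lemma CocycleRep.ext_val {x y : CocycleRep α β} (h : ∀ τ, x.val τ = y.val τ) : x = y := by
  have h1 : x.hom = y.hom := DFunLike.ext _ _ fun a => h (.inl a)
  have h2 : x.coc = y.coc := funext fun g => h (.inr g)
  cases x
  cases y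
  cases h1
  cases h2
  rfl

end Swindle

/-! ### Homotopy invariance by a dyadic swindle -/

section HomotopyInvariance

variable {G : Type*} [Group G] [TopologicalSpace G]
variable {A : Type*} [NonUnitalCStarAlgebra A] {B : Type*} [NonUnitalCStarAlgebra B]
variable {α : CStarAction G A} {β : CStarAction G B}

open IsoFrame ModClass

/-- The sum of the pairs `(x i, y i)` and `(y i, x i)`, with the exact rotation by a right angle. -/
lemma exists_exact_isRotation {ι : Type*} (t : CuntzIsometries β) (R : IsoFrame β ι)
    (x y : ι → CocycleRep α β) :
    ∃ p : ModUnitary α β, IsTrivial (mk t p) ∧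
      p.IsRotation x y y x (fun _ => 0) (fun _ => 1) := by
  have e : rotation t (op R R fun _ => 1) (permUnitary R 1) = t.mat 0 1 (-1) 0 := by
    rw [rotation, op_one, permUnitary_one, sub_self, psqrt_zero, psqrt_one, star_one, mul_one]
  have hex : IsExact ((CocycleRep.directSum R x).cuntzSum t (CocycleRep.directSum R y))
      ((CocycleRep.directSum R y).cuntzSum t (CocycleRep.directSum R x))
      (rotation t (op R R fun _ => 1) (permUnitary R 1)) := by
    rw [e]
    exact IsExact.mat t (IsExact.zero _ _) IsExact.one IsExact.one.neg (IsExact.zero _ _)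
  have hm : rotation t (op R R fun _ => 1) (permUnitary R 1) ∈
      unitaryHom ((CocycleRep.directSum R x).cuntzSum t (CocycleRep.directSum R y))
        ((CocycleRep.directSum R y).cuntzSum t (CocycleRep.directSum R x)) := by
    refine ⟨?_, hex.isHom⟩
    rw [op_one, permUnitary_one]
    exact rotation_mem_unitary t IsPosContr.one (one_mem _) (Commute.one_left 1)
  refine ⟨sumRotation t R 1 hm, isTrivial_mk.mpr (ModUnitary.HomotopicToExact.of_isExact hex), ?_⟩
  have h := sumRotation_isRotation t R 1 (fun _ => IsPosContr.one) (fun _ => rfl) hm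
  simpa only [sub_self, psqrt_zero, psqrt_one, Equiv.Perm.coe_one, Function.comp_id] using h

/-- Two rotations whose shifts are related by an involution have the same class, up to stably
trivial classes. -/
lemma exists_isRotation_of_isSwindle {D : Type*} (hB : IsSigmaUnital B) (t : CuntzIsometries β)
    (R : IsoFrame β (ℕ × D)) {X Y : CocycleRep α β.cyl} (hXY : IsCuntzPair X Y)
    {pt : D → unitInterval} {W W' : ℕ → D → unitInterval} {E E' : ℕ → Set D} {e e' : ℕ → B}
    {δ δ' : ℕ → ℝ} (h₁ : IsSwindle X Y pt W E e δ) (h₂ : IsSwindle X Y pt W E' e' δ')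
    (h₃ : IsSwindle X Y pt W' E' e' δ') {P : Equiv.Perm (ℕ × D)} (hPP : ∀ i, P (P i) = i)
    (hPW : ∀ i, W (P i).1 (P i).2 = W' i.1 i.2)
    (hPE : ∀ i, swindleEntry E' e' (P i) = swindleEntry E' e' i) :
    ∃ p q : ModUnitary α β, IsStablyTrivial (mk t p + -mk t q) ∧
      p.IsRotation (fun i => X.eval (pt i.2)) (fun i => Y.eval (W i.1 i.2))
        (fun i => Y.eval (pt i.2)) (fun i => X.eval (W i.1 i.2))
        (fun i => psqrt (1 - swindleEntry E e i)) (fun i => psqrt (swindleEntry E e i)) ∧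
      q.IsRotation (fun i => X.eval (pt i.2)) (fun i => Y.eval (W' i.1 i.2))
        (fun i => Y.eval (pt i.2)) (fun i => X.eval (W' i.1 i.2))
        (fun i => psqrt (1 - swindleEntry E' e' i)) (fun i => psqrt (swindleEntry E' e' i)) := by
  have hh₁ (i) := isPosContr_swindleEntry (E := E) h₁.isPosContr i
  have hh₂ (i) := isPosContr_swindleEntry (E := E') h₂.isPosContr i
  have hH₁ := isPosContr_op (R := R) hh₁
  have hH₂ := isPosContr_op (R := R) hh₂
  have hcomm := commute_permUnitary (R := R) (bdd_of_isPosContr hh₂) hPE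
  have hshift (Z : CocycleRep α β.cyl) :
      (fun i : ℕ × D => Z.eval (W i.1 i.2)) ∘ P = fun i => Z.eval (W' i.1 i.2) :=
    funext fun i => congrArg Z.eval (hPW i)
  have r₁ := h₁.rotates hXY R
  have r₂ := h₂.rotates hXY R
  have r₃ := h₃.rotates hXY R
  -- With `P` off the diagonal, the cross conditions for shifts `W` are those with `1` off the
  -- diagonal for the permuted shifts `W'`, which is the third swindle.
  have rP := r₂.permUnitary (P := P) (by rw [hshift, hshift]; exact r₃) hcomm
  have m₁ := r₁.rotation_mem t hB hH₁ IsFixed.one (one_mem _) (Commute.one_right _)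
  have m₃ := r₃.rotation_mem t hB hH₂ IsFixed.one (one_mem _) (Commute.one_right _)
  rw [← permUnitary_one R] at m₁ m₃
  have mP := rP.rotation_mem t hB hH₂ (permUnitary_isFixed R _) (permUnitary_mem_unitary R _) hcomm
  have i₁ := sumRotation_isRotation t R 1 hh₁ (fun _ => rfl) m₁
  have i₃ := sumRotation_isRotation t R 1 hh₂ (fun _ => rfl) m₃
  have iP := sumRotation_isRotation t R P hh₂ hPE mP
  rw [hshift, hshift] at iP
  rw [Equiv.Perm.coe_one, Function.comp_id, Function.comp_id] at i₁ i₃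
  refine ⟨_, _, ?_, i₁, i₃⟩
  -- Up to exact equivalence, the rotation with `P` has the summands and angles of the rotation for
  -- `W'`.
  have hP : mk t (sumRotation t R P mP) = mk t (sumRotation t R 1 m₃) := mk_eq (iP.iso i₃)
  -- The shifts stay fixed along the path: the angles change first, and then the unitary off the
  -- diagonal moves from `1` to `P`.
  have j := (r₁.joinedIn t r₂ hB hH₁ hH₂).trans (r₂.joinedIn_symmetry t rP hB hH₂
    (permUnitary_isFixed R _) (permUnitary_star R hPP) (permUnitary_mul_self R hPP) hcomm)
  rw [← permUnitary_one R] at j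
  refine isStablyTrivial_of_joinedIn j m₁ mP (c := -mk t (sumRotation t R 1 m₃)) ?_
  change IsStablyTrivial (mk t (sumRotation t R P mP) + _)
  rw [hP]
  exact isStablyTrivial_add_neg _

/-- The involution of `ℕ × [0, 1)` that relates the shifts of consecutive levels. -/
def swapPerm : Equiv.Perm (ℕ × UnitRat) where
  toFun i := (i.1, UnitRat.swapFun i.1 i.2)
  invFun i := (i.1, UnitRat.swapFun i.1 i.2)
  left_inv i := Prod.ext rfl (UnitRat.swapFun_involutive i.1 i.2)
  right_inv i := Prod.ext rfl (UnitRat.swapFun_involutive i.1 i.2)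

lemma swindleEntry_swapPerm (e : ℕ → B) (i : ℕ × UnitRat) :
    swindleEntry (fun k => UnitRat.grid (k + 1)) e (swapPerm i)
      = swindleEntry (fun k => UnitRat.grid (k + 1)) e i := by
  obtain ⟨k, q⟩ := i
  have hiff := UnitRat.swapFun_mem_grid_succ k q
  by_cases h : q ∈ UnitRat.grid (k + 1)
  · exact (if_pos (hiff.mpr h)).trans (if_pos h).symm
  · exact (if_neg (mt hiff.mp h)).trans (if_neg h).symm

/-- The second swindle is intermediate: it has the shifts of the first and the entries of the third.
Its points are moved by up to `2⁻ᵏ` at entry level `k + 1`, so the bound `δ` has to be twice the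
step length. -/
lemma exists_isSwindle [IsTopologicalGroup G] [SigmaCompactSpace G]
    [TopologicalSpace.SeparableSpace A] (hB : IsSigmaUnital B) (X Y : CocycleRep α β.cyl) :
    ∃ (e : ℕ → B) (δ : ℕ → ℝ), e 0 = 0 ∧
      IsSwindle X Y UnitRat.pt UnitRat.shift UnitRat.grid e δ ∧
      IsSwindle X Y UnitRat.pt UnitRat.shift (fun k => UnitRat.grid (k + 1))
        (fun k => e (k + 1)) (fun k => δ (k + 1)) ∧
      IsSwindle X Y UnitRat.pt (fun k => UnitRat.shift (k + 1)) (fun k => UnitRat.grid (k + 1))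
        (fun k => e (k + 1)) fun k => δ (k + 1) := by
  have hδ : Filter.Tendsto (fun k : ℕ => 2 * (1 / (2 : ℝ) ^ k)) Filter.atTop (nhds 0) := by
    have h := (tendsto_pow_atTop_nhds_zero_of_lt_one (r := (1 / 2 : ℝ)) (by norm_num)
      (by norm_num)).const_mul 2
    simpa using h
  obtain ⟨e, he0, hep, het, hec⟩ := exists_adapted_sequence hB (fun b => cond b X Y) hδ
  have hδ' (k : ℕ) : 2 * (1 / (2 : ℝ) ^ (k + 1)) = 1 / 2 ^ k := by rw [pow_succ]; field_simp
  have hpow (k : ℕ) : (0 : ℝ) < 1 / 2 ^ k := by positivity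
  have shift_tendsto (b : B) : Filter.Tendsto (fun k => e (k + 1) * b) Filter.atTop (nhds b) :=
    (het b).comp (Filter.tendsto_add_atTop_nat 1)
  have shift_central (b : Bool) (τ : A ⊕ G) (ε : ℝ) (hε : ε > 0) : ∀ᶠ k in Filter.atTop,
      (cond b X Y).AlmostCentral (e (k + 1)) (2 * (1 / (2 : ℝ) ^ (k + 1))) ε τ :=
    (Filter.tendsto_add_atTop_nat 1).eventually (hec b τ ε hε)
  refine ⟨e, fun k => 2 * (1 / 2 ^ k), he0, ?_, ?_, ?_⟩
  · exact ⟨UnitRat.finite_grid, hep, het, fun k q h => UnitRat.shift_of_notMem h,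
      fun k q => (UnitRat.dist_shift_le k q).trans (by linarith [hpow k]), hec true, hec false⟩
  · exact ⟨fun k => UnitRat.finite_grid _, fun k => hep _, shift_tendsto,
      fun k q h => UnitRat.shift_of_notMem fun h' => h (UnitRat.grid_subset k h'),
      fun k q => (UnitRat.dist_shift_le k q).trans (hδ' k).ge, shift_central true,
      shift_central false⟩
  · exact ⟨fun k => UnitRat.finite_grid _, fun k => hep _, shift_tendsto,
      fun k q h => UnitRat.shift_of_notMem h,
      fun k q => (UnitRat.dist_shift_le (k + 1) q).trans (by linarith [hpow (k + 1)]),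
      shift_central true, shift_central false⟩

lemma comp_splitEquiv {Z : Type*} (f : ℕ × UnitRat → Z) {a : Z} {g : {q : UnitRat // q ≠ 0} → Z}
    {h : ℕ × UnitRat → Z} (ha : f (0, 0) = a) (hg : ∀ q, f (0, q.1) = g q)
    (hh : ∀ k q, f (k + 1, q) = h (k, q)) :
    f ∘ UnitRat.splitEquiv = Sum.elim (Sum.elim (fun _ => a) g) h := by
  ext1 ((i | i) | i)
  · exact ha
  · exact hg i
  · exact hh i.1 i.2

lemma nonempty_unitRat_ne_zero : Nonempty {q : UnitRat // q ≠ 0} :=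
  ⟨⟨⟨1 / 2, by norm_num, by norm_num⟩, fun h => by
    have := congrArg (fun q : UnitRat => (q : ℚ)) h
    rw [UnitRat.coe_zero'] at this
    norm_num at this⟩⟩

/-- The rotation `p₁` with shifts of level `k` in row `k` and the rotation `p₃` with levels raised
by one have the same stable class. On the other hand, removing row `0` from `p₁` leaves `p₃`, so row
`0` is stably trivial. -/
lemma isStablyTrivial_of_homotopic [IsTopologicalGroup G] [SigmaCompactSpace G]
    [TopologicalSpace.SeparableSpace A] (hB : IsSigmaUnital B) (hβ : StronglyStable β)
    (t : CuntzIsometries β) {p q : CuntzPair α β} (hpq : p.Homotopic q) :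
    IsStablyTrivial (p.modClass t + -q.modClass t) := by
  obtain ⟨⟨X, Y, hXY⟩, hX0, hY0, hX1, hY1⟩ := hpq
  have eX0 : X.eval 0 = p.left := CocycleRep.ext_val hX0.val_eq
  have eY0 : Y.eval 0 = p.right := CocycleRep.ext_val hY0.val_eq
  have eX1 : X.eval 1 = q.left := CocycleRep.ext_val hX1.val_eq
  have eY1 : Y.eval 1 = q.right := CocycleRep.ext_val hY1.val_eq
  obtain ⟨e, δ, he0, D₁, D₂, D₃⟩ := exists_isSwindle hB X Y
  obtain ⟨R⟩ := exists_isoFrame hB hβ (ℕ × UnitRat)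
  have := nonempty_unitRat_ne_zero
  obtain ⟨S⟩ := exists_isoFrame hB hβ {q : UnitRat // q ≠ 0}
  obtain ⟨p₁, p₃, h₁, i₁, i₃⟩ := exists_isRotation_of_isSwindle hB t R hXY D₁ D₂ D₃
    (P := swapPerm) swapPerm.left_inv (fun i => UnitRat.shift_swapFun i.1 i.2)
    (swindleEntry_swapPerm _)
  obtain ⟨E, hE, iE⟩ := exists_exact_isRotation t S (fun q => X.eval q.1.pt) fun q => Y.eval q.1.pt
  -- Row `0` at the point `0` has entry `e 0 = 0` and goes from the parameter `0` to `1`. It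
  -- contributes `p` and the adjoint of `q`. The other points of row `0` are fixed with entry `1`,
  -- which gives the exact rotation `E`.
  have h₂ : mk t p₁ = p.modClass t + -q.modClass t + mk t E + mk t p₃ := by
    have i₄ := ((ModUnitary.isRotation_add t (p := p.toModUnitary) (q := q.toModUnitary.symm) rfl
      (star_one _)).add t iE).add t i₃
    have hs (i : {q : UnitRat // q ≠ 0}) : i.1 ∉ UnitRat.grid 0 := fun h =>
      i.2 (UnitRat.mem_grid_zero.mp h)
    have hz : (0 : UnitRat) ∈ UnitRat.grid 0 := UnitRat.mem_grid_zero.mpr rfl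
    have i₅ := i₁.reindex UnitRat.splitEquiv
    rw [comp_splitEquiv (fun i : ℕ × UnitRat => X.eval i.2.pt) (a := p.left)
        (g := fun i => X.eval i.1.pt) (h := fun i => X.eval i.2.pt)
        (by rw [UnitRat.pt_zero, eX0]) (fun _ => rfl) (fun _ _ => rfl),
      comp_splitEquiv (fun i : ℕ × UnitRat => Y.eval i.2.pt) (a := p.right)
        (g := fun i => Y.eval i.1.pt) (h := fun i => Y.eval i.2.pt)
        (by rw [UnitRat.pt_zero, eY0]) (fun _ => rfl) (fun _ _ => rfl),
      comp_splitEquiv (fun i : ℕ × UnitRat => X.eval (UnitRat.shift i.1 i.2)) (a := q.left)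
        (g := fun i => X.eval i.1.pt) (h := fun i => X.eval (UnitRat.shift (i.1 + 1) i.2))
        (by rw [UnitRat.shift_zero_zero, eX1])
        (fun i => by rw [UnitRat.shift_of_notMem (hs i)]) (fun _ _ => rfl),
      comp_splitEquiv (fun i : ℕ × UnitRat => Y.eval (UnitRat.shift i.1 i.2)) (a := q.right)
        (g := fun i => Y.eval i.1.pt) (h := fun i => Y.eval (UnitRat.shift (i.1 + 1) i.2))
        (by rw [UnitRat.shift_zero_zero, eY1])
        (fun i => by rw [UnitRat.shift_of_notMem (hs i)]) (fun _ _ => rfl),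
      comp_splitEquiv (fun i => psqrt (1 - swindleEntry UnitRat.grid e i)) (a := 1)
        (g := fun _ => 0) (h := fun i => psqrt (1 - swindleEntry (fun k => UnitRat.grid (k + 1))
          (fun k => e (k + 1)) i))
        (by rw [swindleEntry_of_mem hz, he0, coe_zero, sub_zero, psqrt_one])
        (fun i => by rw [swindleEntry_of_notMem (hs i), sub_self, psqrt_zero]) (fun _ _ => rfl),
      comp_splitEquiv (fun i => psqrt (swindleEntry UnitRat.grid e i)) (a := 0)
        (g := fun _ => 1) (h := fun i => psqrt (swindleEntry (fun k => UnitRat.grid (k + 1))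
          (fun k => e (k + 1)) i))
        (by rw [swindleEntry_of_mem hz, he0, coe_zero, psqrt_zero])
        (fun i => by rw [swindleEntry_of_notMem (hs i), psqrt_one]) (fun _ _ => rfl)] at i₅
    exact mk_eq (i₅.iso i₄)
  rw [h₂] at h₁
  refine IsStablyTrivial.of_add (d := mk t E + (mk t p₃ + -mk t p₃)) ?_
    (hE.isStablyTrivial.add (isStablyTrivial_add_neg _))
  simpa only [add_assoc] using h₁

end HomotopyInvariance

end CuntzThomsen

end

theorem theorem2p6 {G : Type*} [Group G] [TopologicalSpace G] [IsTopologicalGroup G]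
    [LocallyCompactSpace G] [SecondCountableTopology G]
    {A : Type*} [NonUnitalCStarAlgebra A] [TopologicalSpace.SeparableSpace A]
    {B : Type*} [NonUnitalCStarAlgebra B] (hB : CuntzThomsen.IsSigmaUnital B)
    (α : CuntzThomsen.CStarAction G A) (β : CuntzThomsen.CStarAction G B)
    (hβ : CuntzThomsen.StronglyStable β)
    (x y : CuntzThomsen.CocycleRep α β) (hxy : CuntzThomsen.IsCuntzPair x y)
    (hanch : CuntzThomsen.CuntzPair.Anchored ⟨x, y, hxy⟩)
    (hzero : CuntzThomsen.KKG.mk ⟨x, y, hxy⟩ = 0) :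
    CuntzThomsen.CocycleRep.StablyOperatorHomotopic x y := by
  -- A frame with two members supplies the isometries for the semigroup of classes. The conclusion
  -- covers every other choice, since sums for different isometries are exactly equivalent.
  obtain ⟨R⟩ := CuntzThomsen.exists_isoFrame hB hβ Bool
  exact CuntzThomsen.CuntzPair.stablyOperatorHomotopic_of_mk_eq_zero R.toCuntzIsometries
    (p := ⟨x, y, hxy⟩) (fun _ _ h => CuntzThomsen.isStablyTrivial_of_homotopic hB hβ _ h)
    hanch hzero
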